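/- **Setting.** Let $p\in\mathbb N$, $H=\mathbb C^p\otimes L^2(0,\infty)$, and $(\Lambda(A)F)(x)=e^{-x}AF(x)$ for $A\in B(\mathbb C^p)$, $F\in H$; write $\Lambda$ also for the operator $\Lambda(I)$ in $I-\Lambda$. Let $\mathfrak A(\mathbb C^p)=(I-\Lambda)^{1/2}B(H)(I-\Lambda)^{1/2}$. For $t>0$ let $E(t,\infty)$ be the projection of $H$ onto the functions supported in $[t,\infty)$. All maps below are linear. A *$q$-weight map* over $\mathbb C^p$ is a completely positive map $\omega:\mathfrak A(\mathbb C^p)\to B(\mathbb C^p)$ such that each functional $B\mapsto (f,\omega((I-\Lambda)^{1/2}B(I-\Lambda)^{1/2})g)$ with $f,g\in\mathbb C^p$ is $\sigma$-weakly continuous on $B(H)$, and such that, with $\omega|_t(A)=\omega(E(t,\infty)AE(t,\infty))$, for every $t>0$ the map $\iota+\omega|_t\Lambda$ of $B(\mathbb C^p)$ into itself is invertible and $\pi^\#_t=(\iota+\omega|_t\Lambda)^{-1}\omega|_t$ is a completely positive, contractive, normal map from $B(H)$ to $B(\mathbb C^p)$. It is *of index zero* if its normal spine is zero, i.e. $\pi^\#_t(E(s,\infty)AE(s,\infty))\to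 0$ as $t\to0+$ for all $s>0$ and $A\in B(H)$. A $q$-weight map $\eta$ with associated maps $\psi^\#_t$ is a *$q$-subordinate* of $\omega$, written $\omega\ge_q\eta$, if $\pi^\#_t-\psi^\#_t$ is completely positive for all $t>0$; $\omega$ is *$q$-pure* if any two of its $q$-subordinates $\eta_1,\eta_2$ satisfy $\eta_1\ge_q\eta_2$ or $\eta_2\ge_q\eta_1$. If $L$ is a completely positive contractive idempotent map of $B(\mathbb C^p)$ into itself with range $\mathcal L$, then $A\star B=L(AB)$ is the Choi–Effros product on $\mathcal L$, with unit $I_o=L(I)$. A linear subspace $\mathcal L\subset B(\mathbb C^p)$ is a *Choi–Effros factor of type I$_q$* ($q\ge1$) if it is the range of such an $L$ and $(\mathcal L,\star,{}^*)$ is $*$-isomorphic to the algebra of complex $q\times q$ matrices; it is a *factor of type I$_q$* if this holds with the ordinary product in place of $\star$ (the unit of $\mathcal L$ need not be the unit of $B(\mathbb C^p)$). The support projection of $L$ is the smallest projection $F$ with $L(F)=L(I)$; the *maximal support projection* of $\mathcal L$ is the smallest projection $P\in\mathcal L'\cap\mathcal L''$ with $P\ge F$. **Theorem.** Let $\omega$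 be a $q$-weight map of index zero over $\mathbb C^p$ with range $\mathcal L$. 1. If $\mathcal L$ is a Choi–Effros factor of type I$_q$ and $P$ is the maximal support projection of $\mathcal L$, then $\omega$ has a $q$-subordinate $\eta$ whose range is $P\mathcal L=\{PA: A\in\mathcal L\}$. This range is a Choi–Effros factor of type I$_q$ and its Choi–Effros product is the ordinary product of operators. 2. If $\omega\neq0$ is $q$-pure, then for some $q\ge1$ the range $\mathcal L$ is both a Choi–Effros factor and a factor of type I$_q$, $A\star B=AB$ for all $A,B\in\mathcal L$, and the unit $I_o$ of $\mathcal L$ equals the maximal support projection $P$ of $\mathcal L$. The products, the unit and the maximal support projection may be computed with any completely positive contractive idempotent whose range is the subspace in question. -/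

import Mathlib

open MeasureTheory Filter Topology
open scoped ENNReal ComplexOrder InnerProductSpace

namespace QWeight

noncomputable section

/-! ### Completely positive, contractive and normal maps -/

section Maps

variable {E F : Type*} [NormedAddCommGroup E] [InnerProductSpace ℂ E]
  [NormedAddCommGroup F] [InnerProductSpace ℂ F]

/-- The `n × n` operator matrix `[A i j]` is positive as an operator on `E ⊕ ⋯ ⊕ E`. -/
def MatrixPositive {n : ℕ} (A : Fin n → Fin n → E →L[ℂ] E) : Prop :=
  ∀ x : Fin n → E, 0 ≤ ∑ i, ∑ j, ⟪x i, A i j (x j)⟫_ℂ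

/-- Complete positivity of a linear map defined on all of `B(E)`. -/
def IsCompletelyPositive (φ : (E →L[ℂ] E) →ₗ[ℂ] (F →L[ℂ] F)) : Prop :=
  ∀ (n : ℕ) (A : Fin n → Fin n → E →L[ℂ] E),
    MatrixPositive A → MatrixPositive fun i j => φ (A i j)

/-- Complete positivity of a linear map defined on a linear space `S` of operators. -/
def IsCompletelyPositiveOn {S : Submodule ℂ (E →L[ℂ] E)} (φ : S →ₗ[ℂ] (F →L[ℂ] F)) : Prop :=
  ∀ (n : ℕ) (A : Fin n → Fin n → S),
    MatrixPositive (fun i j => (A i j : E →L[ℂ] E)) → MatrixPositive fun i j => φ (A i j)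

/-- The map does not increase the operator norm. -/
def IsContractive (φ : (E →L[ℂ] E) →ₗ[ℂ] (F →L[ℂ] F)) : Prop :=
  ∀ A, ‖φ A‖ ≤ ‖A‖

/-- A `σ`-weakly continuous functional on `B(E)`: one of the form `A ↦ ∑ₖ (Fₖ, A Gₖ)` with
square summable `Fₖ` and `Gₖ`. -/
def IsNormalFunctional (ρ : (E →L[ℂ] E) → ℂ) : Prop :=
  ∃ f g : ℕ → E, Summable (fun k => ‖f k‖ ^ 2) ∧ Summable (fun k => ‖g k‖ ^ 2) ∧
    ∀ A : E →L[ℂ] E, HasSum (fun k => ⟪f k, A (g k)⟫_ℂ) (ρ A)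

/-- A normal linear map `B(E) → B(F)`, where `F` is finite-dimensional in the applications: all
its matrix coefficients are `σ`-weakly continuous. -/
def IsNormalMap (φ : (E →L[ℂ] E) →ₗ[ℂ] (F →L[ℂ] F)) : Prop :=
  ∀ f g : F, IsNormalFunctional fun A => ⟪f, φ A g⟫_ℂ

end Maps

/-! ### The spaces `ℂ^p`, `H = ℂ^p ⊗ L²(0,∞)`, and multiplication operators on `H` -/

/-- Lebesgue measure on `(0,∞)`. -/
abbrev halfLine : Measure ℝ := volume.restrict (Set.Ioi 0)

/-- `B(ℂ^p)`. -/
abbrev Op (p : ℕ) : Type := EuclideanSpace ℂ (Fin p) →L[ℂ] EuclideanSpace ℂ (Fin p)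

/-- `H = ℂ^p ⊗ L²(0,∞)`, the square integrable `ℂ^p`-valued functions on `(0,∞)`. -/
abbrev HSpace (p : ℕ) : Type := Lp (EuclideanSpace ℂ (Fin p)) 2 halfLine

/-- `B(H)`. -/
abbrev HOp (p : ℕ) : Type := HSpace p →L[ℂ] HSpace p

/-- The operator `(M_f F)(x) = f(x) F(x)` on `H`, for `f ∈ L^∞(0,∞)`. -/
def mulOp (p : ℕ) (f : ℝ → ℂ) (hf : MemLp f ∞ halfLine) : HOp p :=
  (ContinuousLinearMap.lsmul ℂ ℂ).holderL halfLine ∞ 2 2 (hf.toLp f)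

theorem mulOp_coeFn (p : ℕ) (f : ℝ → ℂ) (hf : MemLp f ∞ halfLine) (G : HSpace p) :
    mulOp p f hf G =ᵐ[halfLine] fun x => f x • G x := by
  have h1 := (ContinuousLinearMap.lsmul ℂ ℂ (E := EuclideanSpace ℂ (Fin p))).coeFn_holder
    (r := 2) (hf.toLp f) G
  filter_upwards [h1, hf.coeFn_toLp] with x hx hx2
  rw [← hx2]
  exact hx

theorem mulOp_mul (p : ℕ) (f g h : ℝ → ℂ) (hf : MemLp f ∞ halfLine) (hg : MemLp g ∞ halfLine)
    (hh : MemLp h ∞ halfLine) (H : ∀ x, 0 < x → f x * g x = h x) :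
    mulOp p f hf * mulOp p g hg = mulOp p h hh := by
  ext1 G
  apply Lp.ext
  have h0 : ∀ᵐ x ∂halfLine, x ∈ Set.Ioi (0 : ℝ) := ae_restrict_mem measurableSet_Ioi
  filter_upwards [mulOp_coeFn p f hf (mulOp p g hg G), mulOp_coeFn p g hg G,
    mulOp_coeFn p h hh G, h0] with x h1 h2 h3 h4
  rw [mul_apply_eq_comp, h1, h2, h3, smul_smul, H x h4]

theorem memLp_of_bound {f : ℝ → ℝ} (hf : Measurable f) (C : ℝ) (hC : ∀ x, 0 < x → |f x| ≤ C) :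
    MemLp (fun x => (f x : ℂ)) ∞ halfLine := by
  refine memLp_top_of_bound (Complex.measurable_ofReal.comp hf).aestronglyMeasurable C ?_
  have h0 : ∀ᵐ x ∂halfLine, x ∈ Set.Ioi (0 : ℝ) := ae_restrict_mem measurableSet_Ioi
  filter_upwards [h0] with x hx
  rw [Complex.norm_real, Real.norm_eq_abs]
  exact hC x hx

/-- `x ↦ e^{-x}`. -/
def expFun (x : ℝ) : ℝ := Real.exp (-x)

/-- `x ↦ (1 - e^{-x})^{1/2}`. -/
def rootFun (x : ℝ) : ℝ := Real.sqrt (1 - Real.exp (-x))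

/-- The indicator function of `[t,∞)`. -/
def tailFun (t x : ℝ) : ℝ := Set.indicator (Set.Ici t) (fun _ => 1) x

theorem expFun_memLp : MemLp (fun x => (expFun x : ℂ)) ∞ halfLine := by
  refine memLp_of_bound (by unfold expFun; fun_prop) 1 fun x hx => ?_
  rw [expFun, abs_of_pos (Real.exp_pos _), Real.exp_le_one_iff]
  linarith

theorem rootFun_memLp : MemLp (fun x => (rootFun x : ℂ)) ∞ halfLine := by
  refine memLp_of_bound (by unfold rootFun; fun_prop) 1 fun x hx => ?_
  rw [rootFun, abs_of_nonneg (Real.sqrt_nonneg _)]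
  exact Real.sqrt_le_one.2 (by linarith [Real.exp_pos (-x)])

theorem measurable_tailFun (t : ℝ) : Measurable (tailFun t) :=
  measurable_const.indicator measurableSet_Ici

theorem tailFun_memLp (t : ℝ) : MemLp (fun x => (tailFun t x : ℂ)) ∞ halfLine := by
  refine memLp_of_bound (measurable_tailFun t) 1 fun x hx => ?_
  unfold tailFun
  by_cases h : x ∈ Set.Ici t <;> simp [h]

theorem tailFun_div_rootFun_memLp {t : ℝ} (ht : 0 < t) :
    MemLp (fun x => ((tailFun t x / rootFun x : ℝ) : ℂ)) ∞ halfLine := by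
  refine memLp_of_bound ((measurable_tailFun t).div (by unfold rootFun; fun_prop))
    (1 / rootFun t) fun x hx => ?_
  have hpos : 0 < rootFun t := by
    apply Real.sqrt_pos.2
    have : Real.exp (-t) < 1 := by rw [Real.exp_lt_one_iff]; linarith
    linarith
  unfold tailFun
  by_cases h : x ∈ Set.Ici t
  · have hle : rootFun t ≤ rootFun x := by
      apply Real.sqrt_le_sqrt
      have : Real.exp (-x) ≤ Real.exp (-t) := Real.exp_le_exp.2 (by linarith [Set.mem_Ici.1 h])
      linarith
    rw [Set.indicator_of_mem h, abs_of_nonneg (div_nonneg zero_le_one (hpos.le.trans hle))]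
    exact one_div_le_one_div_of_le hpos hle
  · rw [Set.indicator_of_notMem h]
    simp [hpos.le]

/-- `(I - Λ)^{1/2}`, multiplication by `(1 - e^{-x})^{1/2}`. -/
def rootOp (p : ℕ) : HOp p := mulOp p (fun x => (rootFun x : ℂ)) rootFun_memLp

/-- The projection `E(t,∞)` onto the functions supported in `[t,∞)`. -/
def tailProj (p : ℕ) (t : ℝ) : HOp p := mulOp p (fun x => (tailFun t x : ℂ)) (tailFun_memLp t)

/-- The map `Λ : B(ℂ^p) → B(H)`, `(Λ(A) F)(x) = e^{-x} A F(x)`. -/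
def Lam (p : ℕ) : Op p →ₗ[ℂ] HOp p where
  toFun A := mulOp p (fun x => (expFun x : ℂ)) expFun_memLp * A.compLpL 2 halfLine
  map_add' A B := by rw [ContinuousLinearMap.add_compLpL, mul_add]
  map_smul' c A := by rw [ContinuousLinearMap.smul_compLpL, mul_smul_comm, RingHom.id_apply]

/-! ### The space `𝔄(ℂ^p)`, boundary weight maps and cut-offs -/

/-- `𝔄(ℂ^p)`: the operators `(I - Λ)^{1/2} B (I - Λ)^{1/2}` with `B ∈ B(H)`. -/
def bAlg (p : ℕ) : Submodule ℂ (HOp p) :=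
  LinearMap.range (LinearMap.mulLeftRight ℂ (rootOp p, rootOp p))

/-- The map `B ↦ (I - Λ)^{1/2} B (I - Λ)^{1/2}` from `B(H)` onto `𝔄(ℂ^p)`. -/
def toBAlg (p : ℕ) : HOp p →ₗ[ℂ] bAlg p :=
  (LinearMap.mulLeftRight ℂ (rootOp p, rootOp p)).rangeRestrict

theorem tailProj_conj_mem (p : ℕ) {t : ℝ} (ht : 0 < t) (A : HOp p) :
    LinearMap.mulLeftRight ℂ (tailProj p t, tailProj p t) A ∈ bAlg p := by
  have key : ∀ x : ℝ, 0 < x → rootFun x * (tailFun t x / rootFun x) = tailFun t x := by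
    intro x hx
    have hpos : rootFun x ≠ 0 := by
      apply ne_of_gt
      apply Real.sqrt_pos.2
      have : Real.exp (-x) < 1 := by rw [Real.exp_lt_one_iff]; linarith
      linarith
    field_simp
  set D : HOp p := mulOp p (fun x => ((tailFun t x / rootFun x : ℝ) : ℂ))
    (tailFun_div_rootFun_memLp ht) with hD
  have h1 : rootOp p * D = tailProj p t :=
    mulOp_mul p _ _ _ _ _ _ fun x hx => by rw [← Complex.ofReal_mul, key x hx]
  have h2 : D * rootOp p = tailProj p t :=
    mulOp_mul p _ _ _ _ _ _ fun x hx => by rw [← Complex.ofReal_mul, mul_comm, key x hx]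
  refine ⟨D * A * D, ?_⟩
  rw [LinearMap.mulLeftRight_apply, LinearMap.mulLeftRight_apply]
  calc rootOp p * (D * A * D) * rootOp p = (rootOp p * D) * A * (D * rootOp p) := by
        simp only [mul_assoc]
    _ = tailProj p t * A * tailProj p t := by rw [h1, h2]

/-- For `t > 0`, the map `A ↦ A|_t = E(t,∞) A E(t,∞)` from `B(H)` to `𝔄(ℂ^p)`. It is only used
for `t > 0`; elsewhere it is given the value `0`. -/
def cutoff (p : ℕ) (t : ℝ) : HOp p →ₗ[ℂ] bAlg p :=
  if ht : 0 < t then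
    (LinearMap.mulLeftRight ℂ (tailProj p t, tailProj p t)).codRestrict (bAlg p)
      (tailProj_conj_mem p ht)
  else 0

/-- `ω ∈ B(ℂ^p) ⊗ 𝔄(ℂ^p)_*`: all matrix coefficients of the linear map `ω` are boundary weights,
i.e. become `σ`-weakly continuous on `B(H)` after composition with
`B ↦ (I - Λ)^{1/2} B (I - Λ)^{1/2}`. -/
def IsBoundaryWeightMap {p : ℕ} (ω : bAlg p →ₗ[ℂ] Op p) : Prop :=
  IsNormalMap (ω ∘ₗ toBAlg p)

/-- `ω|_t : B(H) → B(ℂ^p)`, `ω|_t(A) = ω(E(t,∞) A E(t,∞))`. -/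
def trunc {p : ℕ} (ω : bAlg p →ₗ[ℂ] Op p) (t : ℝ) : HOp p →ₗ[ℂ] Op p :=
  ω ∘ₗ cutoff p t

/-- The map `ι + ω|_t Λ` of `B(ℂ^p)` into itself. -/
def onePlus {p : ℕ} (ω : bAlg p →ₗ[ℂ] Op p) (t : ℝ) : Module.End ℂ (Op p) :=
  1 + trunc ω t ∘ₗ Lam p

/-- The generalized boundary representation `π_t^# = (ι + ω|_t Λ)⁻¹ ω|_t`. -/
def boundaryRep {p : ℕ} (ω : bAlg p →ₗ[ℂ] Op p) (t : ℝ) : HOp p →ₗ[ℂ] Op p :=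
  Ring.inverse (onePlus ω t) ∘ₗ trunc ω t

/-! ### `q`-weight maps -/

/-- `q`-weight maps over `ℂ^p`. -/
structure IsQWeightMap {p : ℕ} (ω : bAlg p →ₗ[ℂ] Op p) : Prop where
  boundaryWeightMap : IsBoundaryWeightMap ω
  completelyPositive : IsCompletelyPositiveOn ω
  invertible : ∀ t : ℝ, 0 < t → IsUnit (onePlus ω t)
  rep_completelyPositive : ∀ t : ℝ, 0 < t → IsCompletelyPositive (boundaryRep ω t)
  rep_contractive : ∀ t : ℝ, 0 < t → IsContractive (boundaryRep ω t)
  rep_normal : ∀ t : ℝ, 0 < t → IsNormalMap (boundaryRep ω t)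

/-- `ω ≥_q η`: the `q`-weight map `η` is a `q`-subordinate of the `q`-weight map `ω`. -/
def IsQSubordinate {p : ℕ} (ω η : bAlg p →ₗ[ℂ] Op p) : Prop :=
  IsQWeightMap ω ∧ IsQWeightMap η ∧
    ∀ t : ℝ, 0 < t → IsCompletelyPositive (boundaryRep ω t - boundaryRep η t)

/-- `ω` is `q`-pure: its `q`-subordinates are totally ordered. -/
def IsQPure {p : ℕ} (ω : bAlg p →ₗ[ℂ] Op p) : Prop :=
  IsQWeightMap ω ∧ ∀ η₁ η₂ : bAlg p →ₗ[ℂ] Op p, IsQSubordinate ω η₁ → IsQSubordinate ω η₂ →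
    IsQSubordinate η₁ η₂ ∨ IsQSubordinate η₂ η₁

/-- `π₀` is the normal spine of `ω`: the normal completely positive map `π₀ : B(H) → B(ℂ^p)` with
`π_t^#|_s(A) → π₀|_s(A)` as `t → 0+`, for all `s > 0` and `A ∈ B(H)`. -/
def IsNormalSpine {p : ℕ} (ω : bAlg p →ₗ[ℂ] Op p) (π₀ : HOp p →ₗ[ℂ] Op p) : Prop :=
  IsCompletelyPositive π₀ ∧ IsNormalMap π₀ ∧
    ∀ s : ℝ, 0 < s → ∀ A : HOp p,
      Tendsto (fun t => boundaryRep ω t (tailProj p s * A * tailProj p s)) (𝓝[>] 0)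
        (𝓝 (π₀ (tailProj p s * A * tailProj p s)))

/-- `ω` is of index zero: its normal spine is zero. -/
def IsIndexZero {p : ℕ} (ω : bAlg p →ₗ[ℂ] Op p) : Prop :=
  IsNormalSpine ω 0

/-! ### Choi–Effros factors and the maximal support projection -/

/-- `L` is a completely positive contractive idempotent map of `B(ℂ^p)` into itself with range
`ℒ`. Every such `L` gives the Choi–Effros product `A ⋆ B = L(AB)` on `ℒ`, with unit
`I_o = L(I)`. -/
structure IsCEIdempotent {p : ℕ} (L : Op p →ₗ[ℂ] Op p) (ℒ : Submodule ℂ (Op p)) : Prop where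
  completelyPositive : IsCompletelyPositive L
  contractive : IsContractive L
  idempotent : ∀ A, L (L A) = L A
  range_eq : LinearMap.range L = ℒ

/-- `ℒ` is a Choi–Effros factor of type `I_q`, `q ≥ 1`: with the product `A ⋆ B = L(AB)` it is
`*`-isomorphic to the algebra of `q × q` matrices. -/
def IsChoiEffrosFactor {p : ℕ} (q : ℕ) (ℒ : Submodule ℂ (Op p)) : Prop :=
  0 < q ∧ ∃ L : Op p →ₗ[ℂ] Op p, IsCEIdempotent L ℒ ∧
    ∃ Θ : Matrix (Fin q) (Fin q) ℂ ≃ₗ[ℂ] ℒ,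
      (∀ X, (Θ X.conjTranspose : Op p) = star (Θ X : Op p)) ∧
      ∀ X Y, (Θ (X * Y) : Op p) = L ((Θ X : Op p) * (Θ Y : Op p))

/-- `ℒ` is a factor of type `I_q`, `q ≥ 1`, in `B(ℂ^p)`: with the ordinary product of operators it
is `*`-isomorphic to the algebra of `q × q` matrices. Its unit need not be the unit of `B(ℂ^p)`. -/
def IsTypeIFactor {p : ℕ} (q : ℕ) (ℒ : Submodule ℂ (Op p)) : Prop :=
  0 < q ∧ ∃ Θ : Matrix (Fin q) (Fin q) ℂ ≃ₗ[ℂ] ℒ,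
    (∀ X, (Θ X.conjTranspose : Op p) = star (Θ X : Op p)) ∧
    ∀ X Y, (Θ (X * Y) : Op p) = (Θ X : Op p) * (Θ Y : Op p)

/-- `F` is the support projection of `L`: the smallest projection with `L(F) = L(I)`. -/
def IsSupportProjection {p : ℕ} (L : Op p →ₗ[ℂ] Op p) (F : Op p) : Prop :=
  IsLeast {G : Op p | IsStarProjection G ∧ L G = L 1} F

/-- `P` is the maximal support projection of `ℒ`: the smallest projection in `ℒ' ∩ ℒ''` that
dominates the support projection `F` of a completely positive contractive idempotent with
range `ℒ`. -/
def IsMaximalSupportProjection {p : ℕ} (ℒ : Submodule ℂ (Op p)) (P : Op p) : Prop :=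
  ∃ (L : Op p →ₗ[ℂ] Op p) (F : Op p), IsCEIdempotent L ℒ ∧ IsSupportProjection L F ∧
    IsLeast {R : Op p | IsStarProjection R ∧ R ∈ Set.centralizer (ℒ : Set (Op p)) ∧
      R ∈ Set.centralizer (Set.centralizer (ℒ : Set (Op p))) ∧ F ≤ R} P

end

end QWeight

/-! Write Y_r for π_r^# Λ (`repLam ω r`). It is completely positive of norm at most e^{-r}, and ω|_r
= (1 - Y_r)⁻¹ π_r^# is a Neumann series, so ω resembles the total count of a process with steps Y_r.
Since (1 - Y_r) ω|_s(A) = π_r^#(E(s,∞) A E(s,∞)) for r ≤ s, index zero says that Y_r tends to the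
identity on ℒ. Its limit along an ultrafilter is therefore a completely positive contractive
idempotent with range ℒ (`exists_repLam_limit`), and Choi–Effros theory applies.

All subordinates come from one construction (`isQSubordinate_of_splitting`). Let D and D' be
completely positive with D(1) + D'(1) ≤ 1 and D + D' the identity on ℒ. Replacing π_r^# by D π_r^#
changes ω|_r into (1 - u_r) ω|_r, where u_r = (1 - D Y_r)⁻¹ D'. If u is the ultrafilter limit of the
u_r, then (1 - u) ω is a q-subordinate. Its boundary representation at t is (1 - v) π_t^#, where v
is the analogous limit built from the part of Y_r that lives on [r,t).

Statement 1. Take D = P · P and D' = (1 - P) · (1 - P). The range of the subordinate η lies in Pℒ.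
It is not zero, because every completely positive contractive idempotent with range the factor ℒ is
non-zero at P (`map_centralSupport_ne_zero`). A positive map of a factor into itself that is
dominated by the identity is a scalar (`exists_eq_smul`), and this makes the range of η all of Pℒ.
The two products agree on Pℒ because they agree after multiplication by the support projection F,
and the identity passes from F to its central cover P.

Statement 2. Multiplication by F turns ℒ into a *-algebra Fℒ of operators. A non-trivial central
projection of Fℒ would give two incomparable subordinates, so Fℒ is a full matrix algebra
(`exists_isFactorIso`). For the unit (`unit_eq`), compare the cut by P with a subordinate obtained
by scalar stopping, tuned to be too small to dominate the cut. Purity puts the scaled one below the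
cut. Its limit idempotent is the identity on ℒ, so I_o is bounded by an element of Pℒ, which forces
I_o = P. -/

namespace QWeight

/-! ### Completely positive maps: Schwarz inequality, contractivity, limits. -/

section CompletePositivity

variable {E F G : Type*} [NormedAddCommGroup E] [InnerProductSpace ℂ E]
  [NormedAddCommGroup F] [InnerProductSpace ℂ F] [NormedAddCommGroup G] [InnerProductSpace ℂ G]

theorem nonneg_iff_inner [CompleteSpace E] (A : E →L[ℂ] E) :
    0 ≤ A ↔ ∀ x, 0 ≤ ⟪x, A x⟫_ℂ := by
  rw [ContinuousLinearMap.nonneg_iff_isPositive]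
  constructor
  · intro h x
    exact h.inner_nonneg_right x
  · intro h
    rw [ContinuousLinearMap.isPositive_iff_complex]
    intro x
    have hx := h x
    rw [← inner_conj_symm, Complex.le_def] at hx
    simp only [Complex.zero_re, Complex.zero_im, Complex.conj_re, Complex.conj_im] at hx
    refine ⟨?_, hx.1⟩
    apply Complex.ext
    · simp
    · simp only [RCLike.re_to_complex, Complex.ofReal_im]
      linarith [hx.2]

theorem nonneg_of_inner [CompleteSpace E] {A : E →L[ℂ] E} (h : ∀ x, 0 ≤ ⟪x, A x⟫_ℂ) : 0 ≤ A :=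
  (nonneg_iff_inner A).2 h

theorem matrixPositive_zero {n : ℕ} : MatrixPositive fun _ _ : Fin n => (0 : E →L[ℂ] E) := by
  intro x
  simp

theorem MatrixPositive.add {n : ℕ} {A B : Fin n → Fin n → E →L[ℂ] E} (hA : MatrixPositive A)
    (hB : MatrixPositive B) : MatrixPositive fun i j => A i j + B i j := by
  intro x
  have := add_nonneg (hA x) (hB x)
  simpa [← Finset.sum_add_distrib, inner_add_right] using this

theorem MatrixPositive.smul {n : ℕ} {A : Fin n → Fin n → E →L[ℂ] E} (hA : MatrixPositive A)
    {c : ℂ} (hc : 0 ≤ c) : MatrixPositive fun i j => c • A i j := by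
  intro x
  have := mul_nonneg hc (hA x)
  simpa [Finset.mul_sum, inner_smul_right] using this

theorem MatrixPositive.of_tendsto {ι : Type*} {l : Filter ι} [l.NeBot] {n : ℕ}
    {A : ι → Fin n → Fin n → E →L[ℂ] E} {B : Fin n → Fin n → E →L[ℂ] E}
    (h : ∀ i j, Tendsto (fun r => A r i j) l (𝓝 (B i j)))
    (hA : ∀ᶠ r in l, MatrixPositive (A r)) : MatrixPositive B := by
  intro x
  have ht : Tendsto (fun r => ∑ i, ∑ j, ⟪x i, A r i j (x j)⟫_ℂ) l
      (𝓝 (∑ i, ∑ j, ⟪x i, B i j (x j)⟫_ℂ)) := by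
    refine tendsto_finsetSum _ fun i _ => tendsto_finsetSum _ fun j _ => ?_
    have h1 : Tendsto (fun r => A r i j (x j)) l (𝓝 (B i j (x j))) :=
      ((ContinuousLinearMap.apply ℂ E (x j)).continuous.tendsto _).comp (h i j)
    exact tendsto_const_nhds.inner h1
  exact ge_of_tendsto ht (hA.mono fun r hr => hr x)

theorem MatrixPositive.conj [CompleteSpace E] {n : ℕ}
    {A : Fin n → Fin n → E →L[ℂ] E} (hA : MatrixPositive A) (X : E →L[ℂ] E) :
    MatrixPositive fun i j => star X * A i j * X := by
  intro x
  have := hA fun i => X (x i)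
  simpa [ContinuousLinearMap.star_eq_adjoint, ContinuousLinearMap.adjoint_inner_right] using this

theorem matrixPositive_gram [CompleteSpace E] {n : ℕ} (X : Fin n → E →L[ℂ] E) :
    MatrixPositive fun i j => star (X i) * X j := by
  intro x
  have h : ∑ i, ∑ j, ⟪x i, (star (X i) * X j) (x j)⟫_ℂ
      = ⟪∑ i, X i (x i), ∑ j, X j (x j)⟫_ℂ := by
    rw [sum_inner]
    simp only [inner_sum, mul_apply_eq_comp,
      ContinuousLinearMap.star_eq_adjoint, ContinuousLinearMap.adjoint_inner_right]
  rw [h, inner_self_eq_norm_sq_to_K]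
  exact pow_nonneg (Complex.zero_le_real.2 (norm_nonneg (∑ i, X i (x i)))) 2

namespace IsCompletelyPositive

variable {φ ψ : (E →L[ℂ] E) →ₗ[ℂ] (F →L[ℂ] F)}

theorem zero : IsCompletelyPositive (0 : (E →L[ℂ] E) →ₗ[ℂ] (F →L[ℂ] F)) :=
  fun _ _ _ => matrixPositive_zero

theorem id : IsCompletelyPositive (1 : Module.End ℂ (E →L[ℂ] E)) := fun _ _ h => h

theorem add (hφ : IsCompletelyPositive φ) (hψ : IsCompletelyPositive ψ) :
    IsCompletelyPositive (φ + ψ) := fun n A hA => (hφ n A hA).add (hψ n A hA)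

theorem smul (hφ : IsCompletelyPositive φ) {c : ℂ} (hc : 0 ≤ c) :
    IsCompletelyPositive (c • φ) := fun n A hA => (hφ n A hA).smul hc

theorem comp {φ : (E →L[ℂ] E) →ₗ[ℂ] (F →L[ℂ] F)} {χ : (F →L[ℂ] F) →ₗ[ℂ] (G →L[ℂ] G)}
    (hχ : IsCompletelyPositive χ) (hφ : IsCompletelyPositive φ) :
    IsCompletelyPositive (χ ∘ₗ φ) := fun n A hA => hχ n _ (hφ n A hA)

theorem of_tendsto {ι : Type*} {l : Filter ι} [l.NeBot]
    {Φ : ι → (E →L[ℂ] E) →ₗ[ℂ] (F →L[ℂ] F)}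
    (h : ∀ A, Tendsto (fun r => Φ r A) l (𝓝 (φ A)))
    (hΦ : ∀ᶠ r in l, IsCompletelyPositive (Φ r)) : IsCompletelyPositive φ := fun n A hA =>
  MatrixPositive.of_tendsto (fun i j => h (A i j)) (hΦ.mono fun _ hr => hr n A hA)

theorem conj [CompleteSpace E] (X : E →L[ℂ] E) :
    IsCompletelyPositive (LinearMap.mulLeftRight ℂ (star X, X)) := fun n A hA => by
  simpa [LinearMap.mulLeftRight_apply] using hA.conj X

theorem conj' [CompleteSpace E] {X : E →L[ℂ] E} (hX : star X = X) :
    IsCompletelyPositive (LinearMap.mulLeftRight ℂ (X, X)) := by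
  simpa [hX] using conj X

variable [CompleteSpace E] [CompleteSpace F]

theorem nonneg (hφ : IsCompletelyPositive φ) {A : E →L[ℂ] E} (hA : 0 ≤ A) : 0 ≤ φ A := by
  refine nonneg_of_inner fun x => ?_
  have := hφ 1 (fun _ _ => A) (fun y => by
    simpa using (nonneg_iff_inner A).1 hA (y 0)) fun _ => x
  simpa using this

theorem mono (hφ : IsCompletelyPositive φ) {A B : E →L[ℂ] E} (h : A ≤ B) : φ A ≤ φ B := by
  rw [← sub_nonneg, ← map_sub]
  exact hφ.nonneg (sub_nonneg.2 h)

/-- A self-adjoint `A` is the difference of the positive operators `A + ‖A‖` and `‖A‖`. -/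
theorem isSelfAdjoint (hφ : IsCompletelyPositive φ) {A : E →L[ℂ] E} (hA : IsSelfAdjoint A) :
    IsSelfAdjoint (φ A) := by
  have h1 : (0 : E →L[ℂ] E) ≤ A + algebraMap ℝ _ ‖A‖ := by
    have := hA.neg_algebraMap_norm_le_self
    rwa [neg_le_iff_add_nonneg] at this
  have h2 : (0 : E →L[ℂ] E) ≤ algebraMap ℝ _ ‖A‖ := by
    rw [Algebra.algebraMap_eq_smul_one]
    exact smul_nonneg (norm_nonneg _) zero_le_one
  have h3 := (IsSelfAdjoint.of_nonneg (hφ.nonneg h1)).sub (IsSelfAdjoint.of_nonneg (hφ.nonneg h2))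
  rwa [← map_sub, add_sub_cancel_right] at h3

theorem map_star (hφ : IsCompletelyPositive φ) (A : E →L[ℂ] E) : φ (star A) = star (φ A) := by
  have h := realPart_add_I_smul_imaginaryPart A
  have h1 : star (φ (realPart A : E →L[ℂ] E)) = φ (realPart A : E →L[ℂ] E) :=
    hφ.isSelfAdjoint (realPart A).2
  have h2 : star (φ (imaginaryPart A : E →L[ℂ] E)) = φ (imaginaryPart A : E →L[ℂ] E) :=
    hφ.isSelfAdjoint (imaginaryPart A).2
  have h3 : star (realPart A : E →L[ℂ] E) = realPart A := (realPart A).2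
  have h4 : star (imaginaryPart A : E →L[ℂ] E) = imaginaryPart A := (imaginaryPart A).2
  rw [← h]
  simp only [map_add, map_smul, star_add, star_smul, h1, h2, h3, h4]

/-- The Kadison–Schwarz inequality. -/
theorem schwarz (hφ : IsCompletelyPositive φ) (h1 : φ 1 ≤ 1) (A : E →L[ℂ] E) :
    star (φ A) * φ A ≤ φ (star A * A) := by
  rw [← sub_nonneg]
  refine nonneg_of_inner fun x => ?_
  -- The Gram matrix of (1, A) is tested on the vector (-φ(A)x, x). The term ⟪φ(A)x, φ(1)φ(A)x⟫ that
  -- appears is completed to ‖φ(A)x‖² by the hypothesis φ(1) ≤ 1.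
  have key := hφ 2 (fun i j => star ((![1, A] : Fin 2 → E →L[ℂ] E) i) *
    (![1, A] : Fin 2 → E →L[ℂ] E) j) (matrixPositive_gram _) ![-(φ A x), x]
  have h2 := (nonneg_iff_inner _).1 (sub_nonneg.2 h1) (φ A x)
  have h3 := add_nonneg key h2
  have hs : ⟪x, star (φ A) (φ A x)⟫_ℂ = ⟪φ A x, φ A x⟫_ℂ := by
    rw [ContinuousLinearMap.star_eq_adjoint, ContinuousLinearMap.adjoint_inner_right]
  have h4 : star (φ 1) = φ 1 := hφ.isSelfAdjoint (IsSelfAdjoint.one _)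
  simp only [Fin.sum_univ_two, Matrix.cons_val_zero, Matrix.cons_val_one, star_one, one_mul,
    mul_one, hφ.map_star, sub_apply, inner_sub_right, one_apply_eq_self, map_neg, inner_neg_left,
    inner_neg_right, neg_neg, mul_apply_eq_comp, hs, h4] at h3 ⊢
  convert h3 using 1
  ring

/-- By Schwarz and monotonicity, φ(A)*φ(A) ≤ φ(A*A) ≤ ‖A‖² φ(1) ≤ ‖A‖². -/
theorem isContractive (hφ : IsCompletelyPositive φ) (h1 : φ 1 ≤ 1) : IsContractive φ := by
  intro A
  have hA : star A * A ≤ algebraMap ℝ _ (‖A‖ ^ 2) := by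
    have := (IsSelfAdjoint.star_mul_self A).le_algebraMap_norm_self
    rwa [CStarRing.norm_star_mul_self, ← sq] at this
  have h2 : star (φ A) * φ A ≤ algebraMap ℝ _ (‖A‖ ^ 2) := by
    refine (hφ.schwarz h1 A).trans ((hφ.mono hA).trans ?_)
    rw [Algebra.algebraMap_eq_smul_one, Algebra.algebraMap_eq_smul_one,
      ← Complex.coe_smul, ← Complex.coe_smul, map_smul, Complex.coe_smul, Complex.coe_smul]
    exact smul_le_smul_of_nonneg_left h1 (sq_nonneg _)
  have h3 : ‖star (φ A) * φ A‖ ≤ ‖A‖ ^ 2 := by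
    have := CStarAlgebra.norm_le_norm_of_nonneg_of_le (star_mul_self_nonneg _) h2
    refine this.trans ?_
    rw [Algebra.algebraMap_eq_smul_one, norm_smul, Real.norm_of_nonneg (sq_nonneg _)]
    exact mul_le_of_le_one_right (sq_nonneg _) ContinuousLinearMap.norm_id_le
  rw [CStarRing.norm_star_mul_self, ← sq] at h3
  exact le_of_sq_le_sq h3 (norm_nonneg _)

theorem apply_one_le (hφ : IsCompletelyPositive φ) (hc : IsContractive φ) : φ 1 ≤ 1 := by
  have h1 := (hφ.isSelfAdjoint (IsSelfAdjoint.one _)).le_algebraMap_norm_self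
  refine h1.trans ?_
  rw [Algebra.algebraMap_eq_smul_one]
  have h2 : ‖φ 1‖ ≤ 1 := (hc 1).trans ContinuousLinearMap.norm_id_le
  calc ‖φ 1‖ • (1 : F →L[ℂ] F) ≤ (1 : ℝ) • (1 : F →L[ℂ] F) :=
        smul_le_smul_of_nonneg_right h2 zero_le_one
    _ = 1 := one_smul _ _

/-- Every positive multiple cφ also sends 1 to 0, hence is contractive, and c‖φ(A)‖ ≤ ‖A‖ for all c
> 0 leaves only φ(A) = 0. -/
theorem eq_zero_of_apply_one (hφ : IsCompletelyPositive φ) (h1 : φ 1 = 0) : φ = 0 := by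
  ext1 A
  have h2 : ∀ c : ℝ, 0 < c → c * ‖φ A‖ ≤ ‖A‖ := fun c hc => by
    have := (hφ.smul (c := (c : ℂ)) (by exact_mod_cast hc.le)).isContractive
      (by simp [h1]) A
    simpa [norm_smul, abs_of_pos hc] using this
  by_contra hne
  have hpos : 0 < ‖φ A‖ := norm_pos_iff.2 hne
  have := h2 ((‖A‖ + 1) / ‖φ A‖) (by positivity)
  rw [div_mul_cancel₀ _ hpos.ne'] at this
  linarith

end IsCompletelyPositive

end CompletePositivity

end QWeight

namespace QWeight

/-! ### Neumann series, ultrafilter limits and stopped processes. -/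

section Neumann

variable {V : Type*} [NormedAddCommGroup V] [NormedSpace ℂ V]

/-- The linear map `Φ` has norm strictly less than one. -/
def IsStrictContraction (Φ : Module.End ℂ V) : Prop :=
  ∃ c : ℝ, 0 ≤ c ∧ c < 1 ∧ ∀ A, ‖Φ A‖ ≤ c * ‖A‖

/-- `(1 - Φ)⁻¹`, the sum of the Neumann series of `Φ`. -/
noncomputable def neumann (Φ : Module.End ℂ V) : Module.End ℂ V := Ring.inverse (1 - Φ)

theorem IsStrictContraction.comp_left {Φ Ψ : Module.End ℂ V} (hΦ : IsStrictContraction Φ)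
    (hΨ : ∀ A, ‖Ψ A‖ ≤ ‖A‖) : IsStrictContraction (Ψ * Φ) := by
  obtain ⟨c, h0, h1, hc⟩ := hΦ
  exact ⟨c, h0, h1, fun A => (hΨ _).trans (hc A)⟩

theorem IsStrictContraction.injective {Φ : Module.End ℂ V} (hΦ : IsStrictContraction Φ) {A B : V}
    (h : (1 - Φ) A = (1 - Φ) B) : A = B := by
  obtain ⟨c, h0, h1, hc⟩ := hΦ
  have h2 : Φ (A - B) = A - B := by
    have h3 : A - Φ A = B - Φ B := h
    rw [map_sub]
    exact (sub_eq_sub_iff_sub_eq_sub.1 h3).symm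
  have h4 := hc (A - B)
  rw [h2] at h4
  have h5 : ‖A - B‖ = 0 := by nlinarith [norm_nonneg (A - B)]
  exact sub_eq_zero.1 (norm_eq_zero.1 h5)

variable [FiniteDimensional ℂ V]

theorem IsStrictContraction.isUnit {Φ : Module.End ℂ V} (hΦ : IsStrictContraction Φ) :
    IsUnit (1 - Φ) := by
  rw [LinearMap.isUnit_iff_ker_eq_bot, LinearMap.ker_eq_bot]
  exact fun A B h => hΦ.injective h

theorem IsStrictContraction.mul_neumann {Φ : Module.End ℂ V} (hΦ : IsStrictContraction Φ) :
    (1 - Φ) * neumann Φ = 1 := Ring.mul_inverse_cancel _ hΦ.isUnit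

theorem IsStrictContraction.neumann_mul {Φ : Module.End ℂ V} (hΦ : IsStrictContraction Φ) :
    neumann Φ * (1 - Φ) = 1 := Ring.inverse_mul_cancel _ hΦ.isUnit

theorem IsStrictContraction.neumann_apply {Φ : Module.End ℂ V} (hΦ : IsStrictContraction Φ)
    {A B : V} (h : (1 - Φ) A = B) : neumann Φ B = A := by
  have := LinearMap.congr_fun hΦ.neumann_mul A
  rw [Module.End.mul_apply, h] at this
  exact this

theorem IsStrictContraction.sub_neumann_apply {Φ : Module.End ℂ V} (hΦ : IsStrictContraction Φ)
    (A : V) : neumann Φ A - Φ (neumann Φ A) = A :=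
  LinearMap.congr_fun hΦ.mul_neumann A

/-- The geometric sums telescope against 1 - Φ. Writing the inverse as a limit of polynomials in Φ
with positive coefficients is what makes it completely positive when Φ is. -/
theorem IsStrictContraction.tendsto_neumann {Φ : Module.End ℂ V} (hΦ : IsStrictContraction Φ)
    (A : V) : Tendsto (fun n => (∑ k ∈ Finset.range n, Φ ^ k) A) atTop (𝓝 (neumann Φ A)) := by
  have h1 : ∀ n, (∑ k ∈ Finset.range n, Φ ^ k) A = neumann Φ A - (Φ ^ n) (neumann Φ A) := by
    intro n
    have h2 : (∑ k ∈ Finset.range n, Φ ^ k) * (1 - Φ) = 1 - Φ ^ n := by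
      have := geom_sum_mul Φ n
      rw [← neg_sub, mul_neg, this, neg_sub]
    have h3 := LinearMap.congr_fun h2 (neumann Φ A)
    have h4 : (1 - Φ) (neumann Φ A) = A := hΦ.sub_neumann_apply A
    rw [Module.End.mul_apply, h4] at h3
    exact h3
  obtain ⟨c, h0, hc1, hc⟩ := hΦ
  have h5 : ∀ n, ‖(Φ ^ n) (neumann Φ A)‖ ≤ c ^ n * ‖neumann Φ A‖ := by
    intro n
    induction n with
    | zero => simp
    | succ n ih =>
      rw [pow_succ', Module.End.mul_apply, pow_succ', mul_assoc]
      exact (hc _).trans (mul_le_mul_of_nonneg_left ih h0)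
  have h6 : Tendsto (fun n => (Φ ^ n) (neumann Φ A)) atTop (𝓝 0) := by
    refine squeeze_zero_norm h5 ?_
    simpa using (tendsto_pow_atTop_nhds_zero_of_lt_one h0 hc1).mul_const ‖neumann Φ A‖
  simpa [h1] using (tendsto_const_nhds (x := neumann Φ A)).sub h6

/-- A net of linear contractions of a finite-dimensional space converges pointwise along any
ultrafilter. -/
theorem exists_ultrafilter_limit {ι : Type*} (𝒰 : Ultrafilter ι) (Φ : ι → Module.End ℂ V)
    (hΦ : ∀ᶠ r in (𝒰 : Filter ι), ∀ A, ‖Φ r A‖ ≤ ‖A‖) :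
    ∃ Φ₀ : Module.End ℂ V, ∀ A, Tendsto (fun r => Φ r A) 𝒰 (𝓝 (Φ₀ A)) := by
  have : ProperSpace V := FiniteDimensional.proper ℂ V
  have h : ∀ A, ∃ B, Tendsto (fun r => Φ r A) 𝒰 (𝓝 B) := by
    intro A
    have hK : IsCompact (Metric.closedBall (0 : V) ‖A‖) := isCompact_closedBall _ _
    -- The orbit of `A` stays in a compact ball, so an ultrafilter limit exists. Uniqueness of
    -- limits then makes the limit linear in `A`.
    obtain ⟨B, -, hB⟩ := hK.ultrafilter_le_nhds (𝒰.map fun r => Φ r A) (by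
      rw [le_principal_iff]
      exact hΦ.mono fun r hr => by simpa using hr A)
    exact ⟨B, hB⟩
  choose f hf using h
  refine ⟨⟨⟨f, fun A B => ?_⟩, fun c A => ?_⟩, hf⟩
  · exact tendsto_nhds_unique (hf (A + B)) (by simpa using (hf A).add (hf B))
  · exact tendsto_nhds_unique (hf (c • A)) (by simpa using (hf A).const_smul c)

end Neumann

section

variable {p : ℕ}

theorem IsStrictContraction.neumann_completelyPositive {Φ : Module.End ℂ (Op p)}
    (hΦ : IsStrictContraction Φ) (hcp : IsCompletelyPositive Φ) :
    IsCompletelyPositive (neumann Φ) := by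
  refine IsCompletelyPositive.of_tendsto hΦ.tendsto_neumann (Eventually.of_forall fun n => ?_)
  induction n with
  | zero => simpa using IsCompletelyPositive.zero
  | succ n ih =>
    rw [Finset.sum_range_succ]
    refine ih.add ?_
    clear ih
    induction n with
    | zero => exact IsCompletelyPositive.id
    | succ n ih => exact (pow_succ' Φ n) ▸ hcp.comp ih

/-- `(1 - D Y)⁻¹ D'`, the total rate at which a process with steps `Y` is stopped by `D'` when it
is continued by `D`. -/
noncomputable def stopped (D D' Y : Module.End ℂ (Op p)) : Module.End ℂ (Op p) :=
  neumann (D * Y) * D'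

/-- The two completely positive maps `D` and `D'` have a sum that is completely positive and
contractive, and that restricts to the identity on `ℒ`. -/
structure IsSplitting (D D' : Module.End ℂ (Op p)) (ℒ : Submodule ℂ (Op p)) : Prop where
  left : IsCompletelyPositive D
  right : IsCompletelyPositive D'
  one_le : D 1 + D' 1 ≤ 1
  add_eq : ∀ A ∈ ℒ, D A + D' A = A

namespace IsSplitting

variable {D D' Y : Module.End ℂ (Op p)} {ℒ : Submodule ℂ (Op p)}

theorem left_contractive (h : IsSplitting D D' ℒ) : IsContractive D :=
  h.left.isContractive ((le_add_of_nonneg_right (h.right.nonneg zero_le_one)).trans h.one_le)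

theorem strict (h : IsSplitting D D' ℒ) (hY : IsStrictContraction Y) :
    IsStrictContraction (D * Y) := hY.comp_left h.left_contractive

theorem stopped_eq (h : IsSplitting D D' ℒ) (hY : IsStrictContraction Y) (A : Op p) :
    stopped D D' Y A - D (Y (stopped D D' Y A)) = D' A :=
  (h.strict hY).sub_neumann_apply (D' A)

theorem stopped_completelyPositive (h : IsSplitting D D' ℒ) (hY : IsStrictContraction Y)
    (hcp : IsCompletelyPositive Y) : IsCompletelyPositive (stopped D D' Y) :=
  ((h.strict hY).neumann_completelyPositive (h.left.comp hcp)).comp h.right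

/-- Since D(Y(1)) ≤ D(1) ≤ 1 - D'(1), one has D'(1) ≤ (1 - DY)(1). The positive map (1 - DY)⁻¹
preserves this inequality. -/
theorem stopped_one_le (h : IsSplitting D D' ℒ) (hY : IsStrictContraction Y)
    (hcp : IsCompletelyPositive Y) (hY1 : Y 1 ≤ 1) : stopped D D' Y 1 ≤ 1 := by
  have hn := (h.strict hY).neumann_completelyPositive (h.left.comp hcp)
  have h1 : (1 : Op p) = neumann (D * Y) ((1 - D * Y) 1) :=
    ((h.strict hY).neumann_apply rfl).symm
  have h2 : D' 1 ≤ (1 - D * Y) 1 := by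
    have h3 : D (Y 1) ≤ D 1 := h.left.mono hY1
    have h4 : D' 1 ≤ 1 - D 1 := le_sub_iff_add_le'.2 h.one_le
    exact h4.trans (sub_le_sub_left h3 1)
  calc stopped D D' Y 1 ≤ neumann (D * Y) ((1 - D * Y) 1) := hn.mono h2
    _ = 1 := h1.symm

theorem stopped_contractive (h : IsSplitting D D' ℒ) (hY : IsStrictContraction Y)
    (hcp : IsCompletelyPositive Y) (hY1 : Y 1 ≤ 1) : IsContractive (stopped D D' Y) :=
  (h.stopped_completelyPositive hY hcp).isContractive (h.stopped_one_le hY hcp hY1)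

end IsSplitting

end

end QWeight

namespace QWeight

/-! ### The operators E(t,∞), (I - Λ)^{1/2} and the map Λ on H. -/

section Multiplication

variable {p : ℕ}

theorem ae_halfLine_pos : ∀ᵐ x ∂halfLine, (0 : ℝ) < x := ae_restrict_mem measurableSet_Ioi

theorem norm_mulOp_apply_le (f : ℝ → ℂ) (hf : MemLp f ∞ halfLine) (c : ℝ)
    (hc : ∀ x, 0 < x → ‖f x‖ ≤ c) (G : HSpace p) : ‖mulOp p f hf G‖ ≤ c * ‖G‖ := by
  refine Lp.norm_le_mul_norm_of_ae_le_mul ?_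
  filter_upwards [mulOp_coeFn p f hf G, ae_halfLine_pos] with x hx h0
  rw [hx, norm_smul]
  exact mul_le_mul_of_nonneg_right (hc x h0) (norm_nonneg _)

theorem star_mulOp_ofReal (f : ℝ → ℝ) (hf : MemLp (fun x => (f x : ℂ)) ∞ halfLine) :
    star (mulOp p (fun x => (f x : ℂ)) hf) = mulOp p (fun x => (f x : ℂ)) hf := by
  rw [ContinuousLinearMap.star_eq_adjoint, eq_comm, ContinuousLinearMap.eq_adjoint_iff]
  intro F G
  rw [L2.inner_def, L2.inner_def]
  refine integral_congr_ae ?_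
  filter_upwards [mulOp_coeFn p _ hf F, mulOp_coeFn p _ hf G] with x h1 h2
  rw [h1, h2, inner_smul_left, inner_smul_right, Complex.conj_ofReal]

theorem mulOp_comm (f g : ℝ → ℂ) (hf : MemLp f ∞ halfLine) (hg : MemLp g ∞ halfLine) :
    mulOp p f hf * mulOp p g hg = mulOp p g hg * mulOp p f hf := by
  ext1 G
  apply Lp.ext
  filter_upwards [mulOp_coeFn p f hf (mulOp p g hg G), mulOp_coeFn p g hg G,
    mulOp_coeFn p g hg (mulOp p f hf G), mulOp_coeFn p f hf G] with x h1 h2 h3 h4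
  rw [mul_apply_eq_comp, mul_apply_eq_comp, h1, h2, h3, h4, smul_comm]

theorem mulOp_compLpL_comm (f : ℝ → ℂ) (hf : MemLp f ∞ halfLine) (A : Op p) :
    mulOp p f hf * A.compLpL 2 halfLine = A.compLpL 2 halfLine * mulOp p f hf := by
  ext1 G
  apply Lp.ext
  filter_upwards [mulOp_coeFn p f hf (A.compLpL 2 halfLine G), A.coeFn_compLpL G,
    mulOp_coeFn p f hf G, A.coeFn_compLpL (mulOp p f hf G)] with x h1 h2 h3 h4
  rw [mul_apply_eq_comp, mul_apply_eq_comp, h1, h2, h4, h3, map_smul]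

theorem star_tailProj (t : ℝ) : star (tailProj p t) = tailProj p t := star_mulOp_ofReal _ _

theorem tailProj_mul_tailProj {s t : ℝ} (h : s ≤ t) :
    tailProj p s * tailProj p t = tailProj p t := by
  refine mulOp_mul p _ _ _ _ _ _ fun x hx => ?_
  rw [← Complex.ofReal_mul]
  congr 1
  unfold tailFun
  by_cases h1 : t ≤ x
  · simp [h1, h.trans h1]
  · simp [h1]

theorem tailProj_mul_tailProj' {s t : ℝ} (h : s ≤ t) :
    tailProj p t * tailProj p s = tailProj p t := by
  rw [tailProj, tailProj, mulOp_comm]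
  exact tailProj_mul_tailProj h

theorem tailProj_isIdempotent (t : ℝ) : tailProj p t * tailProj p t = tailProj p t :=
  tailProj_mul_tailProj le_rfl

theorem tailProj_rootOp_comm (t : ℝ) : tailProj p t * rootOp p = rootOp p * tailProj p t :=
  mulOp_comm _ _ _ _

theorem tailProj_Lam_comm (t : ℝ) (A : Op p) :
    tailProj p t * Lam p A = Lam p A * tailProj p t := by
  change tailProj p t * (mulOp p _ expFun_memLp * A.compLpL 2 halfLine) =
    mulOp p _ expFun_memLp * A.compLpL 2 halfLine * tailProj p t
  rw [← mul_assoc, tailProj, mulOp_comm, mul_assoc, mulOp_compLpL_comm, mul_assoc]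

theorem abs_tailFun_le (t x : ℝ) : |tailFun t x| ≤ 1 := by
  unfold tailFun
  by_cases h : t ≤ x <;> simp [h]

theorem norm_tailProj_apply_le (t : ℝ) (G : HSpace p) : ‖tailProj p t G‖ ≤ ‖G‖ := by
  have := norm_mulOp_apply_le (p := p) _ (tailFun_memLp t) 1 (fun x _ => by
    rw [Complex.norm_real]; exact abs_tailFun_le t x) G
  rwa [one_mul] at this

theorem norm_tailProj_le (t : ℝ) : ‖tailProj p t‖ ≤ 1 :=
  ContinuousLinearMap.opNorm_le_bound _ zero_le_one fun G => by
    simpa using norm_tailProj_apply_le t G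

/-- On [t,∞) the weight e^{-x} is at most e^{-t}. All strict contractions used for `q`-weight maps
come from this bound. -/
theorem norm_tailProj_mul_Lam_le {t : ℝ} (A : Op p) :
    ‖tailProj p t * Lam p A‖ ≤ Real.exp (-t) * ‖A‖ := by
  refine ContinuousLinearMap.opNorm_le_bound _ (by positivity) fun G => ?_
  have hprod : MemLp (fun x => ((tailFun t x * expFun x : ℝ) : ℂ)) ∞ halfLine := by
    refine memLp_of_bound ((measurable_tailFun t).mul (by unfold expFun; fun_prop)) 1
      fun x hx => ?_
    rw [abs_mul]
    refine mul_le_one₀ (abs_tailFun_le t x) (abs_nonneg _) ?_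
    rw [expFun, abs_of_pos (Real.exp_pos _), Real.exp_le_one_iff]
    linarith
  have h1 : tailProj p t * Lam p A = mulOp p _ hprod * A.compLpL 2 halfLine := by
    change tailProj p t * (mulOp p _ expFun_memLp * A.compLpL 2 halfLine) = _
    rw [← mul_assoc]
    congr 1
    exact mulOp_mul p _ _ _ _ _ _ fun x _ => by rw [← Complex.ofReal_mul]
  rw [h1, mul_apply_eq_comp, mul_assoc]
  refine (norm_mulOp_apply_le _ hprod (Real.exp (-t)) (fun x hx => ?_) _).trans ?_
  · rw [Complex.norm_real, Real.norm_eq_abs]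
    unfold tailFun expFun
    by_cases h : t ≤ x
    · simp [h]
    · simp [h, Real.exp_nonneg]
  · refine mul_le_mul_of_nonneg_left ?_ (Real.exp_nonneg _)
    exact (ContinuousLinearMap.le_opNorm _ _).trans
      (mul_le_mul_of_nonneg_right (ContinuousLinearMap.norm_compLpL_le _) (norm_nonneg _))

/-- The quadratic form of the matrix Λ(A_ij) at (F_i) is the integral of e^{-x} times the form of
(A_ij) at the vectors (F_i(x)). -/
theorem matrixPositive_Lam {n : ℕ} {A : Fin n → Fin n → Op p} (hA : MatrixPositive A) :
    MatrixPositive fun i j => Lam p (A i j) := by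
  intro F
  have hint : ∀ i j, Integrable (fun x => ⟪F i x, (Lam p (A i j) (F j) : HSpace p) x⟫_ℂ) halfLine :=
    fun i j => L2.integrable_inner _ _
  simp only [L2.inner_def]
  simp_rw [← integral_finsetSum _ fun j _ => hint _ j]
  rw [← integral_finsetSum _ fun i _ => integrable_finsetSum _ fun j _ => hint i j]
  refine integral_nonneg_of_ae ?_
  have h1 : ∀ i j, ∀ᵐ x ∂halfLine,
      (Lam p (A i j) (F j) : HSpace p) x = (expFun x : ℂ) • A i j (F j x) := by
    intro i j
    filter_upwards [mulOp_coeFn p _ expFun_memLp ((A i j).compLpL 2 halfLine (F j)),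
      (A i j).coeFn_compLpL (F j)] with x h2 h3
    rw [← h3]
    exact h2
  have h2 : ∀ᵐ x ∂halfLine, ∀ i j,
      (Lam p (A i j) (F j) : HSpace p) x = (expFun x : ℂ) • A i j (F j x) := by
    simp only [ae_all_iff]
    exact h1
  filter_upwards [h2] with x hx
  simp only [hx, inner_smul_right, ← Finset.mul_sum, Pi.zero_apply]
  refine mul_nonneg ?_ (hA fun i => F i x)
  exact Complex.zero_le_real.2 (Real.exp_nonneg _)

theorem Lam_completelyPositive : IsCompletelyPositive (Lam p) :=
  fun _ _ hA => matrixPositive_Lam hA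

theorem norm_Lam_le (A : Op p) : ‖Lam p A‖ ≤ ‖A‖ := by
  have h0 : tailProj p 0 = 1 := by
    ext1 G
    apply Lp.ext
    filter_upwards [mulOp_coeFn p _ (tailFun_memLp 0) G, ae_halfLine_pos] with x h1 h2
    rw [tailProj, h1]
    simp [tailFun, h2.le]
  simpa [h0] using norm_tailProj_mul_Lam_le (t := 0) A

/-- `E(t,∞)` converges strongly to the identity as `t → 0+`. -/
theorem tendsto_tailProj (G : HSpace p) :
    Tendsto (fun t => tailProj p t G) (𝓝[>] 0) (𝓝 G) := by
  rw [tendsto_iff_norm_sub_tendsto_zero]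
  have hsq : Tendsto (fun t => ‖tailProj p t G - G‖ ^ 2) (𝓝[>] (0 : ℝ)) (𝓝 0) := by
    have h1 : ∀ t, ‖tailProj p t G - G‖ ^ 2
        = ∫ x, ‖(tailFun t x : ℂ) • G x - G x‖ ^ 2 ∂halfLine := by
      intro t
      have h2 : (‖tailProj p t G - G‖ : ℂ) ^ 2
          = ⟪tailProj p t G - G, tailProj p t G - G⟫_ℂ := by
        rw [inner_self_eq_norm_sq_to_K]; rfl
      rw [L2.inner_def] at h2
      have h3 : ∫ x, ⟪(tailProj p t G - G : HSpace p) x, (tailProj p t G - G : HSpace p) x⟫_ℂ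
          ∂halfLine = ∫ x, ((‖(tailFun t x : ℂ) • G x - G x‖ ^ 2 : ℝ) : ℂ) ∂halfLine := by
        refine integral_congr_ae ?_
        filter_upwards [Lp.coeFn_sub (tailProj p t G) G, mulOp_coeFn p _ (tailFun_memLp t) G]
          with x h4 h5
        rw [h4, Pi.sub_apply, tailProj, h5, inner_self_eq_norm_sq_to_K]
        norm_cast
      rw [h3, integral_complex_ofReal] at h2
      exact_mod_cast h2
    simp_rw [h1]
    suffices hlim : Tendsto (fun t => ∫ x, ‖(tailFun t x : ℂ) • G x - G x‖ ^ 2 ∂halfLine)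
        (𝓝[>] (0 : ℝ)) (𝓝 (∫ _, (0 : ℝ) ∂halfLine)) by simpa using hlim
    have hG : Integrable (fun x => ‖G x‖ ^ 2) halfLine :=
      (memLp_two_iff_integrable_sq_norm (Lp.aestronglyMeasurable G)).1 (Lp.memLp G)
    refine tendsto_integral_filter_of_dominated_convergence (fun x => ‖G x‖ ^ 2) ?_ ?_ hG ?_
    · refine Eventually.of_forall fun t => ?_
      have h6 : AEStronglyMeasurable (fun x => (tailFun t x : ℂ) • G x) halfLine :=
        (tailFun_memLp t).aestronglyMeasurable.smul (Lp.aestronglyMeasurable G)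
      exact (h6.sub (Lp.aestronglyMeasurable G)).norm.pow 2
    · refine Eventually.of_forall fun t => Eventually.of_forall fun x => ?_
      rw [Real.norm_of_nonneg (sq_nonneg _)]
      refine pow_le_pow_left₀ (norm_nonneg _) ?_ 2
      unfold tailFun
      by_cases h : t ≤ x <;> simp [h]
    · filter_upwards [ae_halfLine_pos] with x hx
      refine tendsto_const_nhds.congr' ?_
      filter_upwards [Ioo_mem_nhdsGT hx] with t ht
      simp [tailFun, ht.2.le]
  have := (Real.continuous_sqrt.tendsto _).comp hsq
  simpa [Function.comp_def, Real.sqrt_sq (norm_nonneg _)] using this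

end Multiplication

end QWeight

namespace QWeight

/-! ### The correspondence between ω|_t and π_t^#. -/

section Representation

variable {p : ℕ} {ω : bAlg p →ₗ[ℂ] Op p} {t : ℝ}

/-- The map `ω|_t Λ` of `B(ℂ^p)` into itself. -/
noncomputable def truncLam (ω : bAlg p →ₗ[ℂ] Op p) (t : ℝ) : Module.End ℂ (Op p) :=
  trunc ω t ∘ₗ Lam p

/-- The map `π_t^# Λ` of `B(ℂ^p)` into itself. -/
noncomputable def repLam (ω : bAlg p →ₗ[ℂ] Op p) (t : ℝ) : Module.End ℂ (Op p) :=
  boundaryRep ω t ∘ₗ Lam p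

theorem coe_cutoff (ht : 0 < t) (A : HOp p) :
    (cutoff p t A : HOp p) = tailProj p t * A * tailProj p t := by
  simp [cutoff, ht, LinearMap.codRestrict_apply, LinearMap.mulLeftRight_apply]

theorem cutoff_conj_of_le {s : ℝ} (hs : 0 < s) (h : s ≤ t) (A : HOp p) :
    cutoff p s (tailProj p t * A * tailProj p t) = cutoff p t A := by
  apply Subtype.ext
  rw [coe_cutoff hs, coe_cutoff (hs.trans_le h)]
  calc tailProj p s * (tailProj p t * A * tailProj p t) * tailProj p s
      = (tailProj p s * tailProj p t) * A * (tailProj p t * tailProj p s) := by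
        simp only [mul_assoc]
    _ = _ := by rw [tailProj_mul_tailProj h, tailProj_mul_tailProj' h]

theorem trunc_conj_of_le {s : ℝ} (hs : 0 < s) (h : s ≤ t) (A : HOp p) :
    trunc ω s (tailProj p t * A * tailProj p t) = trunc ω t A := by
  simp only [trunc, LinearMap.comp_apply, cutoff_conj_of_le hs h]

theorem trunc_mem_range (A : HOp p) : trunc ω t A ∈ LinearMap.range ω := ⟨_, rfl⟩

theorem truncLam_mem_range (A : Op p) : truncLam ω t A ∈ LinearMap.range ω := ⟨_, rfl⟩

variable (hu : IsUnit (onePlus ω t))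

include hu in
theorem boundaryRep_add (A : HOp p) :
    boundaryRep ω t A + truncLam ω t (boundaryRep ω t A) = trunc ω t A :=
  LinearMap.congr_fun (Ring.mul_inverse_cancel _ hu) (trunc ω t A)

include hu in
theorem boundaryRep_mem_range (A : HOp p) : boundaryRep ω t A ∈ LinearMap.range ω := by
  rw [← add_sub_cancel_right (boundaryRep ω t A) (truncLam ω t (boundaryRep ω t A)),
    boundaryRep_add hu]
  exact sub_mem (trunc_mem_range _) (truncLam_mem_range _)

include hu in
theorem repLam_mem_range (A : Op p) : repLam ω t A ∈ LinearMap.range ω :=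
  boundaryRep_mem_range hu _

include hu in
-- With a = ω|_t Λ, the map π_t^# Λ is (1 + a)⁻¹ a = 1 - (1 + a)⁻¹. Thus ω|_t is recovered from
-- π_t^# as (1 - π_t^# Λ)⁻¹ π_t^#.
theorem one_sub_repLam : 1 - repLam ω t = Ring.inverse (onePlus ω t) := by
  have h1 : repLam ω t = Ring.inverse (onePlus ω t) * truncLam ω t := rfl
  have h2 : Ring.inverse (onePlus ω t) * (1 + truncLam ω t) = 1 := Ring.inverse_mul_cancel _ hu
  refine LinearMap.ext fun A => ?_
  have h3 : Ring.inverse (onePlus ω t) (A + truncLam ω t A) = A := LinearMap.congr_fun h2 A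
  rw [map_add] at h3
  rw [h1]
  exact sub_eq_iff_eq_add.2 h3.symm

include hu in
theorem trunc_sub_repLam (A : HOp p) :
    trunc ω t A - repLam ω t (trunc ω t A) = boundaryRep ω t A :=
  LinearMap.congr_fun (one_sub_repLam hu) (trunc ω t A)

theorem boundaryRep_conj (ht : 0 < t) (A : HOp p) :
    boundaryRep ω t (tailProj p t * A * tailProj p t) = boundaryRep ω t A := by
  simp only [boundaryRep, LinearMap.comp_apply, trunc_conj_of_le ht le_rfl]

/-- π_t^# sees an operator only through its compression to [t,∞), where Λ has norm at most e^{-t}.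
-/
theorem repLam_strict (ht : 0 < t) (hc : IsContractive (boundaryRep ω t)) :
    IsStrictContraction (repLam ω t) := by
  refine ⟨Real.exp (-t), (Real.exp_pos _).le, by simpa using ht, fun A => ?_⟩
  have h1 : repLam ω t A = boundaryRep ω t (tailProj p t * Lam p A * tailProj p t) := by
    rw [boundaryRep_conj ht]; rfl
  rw [h1]
  refine (hc _).trans ((norm_mul_le _ _).trans ?_)
  refine (mul_le_of_le_one_right (norm_nonneg _) (norm_tailProj_le t)).trans ?_
  exact norm_tailProj_mul_Lam_le A

theorem repLam_completelyPositive (hcp : IsCompletelyPositive (boundaryRep ω t)) :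
    IsCompletelyPositive (repLam ω t) := hcp.comp Lam_completelyPositive

theorem repLam_contractive (hc : IsContractive (boundaryRep ω t)) :
    IsContractive (repLam ω t) := fun A => (hc _).trans (norm_Lam_le A)

include hu in
theorem neumann_boundaryRep (ht : 0 < t) (hc : IsContractive (boundaryRep ω t)) :
    neumann (repLam ω t) ∘ₗ boundaryRep ω t = trunc ω t := by
  ext1 A
  exact (repLam_strict ht hc).neumann_apply (trunc_sub_repLam hu A)

include hu in
theorem trunc_completelyPositive (ht : 0 < t) (hc : IsContractive (boundaryRep ω t))
    (hcp : IsCompletelyPositive (boundaryRep ω t)) : IsCompletelyPositive (trunc ω t) := by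
  rw [← neumann_boundaryRep hu ht hc]
  exact ((repLam_strict ht hc).neumann_completelyPositive
    (repLam_completelyPositive hcp)).comp hcp

end Representation

/-! ### The part of π_r^# Λ carried by the interval [r,t). -/

section Step

variable {p : ℕ} {ω : bAlg p →ₗ[ℂ] Op p} {r t : ℝ}

/-- The part of `π_r^# Λ` that comes from the interval `[r, t)`. -/
noncomputable def stepLam (ω : bAlg p →ₗ[ℂ] Op p) (r t : ℝ) : Module.End ℂ (Op p) :=
  boundaryRep ω r ∘ₗ
    LinearMap.mulLeftRight ℂ (tailProj p r - tailProj p t, tailProj p r - tailProj p t) ∘ₗ Lam p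

/-- Λ(A) commutes with the projections E(t,∞), so the cross terms between [r,t) and [t,∞) vanish. -/
theorem conj_tailProj_sub (hrt : r ≤ t) (A : Op p) :
    (tailProj p r - tailProj p t) * Lam p A * (tailProj p r - tailProj p t) =
      tailProj p r * Lam p A * tailProj p r - tailProj p t * Lam p A * tailProj p t := by
  have h1 : tailProj p r * Lam p A * tailProj p t = tailProj p t * Lam p A * tailProj p t := by
    rw [tailProj_Lam_comm, mul_assoc, tailProj_mul_tailProj hrt, tailProj_Lam_comm, mul_assoc,
      tailProj_isIdempotent]
  have h2 : tailProj p t * Lam p A * tailProj p r = tailProj p t * Lam p A * tailProj p t := by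
    rw [tailProj_Lam_comm, mul_assoc, tailProj_mul_tailProj' hrt, mul_assoc,
      tailProj_isIdempotent]
  rw [sub_mul, sub_mul, mul_sub, mul_sub, h1, h2]
  abel

/-- The contribution of [t,∞) to π_r^# Λ is removed; by π_r^# = (1 - π_r^# Λ) ω|_r it equals (1 -
π_r^# Λ) ω|_t Λ. -/
theorem stepLam_apply (hr : 0 < r) (hrt : r ≤ t) (hu : IsUnit (onePlus ω r)) (A : Op p) :
    stepLam ω r t A = repLam ω r A - (truncLam ω t A - repLam ω r (truncLam ω t A)) := by
  have h1 : stepLam ω r t A = boundaryRep ω r (tailProj p r * Lam p A * tailProj p r) -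
      boundaryRep ω r (tailProj p t * Lam p A * tailProj p t) := by
    rw [← map_sub, ← conj_tailProj_sub hrt]
    rfl
  rw [h1, boundaryRep_conj hr]
  congr 1
  rw [← trunc_sub_repLam hu, trunc_conj_of_le hr hrt]
  rfl

theorem star_tailProj_sub : star (tailProj p r - tailProj p t) = tailProj p r - tailProj p t := by
  rw [star_sub, star_tailProj, star_tailProj]

theorem norm_tailProj_sub_le (hrt : r ≤ t) : ‖tailProj p r - tailProj p t‖ ≤ 1 := by
  have h : IsStarProjection (tailProj p r - tailProj p t) := by
    refine ⟨?_, star_tailProj_sub⟩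
    change (tailProj p r - tailProj p t) * (tailProj p r - tailProj p t) = _
    rw [sub_mul, mul_sub, mul_sub, tailProj_mul_tailProj hrt, tailProj_mul_tailProj' hrt,
      tailProj_isIdempotent, tailProj_isIdempotent]
    abel
  exact h.norm_le

theorem stepLam_completelyPositive (hcp : IsCompletelyPositive (boundaryRep ω r)) :
    IsCompletelyPositive (stepLam ω r t) :=
  hcp.comp ((IsCompletelyPositive.conj' star_tailProj_sub).comp Lam_completelyPositive)

theorem stepLam_strict (hr : 0 < r) (hrt : r ≤ t) (hc : IsContractive (boundaryRep ω r)) :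
    IsStrictContraction (stepLam ω r t) := by
  refine ⟨Real.exp (-r), (Real.exp_pos _).le, by simpa using hr, fun A => ?_⟩
  have h1 : (tailProj p r - tailProj p t) * tailProj p r = tailProj p r - tailProj p t := by
    rw [sub_mul, tailProj_isIdempotent, tailProj_mul_tailProj' hrt]
  refine (hc _).trans ?_
  change ‖(tailProj p r - tailProj p t) * Lam p A * (tailProj p r - tailProj p t)‖ ≤ _
  refine (norm_mul_le _ _).trans ?_
  refine (mul_le_of_le_one_right (norm_nonneg _) (norm_tailProj_sub_le hrt)).trans ?_
  rw [← h1, mul_assoc]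
  refine (norm_mul_le _ _).trans ?_
  refine (mul_le_of_le_one_left (norm_nonneg _) (norm_tailProj_sub_le hrt)).trans ?_
  exact norm_tailProj_mul_Lam_le A

theorem IsStrictContraction.contractive {Φ : Module.End ℂ (Op p)} (hΦ : IsStrictContraction Φ) :
    IsContractive Φ := by
  obtain ⟨c, h0, h1, hc⟩ := hΦ
  exact fun A => (hc A).trans (mul_le_of_le_one_left (norm_nonneg _) h1.le)

/-- `π_r^#` cut off at `t` is obtained from `π_t^#`. -/
theorem boundaryRep_sub_stepLam (hr : 0 < r) (hrt : r ≤ t) (hur : IsUnit (onePlus ω r))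
    (hut : IsUnit (onePlus ω t)) (A : HOp p) :
    boundaryRep ω t A - stepLam ω r t (boundaryRep ω t A) =
      boundaryRep ω r (tailProj p t * A * tailProj p t) := by
  rw [stepLam_apply hr hrt hur, ← trunc_sub_repLam hur, trunc_conj_of_le hr hrt,
    ← boundaryRep_add hut A, map_add]
  abel

end Step

/-! ### Normal functionals and recovery of ω from its truncations. -/

section Normality

variable {E F : Type*} [NormedAddCommGroup E] [InnerProductSpace ℂ E]
  [NormedAddCommGroup F] [InnerProductSpace ℂ F]

theorem IsNormalFunctional.zero : IsNormalFunctional fun _ : E →L[ℂ] E => 0 :=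
  ⟨0, 0, by simp [summable_zero], by simp [summable_zero], fun A => by
    simp⟩

theorem IsNormalFunctional.smul {ρ : (E →L[ℂ] E) → ℂ} (h : IsNormalFunctional ρ) (c : ℂ) :
    IsNormalFunctional fun A => c * ρ A := by
  obtain ⟨f, g, hf, hg, hs⟩ := h
  refine ⟨f, fun k => c • g k, hf, ?_, fun A => ?_⟩
  · simpa [norm_smul, mul_pow] using hg.mul_left (‖c‖ ^ 2)
  · simpa [inner_smul_right] using (hs A).mul_left c

theorem IsNormalFunctional.add {ρ σ : (E →L[ℂ] E) → ℂ} (hρ : IsNormalFunctional ρ)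
    (hσ : IsNormalFunctional σ) : IsNormalFunctional fun A => ρ A + σ A := by
  obtain ⟨f, g, hf, hg, hs⟩ := hρ
  obtain ⟨f', g', hf', hg', hs'⟩ := hσ
  -- The two representing sequences are interleaved, because a normal functional is represented by
  -- sequences indexed by ℕ.
  obtain ⟨e⟩ : Nonempty (ℕ ≃ ℕ ⊕ ℕ) := ⟨Equiv.natSumNatEquivNat.symm⟩
  have key : ∀ u v : ℕ → E, Summable (fun k => ‖u k‖ ^ 2) → Summable (fun k => ‖v k‖ ^ 2) →
      Summable fun k => ‖(Sum.elim u v (e k) : E)‖ ^ 2 := by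
    intro u v hu hv
    exact e.summable_iff.2
      (Summable.sum (fun k : ℕ ⊕ ℕ => ‖(Sum.elim u v k : E)‖ ^ 2) hu hv)
  refine ⟨fun k => Sum.elim f f' (e k),
    fun k => Sum.elim g g' (e k), key f f' hf hf', key g g' hg hg',
    fun A => ?_⟩
  exact (e.hasSum_iff
    (f := fun k : ℕ ⊕ ℕ => ⟪(Sum.elim f f' k : E), A (Sum.elim g g' k)⟫_ℂ)).2
    (HasSum.sum (hs A) (hs' A))

theorem IsNormalFunctional.sum {ι : Type*} (s : Finset ι) {ρ : ι → (E →L[ℂ] E) → ℂ}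
    (h : ∀ i ∈ s, IsNormalFunctional (ρ i)) : IsNormalFunctional fun A => ∑ i ∈ s, ρ i A := by
  classical
  induction s using Finset.induction_on with
  | empty => simpa using IsNormalFunctional.zero
  | insert i s hi ih =>
    simp only [Finset.sum_insert hi]
    exact (h i (by simp)).add (ih fun j hj => h j (by simp [hj]))

variable {p : ℕ}

/-- The matrix unit of `B(ℂ^p)` that maps the basis vector `j` to the basis vector `i`. -/
noncomputable def unitOp (p : ℕ) (i j : Fin p) : Op p :=
  InnerProductSpace.rankOne ℂ (EuclideanSpace.basisFun (Fin p) ℂ i)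
    (EuclideanSpace.basisFun (Fin p) ℂ j)

theorem sum_unitOp (A : Op p) : ∑ i, ∑ j, ⟪EuclideanSpace.basisFun (Fin p) ℂ i,
    A (EuclideanSpace.basisFun (Fin p) ℂ j)⟫_ℂ • unitOp p i j = A := by
  refine ContinuousLinearMap.ext fun x => ?_
  have h1 := (EuclideanSpace.basisFun (Fin p) ℂ).sum_repr' x
  conv_rhs => rw [← (EuclideanSpace.basisFun (Fin p) ℂ).sum_repr' (A x)]
  simp only [sum_apply, smul_apply, unitOp,
    InnerProductSpace.rankOne_apply]
  refine Finset.sum_congr rfl fun i _ => ?_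
  conv_rhs => rw [← h1]
  simp only [map_sum, map_smul, inner_sum, inner_smul_right, Finset.sum_smul, smul_smul]
  exact Finset.sum_congr rfl fun j _ => by rw [mul_comm]

/-- In finite dimension each matrix coefficient of M ∘ φ is a finite linear combination of matrix
coefficients of φ. -/
theorem IsNormalMap.comp {φ : (E →L[ℂ] E) →ₗ[ℂ] Op p} (hφ : IsNormalMap φ)
    (M : Module.End ℂ (Op p)) : IsNormalMap (M ∘ₗ φ) := by
  intro f g
  have h : ∀ A, ⟪f, (M ∘ₗ φ) A g⟫_ℂ = ∑ i, ∑ j, ⟪f, M (unitOp p i j) g⟫_ℂ *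
      ⟪EuclideanSpace.basisFun (Fin p) ℂ i, φ A (EuclideanSpace.basisFun (Fin p) ℂ j)⟫_ℂ := by
    intro A
    rw [LinearMap.comp_apply]
    conv_lhs => rw [← sum_unitOp (φ A)]
    simp only [map_sum, map_smul, sum_apply, smul_apply, inner_sum,
      inner_smul_right]
    exact Finset.sum_congr rfl fun i _ => Finset.sum_congr rfl fun j _ => by rw [mul_comm]
  simp only [h]
  exact IsNormalFunctional.sum _ fun i _ => IsNormalFunctional.sum _ fun j _ =>
    (hφ _ _).smul _

/-- Normal functionals are continuous for the compressions by `E(s,∞)`, `s → 0+`. -/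
theorem IsNormalFunctional.tendsto_compress {ρ : HOp p → ℂ} (h : IsNormalFunctional ρ)
    (B : HOp p) : Tendsto (fun s => ρ (tailProj p s * B * tailProj p s)) (𝓝[>] 0) (𝓝 (ρ B)) := by
  obtain ⟨f, g, hf, hg, hs⟩ := h
  have h1 : ∀ A, ρ A = ∑' k, ⟪f k, A (g k)⟫_ℂ := fun A => (hs A).tsum_eq.symm
  simp only [h1]
  refine tendsto_tsum_of_dominated_convergence
    (bound := fun k => ‖B‖ * (‖f k‖ ^ 2 + ‖g k‖ ^ 2)) ((hf.add hg).mul_left _) ?_ ?_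
  · intro k
    have h2 : ∀ s, ⟪f k, (tailProj p s * B * tailProj p s) (g k)⟫_ℂ =
        ⟪tailProj p s (f k), B (tailProj p s (g k))⟫_ℂ := by
      intro s
      have h3 := ContinuousLinearMap.adjoint_inner_left (tailProj p s) (B (tailProj p s (g k)))
        (f k)
      rw [← ContinuousLinearMap.star_eq_adjoint, star_tailProj] at h3
      exact h3.symm
    simp only [h2]
    exact (tendsto_tailProj (f k)).inner ((B.continuous.tendsto _).comp (tendsto_tailProj (g k)))
  · refine Eventually.of_forall fun s k => ?_
    have h4 : ‖(tailProj p s * B * tailProj p s) (g k)‖ ≤ ‖B‖ * ‖g k‖ := by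
      refine (norm_tailProj_apply_le s _).trans ((B.le_opNorm _).trans ?_)
      exact mul_le_mul_of_nonneg_left (norm_tailProj_apply_le s _) (norm_nonneg _)
    refine (norm_inner_le_norm _ _).trans
      ((mul_le_mul_of_nonneg_left h4 (norm_nonneg _)).trans ?_)
    have h5 : ‖f k‖ * ‖g k‖ ≤ ‖f k‖ ^ 2 + ‖g k‖ ^ 2 := by
      nlinarith [sq_nonneg (‖f k‖ - ‖g k‖), sq_nonneg ‖f k‖, sq_nonneg ‖g k‖]
    calc ‖f k‖ * (‖B‖ * ‖g k‖) = ‖B‖ * (‖f k‖ * ‖g k‖) := by ring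
      _ ≤ _ := mul_le_mul_of_nonneg_left h5 (norm_nonneg _)

theorem tendsto_op_of_inner {ι : Type*} {l : Filter ι} {A : ι → Op p} {B : Op p}
    (h : ∀ f g, Tendsto (fun r => ⟪f, A r g⟫_ℂ) l (𝓝 ⟪f, B g⟫_ℂ)) : Tendsto A l (𝓝 B) := by
  have h1 : Tendsto (fun r => ∑ i, ∑ j, ⟪EuclideanSpace.basisFun (Fin p) ℂ i,
      A r (EuclideanSpace.basisFun (Fin p) ℂ j)⟫_ℂ • unitOp p i j) l
      (𝓝 (∑ i, ∑ j, ⟪EuclideanSpace.basisFun (Fin p) ℂ i,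
        B (EuclideanSpace.basisFun (Fin p) ℂ j)⟫_ℂ • unitOp p i j)) :=
    tendsto_finsetSum _ fun i _ => tendsto_finsetSum _ fun j _ => (h _ _).smul_const _
  simpa only [sum_unitOp] using h1

/-- E(s,∞) commutes with (I - Λ)^{1/2}, so for A = (I - Λ)^{1/2} B (I - Λ)^{1/2} the cut-off of A
comes from the compression of B, to which normality applies. Hence facts about the maps ω|_s pass to
ω. -/
theorem IsBoundaryWeightMap.tendsto_trunc {ω : bAlg p →ₗ[ℂ] Op p} (hω : IsBoundaryWeightMap ω)
    (A : bAlg p) : Tendsto (fun s => trunc ω s (A : HOp p)) (𝓝[>] 0) (𝓝 (ω A)) := by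
  obtain ⟨_, B, rfl⟩ := A
  have h1 : ∀ s, 0 < s → trunc ω s (LinearMap.mulLeftRight ℂ (rootOp p, rootOp p) B) =
      (ω ∘ₗ toBAlg p) (tailProj p s * B * tailProj p s) := by
    intro s hs
    change ω _ = ω _
    congr 1
    apply Subtype.ext
    rw [coe_cutoff hs]
    change tailProj p s * (rootOp p * B * rootOp p) * tailProj p s =
      rootOp p * (tailProj p s * B * tailProj p s) * rootOp p
    calc tailProj p s * (rootOp p * B * rootOp p) * tailProj p s
        = (tailProj p s * rootOp p) * B * (rootOp p * tailProj p s) := by simp only [mul_assoc]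
      _ = (rootOp p * tailProj p s) * B * (tailProj p s * rootOp p) := by
        rw [tailProj_rootOp_comm]
      _ = _ := by simp only [mul_assoc]
  have h2 : Tendsto (fun s => (ω ∘ₗ toBAlg p) (tailProj p s * B * tailProj p s)) (𝓝[>] 0)
      (𝓝 ((ω ∘ₗ toBAlg p) B)) :=
    tendsto_op_of_inner fun f g => (hω f g).tendsto_compress B
  refine h2.congr' ?_
  filter_upwards [self_mem_nhdsWithin] with s hs
  exact (h1 s hs).symm

end Normality

end QWeight

namespace QWeight

/-! ### From splittings of the range to `q`-subordinates. -/

section Construction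

variable {p : ℕ} {ω : bAlg p →ₗ[ℂ] Op p}

/-- An ultrafilter that refines `t → 0+`. -/
noncomputable def zeroUltrafilter : Ultrafilter ℝ := Ultrafilter.of (𝓝[>] 0)

theorem zeroUltrafilter_le : (zeroUltrafilter : Filter ℝ) ≤ 𝓝[>] 0 := Ultrafilter.of_le _

theorem eventually_zeroUltrafilter {t : ℝ} (ht : 0 < t) :
    ∀ᶠ r in (zeroUltrafilter : Filter ℝ), 0 < r ∧ r < t :=
  zeroUltrafilter_le (Ioo_mem_nhdsGT ht)

theorem eventually_zeroUltrafilter_pos : ∀ᶠ r in (zeroUltrafilter : Filter ℝ), 0 < r :=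
  (eventually_zeroUltrafilter one_pos).mono fun _ h => h.1

/-- On ℒ one has 1 - D' = D, which gives 1 - `stopped D D' Y` = (1 - DY)⁻¹ D (1 - Y) there. For Y =
π_r^# Λ this yields (1 - u_r) ω|_r = (1 - DY)⁻¹ D π_r^#, the weight whose boundary representation at
r is D π_r^#. -/
theorem IsSplitting.sub_stopped {D D' Y : Module.End ℂ (Op p)} {ℒ : Submodule ℂ (Op p)}
    (h : IsSplitting D D' ℒ) (hY : IsStrictContraction Y) {A : Op p} (hA : A ∈ ℒ) :
    (A - stopped D D' Y A) - D (Y (A - stopped D D' Y A)) = D (A - Y A) := by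
  have h1 := h.stopped_eq hY A
  have h2 := h.add_eq A hA
  have h3 : D A = A - D' A := eq_sub_of_add_eq h2
  simp only [map_sub]
  rw [h3, ← h1]
  abel

namespace IsQWeightMap

theorem isStrict (hω : IsQWeightMap ω) {t : ℝ} (ht : 0 < t) :
    IsStrictContraction (repLam ω t) := repLam_strict ht (hω.rep_contractive t ht)

theorem repLam_cp (hω : IsQWeightMap ω) {t : ℝ} (ht : 0 < t) :
    IsCompletelyPositive (repLam ω t) := repLam_completelyPositive (hω.rep_completelyPositive t ht)

theorem repLam_one_le (hω : IsQWeightMap ω) {t : ℝ} (ht : 0 < t) : repLam ω t 1 ≤ 1 :=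
  (hω.repLam_cp ht).apply_one_le (repLam_contractive (hω.rep_contractive t ht))

theorem stepLam_cp (hω : IsQWeightMap ω) {r t : ℝ} (hr : 0 < r) :
    IsCompletelyPositive (stepLam ω r t) :=
  stepLam_completelyPositive (hω.rep_completelyPositive r hr)

theorem stepLam_isStrict (hω : IsQWeightMap ω) {r t : ℝ} (hr : 0 < r) (hrt : r ≤ t) :
    IsStrictContraction (stepLam ω r t) := stepLam_strict hr hrt (hω.rep_contractive r hr)

theorem stepLam_one_le (hω : IsQWeightMap ω) {r t : ℝ} (hr : 0 < r) (hrt : r ≤ t) :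
    stepLam ω r t 1 ≤ 1 :=
  (hω.stepLam_cp hr).apply_one_le (hω.stepLam_isStrict hr hrt).contractive

/-- Applied to values of π_t^#, this says, before r → 0+, that correcting π_t^# by the process
stopped on [r,t) solves the equation of the boundary representation at t of (1 - u_r) ω. -/
theorem stopped_compat (hω : IsQWeightMap ω) {D D' : Module.End ℂ (Op p)}
    (hD : IsSplitting D D' (LinearMap.range ω)) {r t : ℝ} (hr : 0 < r) (hrt : r ≤ t) {A : Op p}
    (hA : A ∈ LinearMap.range ω) :
    (1 + (1 - stopped D D' (repLam ω r)) * truncLam ω t) ((1 - stopped D D' (stepLam ω r t)) A) =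
      (1 - stopped D D' (repLam ω r)) (A + truncLam ω t A) := by
  have hu := hω.invertible r hr
  set X : Op p := A - stopped D D' (stepLam ω r t) A with hX
  have hY := hω.isStrict hr
  have h1 := hD.sub_stopped hY (truncLam_mem_range (ω := ω) (t := t) X)
  have h2 := hD.sub_stopped (hω.stepLam_isStrict hr hrt) hA
  have h3 := hD.sub_stopped hY (add_mem hA (truncLam_mem_range (ω := ω) (t := t) A))
  rw [← hX, stepLam_apply hr hrt hu, stepLam_apply hr hrt hu] at h2
  -- The injective map 1 - D Y_r removes the inverses from both sides. What remains is linear in D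
  -- and follows from the equation for the steps on [r,t).
  refine (hD.strict hY).injective ?_
  change (X + (truncLam ω t X - stopped D D' (repLam ω r) (truncLam ω t X))) -
      D (repLam ω r (X + (truncLam ω t X - stopped D D' (repLam ω r) (truncLam ω t X)))) =
    ((A + truncLam ω t A) - stopped D D' (repLam ω r) (A + truncLam ω t A)) -
      D (repLam ω r ((A + truncLam ω t A) - stopped D D' (repLam ω r) (A + truncLam ω t A)))
  rw [h3, map_add (repLam ω r), map_add D, add_sub_add_comm, h1]
  simp only [map_sub, map_add] at h2 ⊢
  have h4 : ∀ a b c d e f g h : Op p, a - (b - (c - d)) = e - (f - (g - h)) →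
      a - b + (c - d) = e + g - (f + h) := by
    intro a b c d e f g h H
    have : a - b + (c - d) = a - (b - (c - d)) := by abel
    rw [this, H]
    abel
  exact h4 _ _ _ _ _ _ _ _ h2

/-- With S the part of Y_r on [r,t), (1 - S) π_t^# is π_r^# cut off at t. Hence the map is (1 -
DS)⁻¹ D applied after this cut-off, a composition of completely positive maps. -/
theorem sub_stopped_rep (hω : IsQWeightMap ω) {D D' : Module.End ℂ (Op p)}
    (hD : IsSplitting D D' (LinearMap.range ω)) {r t : ℝ} (hr : 0 < r) (hrt : r ≤ t) :
    IsCompletelyPositive ((1 - stopped D D' (stepLam ω r t)) ∘ₗ boundaryRep ω t) := by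
  have ht := hr.trans_le hrt
  have hY := hω.stepLam_isStrict hr hrt
  have h1 : (1 - stopped D D' (stepLam ω r t)) ∘ₗ boundaryRep ω t =
      neumann (D * stepLam ω r t) ∘ₗ D ∘ₗ boundaryRep ω r ∘ₗ
        LinearMap.mulLeftRight ℂ (tailProj p t, tailProj p t) := by
    refine LinearMap.ext fun A => ?_
    have h2 := hD.sub_stopped hY (boundaryRep_mem_range (hω.invertible t ht) A)
    rw [boundaryRep_sub_stepLam hr hrt (hω.invertible r hr) (hω.invertible t ht)] at h2
    exact ((hD.strict hY).neumann_apply h2).symm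
  rw [h1]
  exact ((hD.strict hY).neumann_completelyPositive (hD.left.comp (hω.stepLam_cp hr))).comp
    (hD.left.comp ((hω.rep_completelyPositive r hr).comp
      (IsCompletelyPositive.conj' (star_tailProj t))))

end IsQWeightMap

variable {D D' : ℝ → Module.End ℂ (Op p)} {u : Module.End ℂ (Op p)}

theorem IsQWeightMap.exists_rep (hω : IsQWeightMap ω)
    (hD : ∀ r, 0 < r → IsSplitting (D r) (D' r) (LinearMap.range ω))
    (hlim : ∀ A, Tendsto (fun r => stopped (D r) (D' r) (repLam ω r) A) zeroUltrafilter
      (𝓝 (u A))) {t : ℝ} (ht : 0 < t) :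
    ∃ v : Module.End ℂ (Op p), IsCompletelyPositive v ∧
      IsCompletelyPositive ((1 - v) ∘ₗ boundaryRep ω t) ∧
      ∀ A ∈ LinearMap.range ω,
        (1 + (1 - u) * truncLam ω t) ((1 - v) A) = (1 - u) (A + truncLam ω t A) := by
  have hev := eventually_zeroUltrafilter ht
  obtain ⟨v, hv⟩ := exists_ultrafilter_limit zeroUltrafilter
    (fun r => stopped (D r) (D' r) (stepLam ω r t)) (hev.mono fun r hr =>
      (hD r hr.1).stopped_contractive (hω.stepLam_isStrict hr.1 hr.2.le) (hω.stepLam_cp hr.1)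
        (hω.stepLam_one_le hr.1 hr.2.le))
  refine ⟨v, ?_, ?_, ?_⟩
  · exact IsCompletelyPositive.of_tendsto hv (hev.mono fun r hr =>
      (hD r hr.1).stopped_completelyPositive (hω.stepLam_isStrict hr.1 hr.2.le)
        (hω.stepLam_cp hr.1))
  · refine IsCompletelyPositive.of_tendsto (l := (zeroUltrafilter : Filter ℝ))
      (Φ := fun r => (1 - stopped (D r) (D' r) (stepLam ω r t)) ∘ₗ boundaryRep ω t)
      (fun A => ?_) (hev.mono fun r hr => hω.sub_stopped_rep (hD r hr.1) hr.1 hr.2.le)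
    have h1 : Tendsto (fun r => boundaryRep ω t A -
        stopped (D r) (D' r) (stepLam ω r t) (boundaryRep ω t A)) zeroUltrafilter
        (𝓝 (boundaryRep ω t A - v (boundaryRep ω t A))) := tendsto_const_nhds.sub (hv _)
    exact h1
  · intro A hA
    have hcont : Continuous (truncLam ω t) := LinearMap.continuous_of_finiteDimensional _
    have h1 : Tendsto (fun r => A - stopped (D r) (D' r) (stepLam ω r t) A) zeroUltrafilter
        (𝓝 (A - v A)) := tendsto_const_nhds.sub (hv A)
    -- The stopped maps are uniformly contractive, so their pointwise convergence also holds along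
    -- convergent arguments.
    have h2 : ∀ {X : ℝ → Op p} {X₀ : Op p}, Tendsto X zeroUltrafilter (𝓝 X₀) →
        Tendsto (fun r => stopped (D r) (D' r) (repLam ω r) (X r)) zeroUltrafilter
          (𝓝 (u X₀)) := by
      intro X X₀ hX
      have h3 : Tendsto (fun r => stopped (D r) (D' r) (repLam ω r) (X r - X₀)) zeroUltrafilter
          (𝓝 0) := by
        refine squeeze_zero_norm' ?_ (tendsto_iff_norm_sub_tendsto_zero.1 hX)
        exact hev.mono fun r hr => (hD r hr.1).stopped_contractive (hω.isStrict hr.1)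
          (hω.repLam_cp hr.1) (hω.repLam_one_le hr.1) _
      simpa using h3.add (hlim X₀)
    have h4 : Tendsto (fun r => (1 + (1 - stopped (D r) (D' r) (repLam ω r)) * truncLam ω t)
        ((1 - stopped (D r) (D' r) (stepLam ω r t)) A)) zeroUltrafilter
        (𝓝 ((1 + (1 - u) * truncLam ω t) ((1 - v) A))) :=
      h1.add (((hcont.tendsto _).comp h1).sub (h2 ((hcont.tendsto _).comp h1)))
    have h5 : Tendsto (fun r => (1 - stopped (D r) (D' r) (repLam ω r)) (A + truncLam ω t A))
        zeroUltrafilter (𝓝 ((1 - u) (A + truncLam ω t A))) := tendsto_const_nhds.sub (hlim _)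
    refine tendsto_nhds_unique (h4.congr' ?_) h5
    exact hev.mono fun r hr => hω.stopped_compat (hD r hr.1) hr.1 hr.2.le hA

/-- Stopping `ω` according to a family of splittings of its range yields a `q`-subordinate. -/
theorem IsQWeightMap.isQSubordinate_of_splitting (hω : IsQWeightMap ω)
    (hD : ∀ r, 0 < r → IsSplitting (D r) (D' r) (LinearMap.range ω))
    (hlim : ∀ A, Tendsto (fun r => stopped (D r) (D' r) (repLam ω r) A) zeroUltrafilter
      (𝓝 (u A))) : IsQSubordinate ω ((1 - u) ∘ₗ ω) := by
  set η := (1 - u) ∘ₗ ω with hη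
  have key : ∀ t, 0 < t → IsUnit (onePlus η t) ∧ ∃ v : Module.End ℂ (Op p),
      IsCompletelyPositive v ∧ IsCompletelyPositive (boundaryRep η t) ∧
      boundaryRep η t = (1 - v) ∘ₗ boundaryRep ω t := by
    intro t ht
    obtain ⟨v, hv1, hv2, hv3⟩ := hω.exists_rep hD hlim ht
    -- (1 - v) π_t^# solves (1 + η|_t Λ) ψ = η|_t. Once 1 + η|_t Λ is known to be invertible, this
    -- identifies the boundary representation of η.
    have h1 : ∀ X, onePlus η t (((1 - v) ∘ₗ boundaryRep ω t) X) = trunc η t X := by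
      intro X
      refine (hv3 _ (boundaryRep_mem_range (hω.invertible t ht) X)).trans ?_
      rw [boundaryRep_add (hω.invertible t ht)]
      rfl
    have hu : IsUnit (onePlus η t) := by
      rw [LinearMap.isUnit_iff_range_eq_top, LinearMap.range_eq_top]
      intro A
      -- If (1 + η|_t Λ) ψ = η|_t, then A - ψ(Λ(A)) is mapped to A. In finite dimension surjectivity
      -- gives invertibility.
      refine ⟨A - ((1 - v) ∘ₗ boundaryRep ω t) (Lam p A), ?_⟩
      rw [map_sub, h1]
      change A + trunc η t (Lam p A) - trunc η t (Lam p A) = A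
      rw [add_sub_cancel_right]
    have h2 : boundaryRep η t = (1 - v) ∘ₗ boundaryRep ω t := by
      refine LinearMap.ext fun X => ?_
      change Ring.inverse (onePlus η t) (trunc η t X) = _
      rw [← h1]
      exact LinearMap.congr_fun (Ring.inverse_mul_cancel _ hu) _
    exact ⟨hu, v, hv1, h2 ▸ hv2, h2⟩
  have hsub : ∀ t, 0 < t → IsCompletelyPositive (boundaryRep ω t - boundaryRep η t) := by
    intro t ht
    obtain ⟨-, v, hv1, -, hv3⟩ := key t ht
    have h1 : boundaryRep ω t - boundaryRep η t = v ∘ₗ boundaryRep ω t := by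
      rw [hv3]
      refine LinearMap.ext fun X => ?_
      change boundaryRep ω t X - (boundaryRep ω t X - v (boundaryRep ω t X)) = _
      rw [sub_sub_cancel]
      rfl
    rw [h1]
    exact hv1.comp (hω.rep_completelyPositive t ht)
  have hcontr : ∀ t, 0 < t → IsContractive (boundaryRep η t) := by
    intro t ht
    obtain ⟨-, v, -, hv2, -⟩ := key t ht
    refine hv2.isContractive ?_
    have h1 : 0 ≤ (boundaryRep ω t - boundaryRep η t) 1 := (hsub t ht).nonneg zero_le_one
    exact (sub_nonneg.1 h1).trans
      ((hω.rep_completelyPositive t ht).apply_one_le (hω.rep_contractive t ht))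
  have hbw : IsBoundaryWeightMap η := hω.boundaryWeightMap.comp (1 - u)
  refine ⟨hω, ⟨hbw, ?_, fun t ht => (key t ht).1, ?_, hcontr, ?_⟩, hsub⟩
  -- Complete positivity on 𝔄(ℂ^p) is inherited from the truncations η|_s as s → 0+.
  · intro n A hA
    refine MatrixPositive.of_tendsto (l := 𝓝[>] (0 : ℝ))
      (fun i j => hbw.tendsto_trunc (A i j)) ?_
    filter_upwards [self_mem_nhdsWithin] with s hs
    obtain ⟨hu, v, -, hv2, -⟩ := key s hs
    exact trunc_completelyPositive hu hs (hcontr s hs) hv2 n _ hA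
  · intro t ht
    obtain ⟨-, v, -, hv2, -⟩ := key t ht
    exact hv2
  · intro t ht
    obtain ⟨-, v, -, -, hv3⟩ := key t ht
    rw [hv3]
    exact (hω.rep_normal t ht).comp (1 - v)

theorem IsQWeightMap.exists_stopped_limit (hω : IsQWeightMap ω)
    (hD : ∀ r, 0 < r → IsSplitting (D r) (D' r) (LinearMap.range ω)) :
    ∃ u : Module.End ℂ (Op p), IsCompletelyPositive u ∧ IsContractive u ∧
      ∀ A, Tendsto (fun r => stopped (D r) (D' r) (repLam ω r) A) zeroUltrafilter (𝓝 (u A)) := by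
  have hev := eventually_zeroUltrafilter_pos
  have hc : ∀ᶠ r in (zeroUltrafilter : Filter ℝ),
      IsContractive (stopped (D r) (D' r) (repLam ω r)) := hev.mono fun r hr =>
    (hD r hr).stopped_contractive (hω.isStrict hr) (hω.repLam_cp hr) (hω.repLam_one_le hr)
  obtain ⟨u, hu⟩ := exists_ultrafilter_limit zeroUltrafilter
    (fun r => stopped (D r) (D' r) (repLam ω r)) hc
  refine ⟨u, IsCompletelyPositive.of_tendsto hu (hev.mono fun r hr =>
    (hD r hr).stopped_completelyPositive (hω.isStrict hr) (hω.repLam_cp hr)), fun A => ?_, hu⟩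
  exact le_of_tendsto (hu A).norm (hc.mono fun r hr => hr A)

/-- At every r, A - u_r(A) is a sum of values of D on ℒ, because π_r^# Λ takes its values in ℒ. The
finite-dimensional space ℛ is closed. -/
theorem IsQWeightMap.sub_limit_mem (hω : IsQWeightMap ω)
    (hD : ∀ r, 0 < r → IsSplitting (D r) (D' r) (LinearMap.range ω))
    (hlim : ∀ A, Tendsto (fun r => stopped (D r) (D' r) (repLam ω r) A) zeroUltrafilter
      (𝓝 (u A))) {ℛ : Submodule ℂ (Op p)}
    (hℛ : ∀ r, 0 < r → ∀ A ∈ LinearMap.range ω, D r A ∈ ℛ) {A : Op p}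
    (hA : A ∈ LinearMap.range ω) : A - u A ∈ ℛ := by
  have hclosed : IsClosed (ℛ : Set (Op p)) := ℛ.closed_of_finiteDimensional
  have h1 : Tendsto (fun r => A - stopped (D r) (D' r) (repLam ω r) A) zeroUltrafilter
      (𝓝 (A - u A)) := tendsto_const_nhds.sub (hlim A)
  refine hclosed.mem_of_tendsto h1 (eventually_zeroUltrafilter_pos.mono fun r hr => ?_)
  have h2 := (hD r hr).sub_stopped (hω.isStrict hr) hA
  rw [sub_eq_iff_eq_add] at h2
  rw [h2]
  have hm := fun B => repLam_mem_range (hω.invertible r hr) B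
  exact add_mem (hℛ r hr _ (sub_mem hA (hm _))) (hℛ r hr _ (hm _))

end Construction

end QWeight

namespace QWeight

/-! ### Index zero and the limit idempotent. -/

section Limits

variable {p : ℕ} {ω η : bAlg p →ₗ[ℂ] Op p}

theorem IsIndexZero.tendsto (h0 : IsIndexZero ω) {s : ℝ} (hs : 0 < s) (A : HOp p) :
    Tendsto (fun t => boundaryRep ω t (tailProj p s * A * tailProj p s)) (𝓝[>] 0) (𝓝 0) :=
  h0.2.2 s hs A

theorem IsNormalMap.zero : IsNormalMap (0 : HOp p →ₗ[ℂ] Op p) := fun f g => by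
  simpa using IsNormalFunctional.zero

/-- Schwarz gives ψ(X)*ψ(X) ≤ ψ(X*X) ≤ φ(X*X). Thus domination controls ψ on operators that need not
be positive, and index zero passes to subordinates. -/
theorem norm_sq_le_of_le {E : Type*} [NormedAddCommGroup E] [InnerProductSpace ℂ E]
    [CompleteSpace E] {φ ψ : (E →L[ℂ] E) →ₗ[ℂ] Op p} (hψ : IsCompletelyPositive ψ)
    (hψc : IsContractive ψ) (h : IsCompletelyPositive (φ - ψ)) (X : E →L[ℂ] E) :
    ‖ψ X‖ ^ 2 ≤ ‖φ (star X * X)‖ := by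
  rw [sq, ← CStarRing.norm_star_mul_self]
  refine CStarAlgebra.norm_le_norm_of_nonneg_of_le (star_mul_self_nonneg _) ?_
  refine (hψ.schwarz (hψ.apply_one_le hψc) X).trans ?_
  exact sub_nonneg.1 (h.nonneg (star_mul_self_nonneg X))

theorem IsQSubordinate.isIndexZero (h : IsQSubordinate ω η) (h0 : IsIndexZero ω) :
    IsIndexZero η := by
  obtain ⟨hω, hη, hsub⟩ := h
  refine ⟨IsCompletelyPositive.zero, IsNormalMap.zero, fun s hs A => ?_⟩
  set X := tailProj p s * A * tailProj p s with hX
  have h1 : star X * X = tailProj p s * (star A * tailProj p s * A) * tailProj p s := by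
    rw [hX, star_mul, star_mul, star_tailProj]
    calc tailProj p s * (star A * tailProj p s) * (tailProj p s * A * tailProj p s)
        = tailProj p s * star A * (tailProj p s * tailProj p s) * A * tailProj p s := by
          simp only [mul_assoc]
      _ = _ := by rw [tailProj_isIdempotent]; simp only [mul_assoc]
  have h2 := h0.tendsto hs (star A * tailProj p s * A)
  rw [← h1] at h2
  have h3 : Tendsto (fun t => ‖boundaryRep η t X‖ ^ 2) (𝓝[>] 0) (𝓝 0) := by
    refine squeeze_zero' (Eventually.of_forall fun t => sq_nonneg _) ?_
      (tendsto_zero_iff_norm_tendsto_zero.1 h2)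
    filter_upwards [self_mem_nhdsWithin] with t ht
    exact norm_sq_le_of_le (hη.rep_completelyPositive t ht) (hη.rep_contractive t ht)
      (hsub t ht) X
  have h4 := (Real.continuous_sqrt.tendsto _).comp h3
  rw [LinearMap.zero_apply]
  exact tendsto_zero_iff_norm_tendsto_zero.2 (by
    simpa [Function.comp_def, Real.sqrt_sq (norm_nonneg _)] using h4)

/-- By index zero (1 - Y_r) ω|_s → 0, so the limit L fixes each ω|_s(A) and, as s → 0+, all of ℒ.
Every Y_r has its values in ℒ, hence so has L. -/
theorem IsQWeightMap.exists_repLam_limit (hω : IsQWeightMap ω) (h0 : IsIndexZero ω) :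
    ∃ L : Module.End ℂ (Op p), IsCEIdempotent L (LinearMap.range ω) ∧
      ∀ A, Tendsto (fun r => repLam ω r A) zeroUltrafilter (𝓝 (L A)) := by
  have hev := eventually_zeroUltrafilter_pos
  obtain ⟨L, hL⟩ := exists_ultrafilter_limit zeroUltrafilter (fun r => repLam ω r)
    (hev.mono fun r hr => repLam_contractive (hω.rep_contractive r hr))
  have hclosed : IsClosed ((LinearMap.range ω : Submodule ℂ (Op p)) : Set (Op p)) :=
    (LinearMap.range ω).closed_of_finiteDimensional
  have hmem : ∀ A, L A ∈ LinearMap.range ω := fun A =>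
    hclosed.mem_of_tendsto (hL A) (hev.mono fun r hr => repLam_mem_range (hω.invertible r hr) A)
  have htr : ∀ s, 0 < s → ∀ A, L (trunc ω s A) = trunc ω s A := by
    intro s hs A
    have h1 : Tendsto (fun r => trunc ω s A - repLam ω r (trunc ω s A)) zeroUltrafilter
        (𝓝 (trunc ω s A - L (trunc ω s A))) := tendsto_const_nhds.sub (hL _)
    have h2 : Tendsto (fun r => trunc ω s A - repLam ω r (trunc ω s A)) zeroUltrafilter
        (𝓝 0) := by
      refine ((h0.tendsto hs A).mono_left zeroUltrafilter_le).congr' ?_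
      filter_upwards [eventually_zeroUltrafilter hs] with r hr
      rw [← trunc_sub_repLam (hω.invertible r hr.1), trunc_conj_of_le hr.1 hr.2.le]
    exact (sub_eq_zero.1 (tendsto_nhds_unique h1 h2)).symm
  have hid : ∀ A ∈ LinearMap.range ω, L A = A := by
    rintro _ ⟨A, rfl⟩
    have h1 := hω.boundaryWeightMap.tendsto_trunc A
    have hcont : Continuous L := LinearMap.continuous_of_finiteDimensional _
    refine tendsto_nhds_unique (((hcont.tendsto _).comp h1).congr' ?_) h1
    filter_upwards [self_mem_nhdsWithin] with s hs
    exact htr s hs _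
  refine ⟨L, ⟨?_, fun A => ?_, fun A => hid _ (hmem A), ?_⟩, hL⟩
  · exact IsCompletelyPositive.of_tendsto hL (hev.mono fun r hr => hω.repLam_cp hr)
  · exact le_of_tendsto (hL A).norm
      (hev.mono fun r hr => repLam_contractive (hω.rep_contractive r hr) A)
  · refine le_antisymm ?_ fun A hA => ⟨A, hid A hA⟩
    rintro _ ⟨A, rfl⟩
    exact hmem A

theorem IsQSubordinate.limit_sub (h : IsQSubordinate ω η) {L M : Module.End ℂ (Op p)}
    (hL : ∀ A, Tendsto (fun r => repLam ω r A) zeroUltrafilter (𝓝 (L A)))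
    (hM : ∀ A, Tendsto (fun r => repLam η r A) zeroUltrafilter (𝓝 (M A))) :
    IsCompletelyPositive (L - M) := by
  refine IsCompletelyPositive.of_tendsto (l := (zeroUltrafilter : Filter ℝ))
    (Φ := fun r => (boundaryRep ω r - boundaryRep η r) ∘ₗ Lam p) (fun A => (hL A).sub (hM A)) ?_
  exact eventually_zeroUltrafilter_pos.mono fun r hr =>
    (h.2.2 r hr).comp Lam_completelyPositive

/-- Subordination is inherited by the truncated weight maps. -/
theorem IsQSubordinate.trunc_sub (h : IsQSubordinate ω η) {t : ℝ} (ht : 0 < t) :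
    IsCompletelyPositive (trunc ω t - trunc η t) := by
  obtain ⟨hω, hη, hsub⟩ := h
  have hn := (hω.isStrict ht).neumann_completelyPositive (hω.repLam_cp ht)
  have hcp := trunc_completelyPositive (hη.invertible t ht) ht (hη.rep_contractive t ht)
    (hη.rep_completelyPositive t ht)
  -- With π, ψ the boundary representations of ω, η, one has (1 - πΛ)(ω|_t - η|_t) = (π - ψ) + (πΛ -
  -- ψΛ) η|_t, and every map on the right is completely positive.
  have h1 : trunc ω t - trunc η t = neumann (repLam ω t) ∘ₗ
      ((boundaryRep ω t - boundaryRep η t) + (repLam ω t - repLam η t) ∘ₗ trunc η t) := by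
    refine LinearMap.ext fun X => ?_
    refine ((hω.isStrict ht).neumann_apply ?_).symm
    change (trunc ω t X - trunc η t X) - repLam ω t (trunc ω t X - trunc η t X) =
      (boundaryRep ω t X - boundaryRep η t X) +
        (repLam ω t (trunc η t X) - repLam η t (trunc η t X))
    rw [← trunc_sub_repLam (hω.invertible t ht), ← trunc_sub_repLam (hη.invertible t ht), map_sub]
    abel
  rw [h1]
  exact hn.comp ((hsub t ht).add (((hsub t ht).comp Lam_completelyPositive).comp hcp))

theorem IsQSubordinate.norm_trunc_one_le (h : IsQSubordinate ω η) {t : ℝ} (ht : 0 < t) :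
    ‖trunc η t 1‖ ≤ ‖trunc ω t 1‖ := by
  have hη := h.2.1
  have hcp := trunc_completelyPositive (hη.invertible t ht) ht (hη.rep_contractive t ht)
    (hη.rep_completelyPositive t ht)
  exact CStarAlgebra.norm_le_norm_of_nonneg_of_le (hcp.nonneg zero_le_one)
    (sub_nonneg.1 ((h.trunc_sub ht).nonneg zero_le_one))

/-- A truncation that annihilates 1 is zero by complete positivity, and ω is the limit of its
truncations. -/
theorem IsQWeightMap.exists_trunc_one_ne_zero (hω : IsQWeightMap ω) (hne : ω ≠ 0) :
    ∃ t, 0 < t ∧ trunc ω t 1 ≠ 0 := by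
  by_contra! hcon
  refine hne (LinearMap.ext fun A => ?_)
  refine tendsto_nhds_unique (hω.boundaryWeightMap.tendsto_trunc A)
    (tendsto_const_nhds.congr' ?_)
  filter_upwards [self_mem_nhdsWithin] with t ht
  have hcp := trunc_completelyPositive (hω.invertible t ht) ht (hω.rep_contractive t ht)
    (hω.rep_completelyPositive t ht)
  rw [hcp.eq_zero_of_apply_one (hcon t ht)]
  rfl

theorem eq_zero_of_range_limit {L : Module.End ℂ (Op p)}
    (hL : IsCEIdempotent L (LinearMap.range ω)) (h1 : L 1 = 0) : ω = 0 := by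
  have h2 := hL.completelyPositive.eq_zero_of_apply_one h1
  rw [← LinearMap.range_eq_bot, ← hL.range_eq, h2, LinearMap.range_zero]

end Limits

end QWeight

namespace QWeight

/-! ### Choi–Effros product, support projection and its central cover. -/

section ChoiEffros

variable {p : ℕ} {L L' : Op p →ₗ[ℂ] Op p} {ℒ : Submodule ℂ (Op p)}

theorem op_eq_zero_of_inner_self {A : Op p} (h : ∀ x, ⟪x, A x⟫_ℂ = 0) : A = 0 := by
  have h1 : (A : EuclideanSpace ℂ (Fin p) →ₗ[ℂ] EuclideanSpace ℂ (Fin p)) = 0 := by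
    rw [← inner_map_self_eq_zero]
    intro x
    exact inner_eq_zero_symm.1 (h x)
  exact ContinuousLinearMap.ext fun x => LinearMap.congr_fun h1 x

theorem conj_le_of_le_algebraMap {A B : Op p} {c : ℝ} (h : A ≤ algebraMap ℝ (Op p) c) :
    star B * A * B ≤ c • (star B * B) := by
  have := star_left_conjugate_le_conjugate h B
  rwa [Algebra.algebraMap_eq_smul_one, mul_smul_comm, mul_one, smul_mul_assoc] at this

theorem star_mul_self_le_norm (A : Op p) : star A * A ≤ algebraMap ℝ (Op p) (‖A‖ ^ 2) := by
  have := (IsSelfAdjoint.star_mul_self A).le_algebraMap_norm_self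
  rwa [CStarRing.norm_star_mul_self, ← sq] at this

/-- At each vector the form is real-affine in c and bounded below, so its linear part vanishes.
Reality at c = 1 and c = i makes the coefficients conjugate; c along the coefficient x, with a large
negative factor, then forces x = 0. -/
theorem eq_zero_of_sesquilinear_nonneg {S X Y : Op p}
    (h : ∀ c : ℂ, 0 ≤ S + (starRingEnd ℂ c) • X + c • Y) : X = 0 := by
  refine op_eq_zero_of_inner_self fun ξ => ?_
  have h1 : ∀ c : ℂ, 0 ≤ ⟪ξ, S ξ⟫_ℂ + (starRingEnd ℂ c) * ⟪ξ, X ξ⟫_ℂ + c * ⟪ξ, Y ξ⟫_ℂ := by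
    intro c
    simpa [inner_add_right, inner_smul_right] using (nonneg_iff_inner _).1 (h c) ξ
  generalize ⟪ξ, S ξ⟫_ℂ = s at h1
  generalize ⟪ξ, X ξ⟫_ℂ = x at h1
  generalize ⟪ξ, Y ξ⟫_ℂ = y at h1
  have hs := (Complex.le_def.1 (h1 0)).2
  have h2 := (Complex.le_def.1 (h1 1)).2
  have h3 := (Complex.le_def.1 (h1 Complex.I)).2
  simp at hs h2 h3
  have h4 : ∀ n : ℝ, 0 ≤ s.re + 2 * n * (x.re ^ 2 + x.im ^ 2) := by
    intro n
    have := (Complex.le_def.1 (h1 (n * x))).1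
    simp at this
    have hx1 : y.re = x.re := by linarith
    have hx2 : y.im = -x.im := by linarith
    rw [hx1, hx2] at this
    nlinarith
  have h5 : x.re ^ 2 + x.im ^ 2 = 0 := by
    by_contra hne
    have hpos : 0 < x.re ^ 2 + x.im ^ 2 :=
      lt_of_le_of_ne (by positivity) (Ne.symm hne)
    have h6 := h4 (-(s.re + 1) / (x.re ^ 2 + x.im ^ 2))
    have h7 : 2 * (-(s.re + 1) / (x.re ^ 2 + x.im ^ 2)) * (x.re ^ 2 + x.im ^ 2)
        = -2 * (s.re + 1) := by field_simp
    have h8 := h4 0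
    linarith
  apply Complex.ext <;> simp <;> nlinarith [sq_nonneg x.re, sq_nonneg x.im]

theorem star_add_smul_mul_self {A : Type*} [Ring A] [StarRing A] [Algebra ℂ A] [StarModule ℂ A]
    (a b : A) (c : ℂ) : star (a + c • b) * (a + c • b) = star a * a + c • (star a * b) +
      (starRingEnd ℂ c) • (star b * a) + (starRingEnd ℂ c * c) • (star b * b) := by
  simp only [star_add, star_smul, add_mul, mul_add, smul_mul_assoc, mul_smul_comm, smul_add,
    smul_smul, starRingEnd_apply, mul_comm c]
  abel

/-- Polarization: two linear maps that agree on all squares `a* a` with `a ∈ ℒ` agree on all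
products `a* b`. -/
theorem polarization {A B : Type*} [Ring A] [StarRing A] [Algebra ℂ A] [StarModule ℂ A]
    [AddCommGroup B] [Module ℂ B] {ℒ : Submodule ℂ A} (f g : A →ₗ[ℂ] B)
    (h : ∀ a ∈ ℒ, f (star a * a) = g (star a * a)) {a b : A} (ha : a ∈ ℒ) (hb : b ∈ ℒ) :
    f (star a * b) = g (star a * b) := by
  have key : ∀ c : ℂ, c • (f - g) (star a * b) + (starRingEnd ℂ c) • (f - g) (star b * a) = 0 := by
    intro c
    have h1 := h _ (add_mem ha (ℒ.smul_mem c hb))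
    rw [star_add_smul_mul_self] at h1
    simp only [map_add, map_smul, h a ha, h b hb] at h1
    simp only [LinearMap.sub_apply, smul_sub]
    have h3 := sub_eq_zero.2 h1
    rw [← h3]
    abel
  have k1 := key 1
  have k2 := key Complex.I
  simp only [one_smul, map_one, Complex.conj_I, neg_smul] at k1 k2
  rw [← sub_eq_add_neg, ← smul_sub] at k2
  have k3 := (smul_eq_zero.1 k2).resolve_left Complex.I_ne_zero
  have k4 : (2 : ℂ) • (f - g) (star a * b) = 0 := by
    rw [two_smul]
    nth_rewrite 2 [sub_eq_zero.1 k3]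
    exact k1
  exact sub_eq_zero.1 ((smul_eq_zero.1 k4).resolve_left two_ne_zero)

theorem op_star_mul_self_eq_zero (A : Op p) (h : star A * A = 0) : A = 0 :=
  (CStarRing.star_mul_self_eq_zero_iff A).1 h

namespace IsCEIdempotent

theorem map_mem (h : IsCEIdempotent L ℒ) (A : Op p) : L A ∈ ℒ := h.range_eq ▸ ⟨A, rfl⟩

theorem map_eq (h : IsCEIdempotent L ℒ) {A : Op p} (hA : A ∈ ℒ) : L A = A := by
  rw [← h.range_eq] at hA
  obtain ⟨B, rfl⟩ := hA
  exact h.idempotent B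

theorem one_le (h : IsCEIdempotent L ℒ) : L 1 ≤ 1 := h.completelyPositive.apply_one_le h.contractive

theorem star_mem (h : IsCEIdempotent L ℒ) {A : Op p} (hA : A ∈ ℒ) : star A ∈ ℒ := by
  rw [← h.map_eq hA, ← h.completelyPositive.map_star]
  exact h.map_mem _

theorem schwarz (h : IsCEIdempotent L ℒ) (A : Op p) : star (L A) * L A ≤ L (star A * A) :=
  h.completelyPositive.schwarz h.one_le A

/-- Apply L to the Schwarz inequality for b + c a*. The |c|² terms on both sides coincide because L
fixes a*, and the difference left over is positive and real-affine in c. -/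
theorem map_mul_map (h : IsCEIdempotent L ℒ) {a : Op p} (ha : a ∈ ℒ) (b : Op p) :
    L (a * L b) = L (a * b) := by
  have key : L (star (star a) * b) - L (star (star a) * L b) = 0 := by
    have hsa := h.star_mem ha
    refine eq_zero_of_sesquilinear_nonneg
      (S := L (star b * b) - L (star (L b) * L b))
      (Y := L (star b * star a) - L (star (L b) * star a)) fun c => ?_
    have h1 := h.completelyPositive.mono (h.schwarz (b + c • star a))
    have e1 : L (b + c • star a) = L b + c • star a := by
      rw [map_add, map_smul, h.map_eq hsa]
    have e2 : L (star (b + c • star a) * (b + c • star a)) = L (star b * b) +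
        c • L (star b * star a) + (starRingEnd ℂ c) • L (star (star a) * b) +
        (starRingEnd ℂ c * c) • L (star (star a) * star a) := by
      rw [star_add_smul_mul_self b (star a) c]
      simp only [map_add, map_smul]
    have e3 : L (star (L b + c • star a) * (L b + c • star a)) = L (star (L b) * L b) +
        c • L (star (L b) * star a) + (starRingEnd ℂ c) • L (star (star a) * L b) +
        (starRingEnd ℂ c * c) • L (star (star a) * star a) := by
      rw [star_add_smul_mul_self (L b) (star a) c]
      simp only [map_add, map_smul]
    rw [h.idempotent, e1, e2, e3, ← sub_nonneg] at h1
    convert h1 using 1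
    simp only [smul_sub]
    abel
  rw [star_star] at key
  exact (sub_eq_zero.1 key).symm

theorem map_map_mul (h : IsCEIdempotent L ℒ) {a : Op p} (ha : a ∈ ℒ) (b : Op p) :
    L (L b * a) = L (b * a) := by
  have h1 := congrArg star (h.map_mul_map (h.star_mem ha) (star b))
  simpa only [← h.completelyPositive.map_star, star_mul, star_star] using h1

theorem mul_unit (h : IsCEIdempotent L ℒ) {a : Op p} (ha : a ∈ ℒ) : L (a * L 1) = a := by
  rw [h.map_mul_map ha, mul_one, h.map_eq ha]

theorem unit_mul (h : IsCEIdempotent L ℒ) {a : Op p} (ha : a ∈ ℒ) : L (L 1 * a) = a := by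
  rw [h.map_map_mul ha, one_mul, h.map_eq ha]

/-- The Choi–Effros product depends on the range only. -/
theorem map_mul_eq (h : IsCEIdempotent L ℒ) (h' : IsCEIdempotent L' ℒ) {a b : Op p}
    (ha : a ∈ ℒ) (hb : b ∈ ℒ) : L (a * b) = L' (a * b) := by
  have key : ∀ {M M' : Op p →ₗ[ℂ] Op p}, IsCEIdempotent M ℒ → IsCEIdempotent M' ℒ →
      ∀ c ∈ ℒ, M (star c * c) ≤ M' (star c * c) := by
    -- By Schwarz c*c ≤ M'(c*c), and the right side lies in ℒ. Applying M, which fixes ℒ, gives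
    -- M(c*c) ≤ M'(c*c).
    intro M M' hM hM' c hc
    have h1 := hM'.schwarz c
    rw [hM'.map_eq hc] at h1
    have h2 := hM.completelyPositive.mono h1
    rwa [hM.map_eq (hM'.map_mem _)] at h2
  have := polarization L L' (fun c hc => le_antisymm (key h h' c hc) (key h' h c hc))
    (h.star_mem ha) hb
  rwa [star_star] at this

theorem unit_eq (h : IsCEIdempotent L ℒ) (h' : IsCEIdempotent L' ℒ) : L 1 = L' 1 := by
  rw [← h'.mul_unit (h.map_mem 1), ← h.map_mul_eq h' (h.map_mem 1) (h'.map_mem 1),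
    h.unit_mul (h'.map_mem 1)]

theorem nonneg_smul_unit (h : IsCEIdempotent L ℒ) {a : Op p} (ha : a ∈ ℒ) :
    star a * a ≤ (‖a‖ ^ 2) • L 1 := by
  have h1 := h.schwarz a
  rw [h.map_eq ha] at h1
  refine h1.trans ((h.completelyPositive.mono (star_mul_self_le_norm a)).trans_eq ?_)
  rw [Algebra.algebraMap_eq_smul_one, ← Complex.coe_smul, map_smul, Complex.coe_smul]

end IsCEIdempotent

/-! ### The support projection -/

theorem rankOne_self_nonneg (v : EuclideanSpace ℂ (Fin p)) :
    (0 : Op p) ≤ InnerProductSpace.rankOne ℂ v v := by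
  rw [ContinuousLinearMap.nonneg_iff_isPositive]
  exact InnerProductSpace.isPositive_rankOne_self v

theorem conj_rankOne (X : Op p) (v : EuclideanSpace ℂ (Fin p)) :
    X * InnerProductSpace.rankOne ℂ v v * star X = InnerProductSpace.rankOne ℂ (X v) (X v) := by
  refine ContinuousLinearMap.ext fun x => ?_
  simp [ContinuousLinearMap.star_eq_adjoint, ContinuousLinearMap.adjoint_inner_right]

theorem map_eq_zero_of_le_smul {φ : Op p →ₗ[ℂ] Op p} (hφ : IsCompletelyPositive φ)
    {A B : Op p} {c : ℝ} (hA : 0 ≤ A) (h : A ≤ c • B) (hB : φ B = 0) : φ A = 0 := by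
  have h1 := hφ.mono h
  have h2 : φ (c • B) = c • φ B := φ.map_smul_of_tower c B
  rw [h2, hB] at h1
  have h3 : c • (0 : Op p) = 0 := ContinuousLinearMap.ext fun x => by simp
  rw [h3] at h1
  exact le_antisymm h1 (hφ.nonneg hA)

theorem conj_rankOne_le {X : Op p} (v : EuclideanSpace ℂ (Fin p)) :
    InnerProductSpace.rankOne ℂ (X v) (X v) ≤
      ‖(InnerProductSpace.rankOne ℂ v v : Op p)‖ • (X * star X) := by
  have h := conj_le_of_le_algebraMap (B := star X)
    (IsSelfAdjoint.of_nonneg (rankOne_self_nonneg v)).le_algebraMap_norm_self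
  rwa [star_star, conj_rankOne] at h

/-- The vectors `v` for which a completely positive map annihilates `v ⊗ v*`. -/
noncomputable def nullSpace (φ : Op p →ₗ[ℂ] Op p) (hφ : IsCompletelyPositive φ) :
    Submodule ℂ (EuclideanSpace ℂ (Fin p)) where
  carrier := {v | φ (InnerProductSpace.rankOne ℂ v v) = 0}
  add_mem' := by
    intro v w hv hw
    -- Parallelogram identity: twice the sum of the rank-one operators of v and w exceeds that of v
    -- + w by that of v - w.
    refine map_eq_zero_of_le_smul (c := 2) (B := InnerProductSpace.rankOne ℂ v v +
      InnerProductSpace.rankOne ℂ w w) hφ (rankOne_self_nonneg _) ?_ ?_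
    · rw [← sub_nonneg]
      convert rankOne_self_nonneg (v - w) using 1
      refine ContinuousLinearMap.ext fun x => ?_
      simp only [two_smul, sub_apply, add_apply, InnerProductSpace.rankOne_apply, inner_add_left,
        inner_sub_left, smul_add, smul_sub, add_smul, sub_smul]
      abel
    · rw [map_add, hv, hw, add_zero]
  zero_mem' := by simp
  smul_mem' := by
    intro c v hv
    change φ _ = 0
    have h1 : (InnerProductSpace.rankOne ℂ (c • v) (c • v) : Op p) =
        (c * starRingEnd ℂ c) • InnerProductSpace.rankOne ℂ v v := by
      refine ContinuousLinearMap.ext fun x => ?_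
      simp [smul_smul]
    have hv' : φ (InnerProductSpace.rankOne ℂ v v) = 0 := hv
    rw [h1, map_smul, hv']
    exact ContinuousLinearMap.ext fun x => by simp

/-- F is the projection onto the orthogonal complement of the null space. If X ≥ 0 and L(X) = 0,
then L also kills X X* ≤ ‖X‖ X, so the range of X lies in the null space. -/
theorem exists_supportProjection (hL : IsCompletelyPositive L) :
    ∃ F : Op p, IsSupportProjection L F ∧ ∀ X : Op p, 0 ≤ X → L X = 0 → F * X = 0 := by
  set N := nullSpace L hL with hN
  have hstar : IsStarProjection N.starProjection := isStarProjection_starProjection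
  have hF : IsStarProjection (1 - N.starProjection) := hstar.one_sub
  have hfaith : ∀ X : Op p, 0 ≤ X → L X = 0 → (1 - N.starProjection) * X = 0 := by
    intro X hX hLX
    have hXs : star X = X := IsSelfAdjoint.of_nonneg hX
    have h2 : L (X * star X) = 0 := by
      refine map_eq_zero_of_le_smul hL (mul_star_self_nonneg X) (c := ‖X‖) ?_ hLX
      have h3 := (IsSelfAdjoint.of_nonneg hX).le_algebraMap_norm_self
      have h4 := conj_le_of_le_algebraMap h3 (B := CFC.sqrt X)
      rw [(CFC.sqrt_nonneg X).isSelfAdjoint.star_eq] at h4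
      have h5 := CFC.sqrt_mul_sqrt_self X hX
      rw [h5] at h4
      refine le_trans (le_of_eq ?_) h4
      calc X * star X = (CFC.sqrt X * CFC.sqrt X) * (CFC.sqrt X * CFC.sqrt X) := by rw [hXs, h5]
        _ = CFC.sqrt X * (CFC.sqrt X * CFC.sqrt X) * CFC.sqrt X := by simp only [mul_assoc]
        _ = CFC.sqrt X * X * CFC.sqrt X := by rw [h5]
    refine ContinuousLinearMap.ext fun v => ?_
    have h1 : X v ∈ N :=
      map_eq_zero_of_le_smul hL (rankOne_self_nonneg _) (conj_rankOne_le v) h2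
    change X v - N.starProjection (X v) = 0
    rw [Submodule.starProjection_eq_self_iff.2 h1, sub_self]
  refine ⟨1 - N.starProjection, ⟨⟨hF, ?_⟩, ?_⟩, hfaith⟩
  · rw [map_sub, sub_eq_self, (stdOrthonormalBasis ℂ N).starProjection_eq_sum_rankOne, map_sum]
    exact Finset.sum_eq_zero fun i _ => ((stdOrthonormalBasis ℂ N) i).2
  · rintro G ⟨hG, hLG⟩
    rw [hF.le_iff_mul_eq_left hG]
    have h1 := hfaith (1 - G) hG.one_sub.nonneg (by rw [map_sub, hLG, sub_self])
    rw [mul_sub, mul_one] at h1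
    exact (sub_eq_zero.1 h1).symm

namespace IsSupportProjection

variable {F : Op p}

theorem isStarProjection (hF : IsSupportProjection L F) : IsStarProjection F := hF.1.1

theorem faithful (hF : IsSupportProjection L F) (hL : IsCompletelyPositive L) {X : Op p}
    (hX : 0 ≤ X) (hLX : L X = 0) : F * X = 0 := by
  obtain ⟨F', hF', h⟩ := exists_supportProjection hL
  rw [IsLeast.unique hF hF']
  exact h X hX hLX

/-- L(1 - G) = 0 because 1 - G ≤ 1 - F. By the Schwarz inequality L then annihilates every X(1 - G).
-/
theorem map_mul_right (hF : IsSupportProjection L F) (h : IsCEIdempotent L ℒ) {G : Op p}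
    (hG : IsStarProjection G) (hFG : F ≤ G) (X : Op p) : L (X * G) = L X := by
  have h0 : L (1 - G) = 0 := by
    have h1 : 1 - G ≤ (1 : ℝ) • (1 - F) := by rw [one_smul]; exact sub_le_sub_left hFG 1
    exact map_eq_zero_of_le_smul h.completelyPositive hG.one_sub.nonneg h1
      (by rw [map_sub, hF.1.2, sub_self])
  have h1 : L (star (X * (1 - G)) * (X * (1 - G))) = 0 := by
    refine map_eq_zero_of_le_smul h.completelyPositive (star_mul_self_nonneg _)
      (c := ‖X‖ ^ 2) ?_ h0
    have h2 := conj_le_of_le_algebraMap (B := 1 - G) (star_mul_self_le_norm X)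
    rw [hG.one_sub.isSelfAdjoint.star_eq, hG.one_sub.isIdempotentElem.eq] at h2
    rw [star_mul, hG.one_sub.isSelfAdjoint.star_eq]
    simpa only [mul_assoc] using h2
  have h3 : L (X * (1 - G)) = 0 := by
    have h4 := h.schwarz (X * (1 - G))
    rw [h1] at h4
    exact op_star_mul_self_eq_zero _
      (le_antisymm h4 (star_mul_self_nonneg _))
  rw [mul_sub, mul_one, map_sub] at h3
  exact (sub_eq_zero.1 h3).symm

theorem map_mul_left (hF : IsSupportProjection L F) (h : IsCEIdempotent L ℒ) {G : Op p}
    (hG : IsStarProjection G) (hFG : F ≤ G) (X : Op p) : L (G * X) = L X := by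
  have h1 := congrArg star (hF.map_mul_right h hG hFG (star X))
  simpa only [← h.completelyPositive.map_star, star_mul, star_star,
    hG.isSelfAdjoint.star_eq] using h1

/-- L(c*c) - c*c is positive and annihilated by L, hence by F; polarization does the rest.
Multiplication by F thus turns the Choi–Effros product into the ordinary one. -/
theorem mul_map_mul (hF : IsSupportProjection L F) (h : IsCEIdempotent L ℒ) {a b : Op p}
    (ha : a ∈ ℒ) (hb : b ∈ ℒ) : F * L (a * b) = F * (a * b) := by
  have := polarization (LinearMap.mulLeft ℂ F ∘ₗ L) (LinearMap.mulLeft ℂ F) (fun c hc => ?_)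
    (h.star_mem ha) hb
  · simpa only [star_star, LinearMap.comp_apply, LinearMap.mulLeft_apply] using this
  · have h1 := h.schwarz c
    rw [h.map_eq hc, ← sub_nonneg] at h1
    have h2 := hF.faithful h.completelyPositive h1 (by rw [map_sub, h.idempotent, sub_self])
    rw [mul_sub] at h2
    exact sub_eq_zero.1 h2

theorem mul_unit (hF : IsSupportProjection L F) (h : IsCEIdempotent L ℒ) : F * L 1 = F := by
  have h2 := hF.faithful h.completelyPositive (sub_nonneg.2 h.one_le)
    (by rw [map_sub, h.idempotent, sub_self])
  rw [mul_sub, mul_one] at h2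
  exact (sub_eq_zero.1 h2).symm

/-- For c ∈ ℒ, L(c*(1 - F)c) = L(c* L((1 - F)c)) = 0, and faithfulness on F gives (1 - F)cF = 0. The
same for c* yields commutation. -/
theorem commute (hF : IsSupportProjection L F) (h : IsCEIdempotent L ℒ) {a : Op p} (ha : a ∈ ℒ) :
    F * a = a * F := by
  have hP := hF.isStarProjection
  have key : ∀ c ∈ ℒ, c * F = F * c * F := by
    intro c hc
    have h0 : L ((1 - F) * c) = 0 := by
      rw [sub_mul, one_mul, map_sub, hF.map_mul_left h hP le_rfl, sub_self]
    have h1 : star ((1 - F) * c) * ((1 - F) * c) = star c * ((1 - F) * c) := by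
      rw [star_mul, hP.one_sub.isSelfAdjoint.star_eq, mul_assoc, ← mul_assoc (1 - F),
        hP.one_sub.isIdempotentElem.eq]
    have h2 : L (star ((1 - F) * c) * ((1 - F) * c)) = 0 := by
      rw [h1, ← h.map_mul_map (h.star_mem hc), h0, mul_zero, map_zero]
    have h3 := hF.faithful h.completelyPositive (star_mul_self_nonneg _) h2
    have h4 : star ((1 - F) * c * F) * ((1 - F) * c * F) = 0 := by
      rw [star_mul, hP.isSelfAdjoint.star_eq]
      calc F * star ((1 - F) * c) * ((1 - F) * c * F)
          = (F * (star ((1 - F) * c) * ((1 - F) * c))) * F := by simp only [mul_assoc]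
        _ = 0 := by rw [h3, zero_mul]
    have h5 := op_star_mul_self_eq_zero _ h4
    rw [sub_mul, one_mul, sub_mul] at h5
    exact sub_eq_zero.1 h5
  have h1 := congrArg star (key _ (h.star_mem ha))
  simp only [star_mul, star_star, hP.isSelfAdjoint.star_eq] at h1
  exact h1.trans ((mul_assoc _ _ _).symm.trans (key a ha).symm)

end IsSupportProjection

/-! ### The maximal support projection -/

theorem commute_starProjection {U : Submodule ℂ (EuclideanSpace ℂ (Fin p))} {T : Op p}
    (h : ∀ v ∈ U, T v ∈ U) (h' : ∀ v ∈ U, star T v ∈ U) :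
    U.starProjection * T = T * U.starProjection := by
  have hP : IsStarProjection U.starProjection := isStarProjection_starProjection
  have key : ∀ S : Op p, (∀ v ∈ U, S v ∈ U) →
      U.starProjection * (S * U.starProjection) = S * U.starProjection := by
    intro S hS
    refine ContinuousLinearMap.ext fun v => ?_
    exact Submodule.starProjection_eq_self_iff.2 (hS _ (U.starProjection_apply_mem v))
  have h1 := congrArg star (key _ h')
  simp only [star_mul, star_star, hP.isSelfAdjoint.star_eq] at h1
  rw [← h1, mul_assoc, key _ h]

theorem star_mem_centralizer {S : Set (Op p)} (hS : ∀ a ∈ S, star a ∈ S) {X : Op p}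
    (hX : X ∈ Set.centralizer S) : star X ∈ Set.centralizer S := by
  intro a ha
  have := congrArg star (hX (star a) (hS a ha))
  simpa using this.symm

/-- P projects onto the span of ℒ'FH, which is invariant under ℒ' and, since F commutes with ℒ,
under ℒ. An element of ℒ'' that kills FH kills ℒ'FH; this transports identities in ℒ'' from F to P.
-/
theorem exists_centralCover {F : Op p} (hF : IsStarProjection F)
    (hstar : ∀ a ∈ ℒ, star a ∈ ℒ) (hcomm : F ∈ Set.centralizer (ℒ : Set (Op p))) :
    ∃ P : Op p, IsLeast {R : Op p | IsStarProjection R ∧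
      R ∈ Set.centralizer (ℒ : Set (Op p)) ∧
      R ∈ Set.centralizer (Set.centralizer (ℒ : Set (Op p))) ∧ F ≤ R} P ∧
      ∀ D ∈ Set.centralizer (Set.centralizer (ℒ : Set (Op p))), D * F = 0 → D * P = 0 := by
  set W : Submodule ℂ (EuclideanSpace ℂ (Fin p)) := Submodule.span ℂ
    {x | ∃ X ∈ Set.centralizer (ℒ : Set (Op p)), ∃ v, x = X (F v)} with hW
  have hsub : ∀ X ∈ Set.centralizer (ℒ : Set (Op p)), ∀ v, X (F v) ∈ W := fun X hX v =>
    Submodule.subset_span ⟨X, hX, v, rfl⟩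
  have hinv : ∀ T : Op p, (∀ X ∈ Set.centralizer (ℒ : Set (Op p)), ∀ v, T (X (F v)) ∈ W) →
      ∀ w ∈ W, T w ∈ W := by
    intro T hT w hw
    have : W ≤ W.comap (T : EuclideanSpace ℂ (Fin p) →ₗ[ℂ] EuclideanSpace ℂ (Fin p)) := by
      rw [hW, Submodule.span_le, ← hW]
      rintro _ ⟨X, hX, v, rfl⟩
      exact hT X hX v
    exact this hw
  have hL : ∀ a ∈ ℒ, ∀ w ∈ W, a w ∈ W := by
    intro a ha
    refine hinv a fun X hX v => ?_
    have h1 : a (X (F v)) = X (F (a v)) := by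
      have e1 := DFunLike.congr_fun (hX a ha) (F v)
      have e2 := DFunLike.congr_fun (hcomm a ha) v
      simp only [mul_apply_eq_comp] at e1 e2
      rw [e1, e2]
    rw [h1]
    exact hsub X hX _
  have hC : ∀ T ∈ Set.centralizer (ℒ : Set (Op p)), ∀ w ∈ W, T w ∈ W := by
    intro T hT
    refine hinv T fun X hX v => ?_
    exact hsub (T * X) (Set.mul_mem_centralizer hT hX) v
  refine ⟨W.starProjection, ⟨⟨isStarProjection_starProjection, ?_, ?_, ?_⟩, ?_⟩, ?_⟩
  · intro a ha
    exact (commute_starProjection (hL a ha) (hL _ (hstar a ha))).symm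
  · intro T hT
    exact (commute_starProjection (hC T hT) (hC _ (star_mem_centralizer hstar hT))).symm
  · rw [hF.le_iff_mul_eq_right isStarProjection_starProjection]
    refine ContinuousLinearMap.ext fun v => ?_
    exact Submodule.starProjection_eq_self_iff.2 (hsub 1 (Set.one_mem_centralizer) v)
  · rintro R ⟨hR, -, hR2, hFR⟩
    rw [IsStarProjection.le_iff_mul_eq_right isStarProjection_starProjection hR]
    rw [hF.le_iff_mul_eq_right hR] at hFR
    have h1 : W ≤ LinearMap.eqLocus
        (R : EuclideanSpace ℂ (Fin p) →ₗ[ℂ] EuclideanSpace ℂ (Fin p)) LinearMap.id := by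
      rw [hW, Submodule.span_le]
      rintro _ ⟨X, hX, v, rfl⟩
      have e1 := DFunLike.congr_fun (hR2 X hX) (F v)
      have e2 := DFunLike.congr_fun hFR v
      simp only [mul_apply_eq_comp] at e1 e2
      change R (X (F v)) = X (F v)
      rw [← e1, e2]
    refine ContinuousLinearMap.ext fun v => ?_
    exact h1 (W.starProjection_apply_mem v)
  · intro D hD hDF
    have h1 : W ≤ LinearMap.ker
        (D : EuclideanSpace ℂ (Fin p) →ₗ[ℂ] EuclideanSpace ℂ (Fin p)) := by
      rw [hW, Submodule.span_le]
      rintro _ ⟨X, hX, v, rfl⟩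
      have e1 := DFunLike.congr_fun (hD X hX) (F v)
      have e2 := DFunLike.congr_fun hDF v
      simp only [mul_apply_eq_comp] at e1 e2
      change D (X (F v)) = 0
      rw [← e1, e2, zero_apply, map_zero]
    refine ContinuousLinearMap.ext fun v => ?_
    exact h1 (W.starProjection_apply_mem v)

/-- The properties of a maximal support projection `P` of `ℒ` and of the map `L` that defines it. -/
structure IsCentralSupport (L : Op p →ₗ[ℂ] Op p) (F : Op p) (ℒ : Submodule ℂ (Op p))
    (P : Op p) : Prop where
  idempotent : IsCEIdempotent L ℒ
  support : IsSupportProjection L F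
  projection : IsStarProjection P
  commute : ∀ a ∈ ℒ, P * a = a * P
  bicommutant : P ∈ Set.centralizer (Set.centralizer (ℒ : Set (Op p)))
  le : F ≤ P
  mul_eq_zero : ∀ D ∈ Set.centralizer (Set.centralizer (ℒ : Set (Op p))), D * F = 0 → D * P = 0

theorem IsMaximalSupportProjection.exists_isCentralSupport {P : Op p}
    (h : IsMaximalSupportProjection ℒ P) : ∃ L F, IsCentralSupport L F ℒ P := by
  obtain ⟨L, F, hL, hF, hP⟩ := h
  obtain ⟨P', hP', hD⟩ := exists_centralCover hF.isStarProjection (fun a ha => hL.star_mem ha)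
    (fun a ha => (hF.commute hL ha).symm)
  obtain rfl := hP.unique hP'
  exact ⟨L, F, hL, hF, hP.1.1, fun a ha => (hP.1.2.1 a ha).symm, hP.1.2.2.1, hP.1.2.2.2, hD⟩

theorem IsCEIdempotent.exists_maximalSupportProjection (hL : IsCEIdempotent L ℒ) :
    ∃ P, IsMaximalSupportProjection ℒ P := by
  obtain ⟨F, hF, -⟩ := exists_supportProjection hL.completelyPositive
  obtain ⟨P, hP, -⟩ := exists_centralCover hF.isStarProjection (fun a ha => hL.star_mem ha)
    (fun a ha => (hF.commute hL ha).symm)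
  exact ⟨P, L, F, hL, hF, hP⟩

theorem subset_bicommutant {a : Op p} (ha : a ∈ ℒ) :
    a ∈ Set.centralizer (Set.centralizer (ℒ : Set (Op p))) :=
  Set.subset_centralizer_centralizer ha

namespace IsCentralSupport

variable {F P : Op p}

/-- L(ab) - ab lies in ℒ'' and vanishes after multiplication by F, hence after multiplication by P.
-/
theorem mul_map_mul (h : IsCentralSupport L F ℒ P) {a b : Op p} (ha : a ∈ ℒ) (hb : b ∈ ℒ) :
    P * L (a * b) = P * (a * b) := by
  have h1 := h.support.mul_map_mul h.idempotent ha hb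
  have hm := h.idempotent.map_mem (a * b)
  have hcF : ∀ c ∈ ℒ, F * c = c * F := fun c hc => h.support.commute h.idempotent hc
  have h2 : (L (a * b) - a * b) * F = 0 := by
    rw [sub_mul, sub_eq_zero, ← hcF _ hm, h1, mul_assoc, ← hcF _ hb, ← mul_assoc, hcF _ ha,
      mul_assoc]
  have h3 := h.mul_eq_zero _ (by
    have := (Subalgebra.centralizer ℂ (Set.centralizer (ℒ : Set (Op p)))).sub_mem
      (subset_bicommutant hm) (Subalgebra.mul_mem _ (subset_bicommutant ha)
        (subset_bicommutant hb))
    exact this) h2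
  rw [sub_mul, sub_eq_zero, ← h.commute _ hm, mul_assoc, ← h.commute _ hb, ← mul_assoc,
    ← h.commute _ ha, mul_assoc] at h3
  exact h3

theorem mul_unit (h : IsCentralSupport L F ℒ P) : P * L 1 = P := by
  have hm := h.idempotent.map_mem 1
  have h2 : (1 - L 1) * F = 0 := by
    rw [sub_mul, one_mul, ← h.support.commute h.idempotent hm, h.support.mul_unit h.idempotent,
      sub_self]
  have h3 := h.mul_eq_zero _ (by
    have := (Subalgebra.centralizer ℂ (Set.centralizer (ℒ : Set (Op p)))).sub_mem
      (Subalgebra.one_mem _) (subset_bicommutant hm)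
    exact this) h2
  rw [sub_mul, one_mul, sub_eq_zero, ← h.commute _ hm] at h3
  exact h3.symm

theorem map_mul_left (h : IsCentralSupport L F ℒ P) (X : Op p) : L (P * X) = L X :=
  h.support.map_mul_left h.idempotent h.projection h.le X

theorem map_mul_right (h : IsCentralSupport L F ℒ P) (X : Op p) : L (X * P) = L X :=
  h.support.map_mul_right h.idempotent h.projection h.le X

end IsCentralSupport

end ChoiEffros

end QWeight

namespace QWeight

/-! ### Finite-dimensional `*`-algebras of operators with trivial centre -/

section Wedderburn

variable {E : Type*} [NormedAddCommGroup E] [InnerProductSpace ℂ E]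

/-- A linear space of operators that is closed under products and adjoints. -/
structure IsStarSubalgebra [CompleteSpace E] (N : Submodule ℂ (E →L[ℂ] E)) : Prop where
  mul_mem : ∀ a ∈ N, ∀ b ∈ N, a * b ∈ N
  star_mem : ∀ a ∈ N, star a ∈ N

variable {N : Submodule ℂ (E →L[ℂ] E)}

theorem star_mul_self_apply_eq_zero [CompleteSpace E] {a : E →L[ℂ] E} {v : E} (h : (star a * a) v = 0) :
    a v = 0 := by
  have h1 : ⟪v, (star a * a) v⟫_ℂ = ⟪a v, a v⟫_ℂ := by
    rw [mul_apply_eq_comp, ContinuousLinearMap.star_eq_adjoint,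
      ContinuousLinearMap.adjoint_inner_right]
  rw [h, inner_zero_right] at h1
  exact inner_self_eq_zero.1 h1.symm

variable [FiniteDimensional ℂ E]

theorem finrank_range_lt {x y : E →L[ℂ] E} (hker : ∀ v, y v = 0 → x v = 0) {v : E}
    (hx : x v = 0) (hy : y v ≠ 0) :
    Module.finrank ℂ (LinearMap.range (x : E →ₗ[ℂ] E)) <
      Module.finrank ℂ (LinearMap.range (y : E →ₗ[ℂ] E)) := by
  have h1 := LinearMap.finrank_range_add_finrank_ker (x : E →ₗ[ℂ] E)
  have h2 := LinearMap.finrank_range_add_finrank_ker (y : E →ₗ[ℂ] E)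
  have h3 : LinearMap.ker (y : E →ₗ[ℂ] E) < LinearMap.ker (x : E →ₗ[ℂ] E) :=
    lt_of_le_of_ne (fun w hw => hker w hw) fun heq => hy (by
      have : v ∈ LinearMap.ker (x : E →ₗ[ℂ] E) := hx
      rw [← heq] at this
      exact this)
  have h4 := Submodule.finrank_lt_finrank_of_lt h3
  omega

theorem exists_eigenvector_mem_range {x y : E →L[ℂ] E} (hy : y ≠ 0)
    (hxy : ∀ v, ∃ w, x (y v) = y w) : ∃ (μ : ℂ) (v : E), y v ≠ 0 ∧ x (y v) = μ • y v := by
  set R := LinearMap.range (y : E →ₗ[ℂ] E) with hR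
  have hmaps : ∀ v ∈ R, (x : E →ₗ[ℂ] E) v ∈ R := by
    rintro _ ⟨v, rfl⟩
    obtain ⟨w, hw⟩ := hxy v
    exact ⟨w, hw.symm⟩
  have hnt : Nontrivial R := by
    rw [Submodule.nontrivial_iff_ne_bot]
    intro hbot
    refine hy (ContinuousLinearMap.ext fun v => ?_)
    have : y v ∈ R := ⟨v, rfl⟩
    rwa [hbot] at this
  obtain ⟨μ, hμ⟩ := Module.End.exists_eigenvalue ((x : E →ₗ[ℂ] E).restrict hmaps)
  obtain ⟨⟨_, v, rfl⟩, hv⟩ := hμ.exists_hasEigenvector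
  refine ⟨μ, v, fun h0 => hv.2 (Subtype.ext h0), ?_⟩
  exact congrArg Subtype.val hv.apply_eq_smul

/-- An element of least positive rank: anything in `N` with a strictly larger kernel has smaller
rank and must be zero. This replaces spectral theory below. -/
theorem exists_minimal_rank (hne : N ≠ ⊥) : ∃ b ∈ N, b ≠ 0 ∧ ∀ x ∈ N, ∀ v,
    (∀ w, b w = 0 → x w = 0) → x v = 0 → b v ≠ 0 → x = 0 := by
  obtain ⟨b, ⟨hb, hb0⟩, hmin⟩ := (measure fun x : E →L[ℂ] E =>
    Module.finrank ℂ (LinearMap.range (x : E →ₗ[ℂ] E))).wf.has_min {x | x ∈ N ∧ x ≠ 0}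
      ((Submodule.ne_bot_iff N).1 hne)
  refine ⟨b, hb, hb0, fun x hx v hker hxv hbv => ?_⟩
  by_contra hx0
  exact hmin x ⟨hx, hx0⟩ (finrank_range_lt hker hxv hbv)

variable [CompleteSpace E]

namespace IsStarSubalgebra

/-- For b of least rank, c = b*b has the same kernel as b. If l is an eigenvalue of c on its range,
c² - lc has a larger kernel, so it is zero and e = c/l is a projection. The same argument for eae -
μe shows that e is minimal. -/
theorem exists_minimal_projection (hN : IsStarSubalgebra N) (hne : N ≠ ⊥) :
    ∃ e ∈ N, e ≠ 0 ∧ e * e = e ∧ star e = e ∧ ∀ a ∈ N, ∃ μ : ℂ, e * a * e = μ • e := by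
  obtain ⟨b, hb, hb0, hmin⟩ := exists_minimal_rank hne
  set c := star b * b with hc
  have hcN : c ∈ N := hN.mul_mem _ (hN.star_mem b hb) b hb
  have hcb : ∀ v, c v = 0 ↔ b v = 0 := fun v =>
    ⟨star_mul_self_apply_eq_zero, fun h => by rw [hc, mul_apply_eq_comp, h, map_zero]⟩
  have hcs : star c = c := by rw [hc, star_mul, star_star]
  have hc0 : c ≠ 0 := fun h => hb0 (ContinuousLinearMap.ext fun v =>
    (hcb v).1 (by rw [h]; rfl))
  have hminc : ∀ x ∈ N, ∀ v, (∀ w, c w = 0 → x w = 0) → x v = 0 → c v ≠ 0 → x = 0 :=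
    fun x hx v h1 h2 h3 => hmin x hx v (fun w hw => h1 w ((hcb w).2 hw)) h2
      fun h => h3 ((hcb v).2 h)
  obtain ⟨l, v, hv0, hv⟩ := exists_eigenvector_mem_range (x := c) hc0 fun v => ⟨c v, rfl⟩
  have hl : l ≠ 0 := by
    rintro rfl
    rw [zero_smul] at hv
    refine hv0 (star_mul_self_apply_eq_zero (a := c) ?_)
    rw [hcs]
    exact hv
  have hcc : c * c = l • c := by
    refine sub_eq_zero.1 (hminc (c * c - l • c) (sub_mem (hN.mul_mem c hcN c hcN)
      (N.smul_mem l hcN)) (c v) (fun w hw => ?_) ?_ ?_)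
    · simp [hw]
    · simp [hv]
    · rw [hv]
      exact smul_ne_zero hl hv0
  have hlr : starRingEnd ℂ l = l := by
    have h1 := congrArg star hcc
    rw [star_mul, hcs, star_smul, hcs, hcc] at h1
    have h2 : (l - starRingEnd ℂ l) • c = 0 := by rw [sub_smul, h1, starRingEnd_apply, sub_self]
    exact (sub_eq_zero.1 ((smul_eq_zero.1 h2).resolve_right hc0)).symm
  have hec : ∀ w, (l⁻¹ • c) w = 0 ↔ c w = 0 := fun w => by
    simp [hl]
  refine ⟨l⁻¹ • c, N.smul_mem _ hcN, smul_ne_zero (inv_ne_zero hl) hc0, ?_, ?_, ?_⟩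
  · rw [smul_mul_smul_comm, hcc, smul_smul, mul_assoc, inv_mul_cancel₀ hl, mul_one]
  · rw [star_smul, hcs, star_inv₀, ← starRingEnd_apply, hlr]
  · have hee : (l⁻¹ • c) * (l⁻¹ • c) = l⁻¹ • c := by
      rw [smul_mul_smul_comm, hcc, smul_smul, mul_assoc, inv_mul_cancel₀ hl, mul_one]
    have he0 : l⁻¹ • c ≠ 0 := smul_ne_zero (inv_ne_zero hl) hc0
    have heN : l⁻¹ • c ∈ N := N.smul_mem _ hcN
    generalize l⁻¹ • c = e at hec hee he0 heN
    intro a ha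
    obtain ⟨μ, v, hv0, hv⟩ := exists_eigenvector_mem_range (x := e * a * e) he0
      fun v => ⟨a (e (e v)), rfl⟩
    refine ⟨μ, sub_eq_zero.1 (hminc _ (sub_mem (hN.mul_mem _ (hN.mul_mem e heN a ha) e heN)
      (N.smul_mem μ heN)) (e v) (fun w hw => ?_) ?_ ?_)⟩
    · simp [(hec w).2 hw]
    · have h1 : e (e v) = e v := DFunLike.congr_fun hee v
      rw [sub_apply, hv, smul_apply, h1, sub_self]
    · intro h
      have h1 : e (e v) = e v := DFunLike.congr_fun hee v
      exact hv0 (by rw [← h1, (hec _).2 h])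

/-- The operators `v i` are isometries from the range of a minimal projection `e` onto mutually
orthogonal subspaces, and `N` acts on them by matrices. -/
theorem exists_isometries (hN : IsStarSubalgebra N) (hne : N ≠ ⊥) :
    ∃ (q : ℕ) (e : E →L[ℂ] E) (v : Fin q → E →L[ℂ] E), 0 < q ∧ e ≠ 0 ∧ (∀ i, v i ∈ N) ∧
      (∀ i, v i * e = v i) ∧ (∀ i j, star (v i) * v j = if i = j then e else 0) ∧
      (∀ a ∈ N, ∀ i, ∃ c : Fin q → ℂ, a * v i = ∑ k, c k • v k) ∧
      ∀ a ∈ N, ∀ i j, ∃ μ : ℂ, star (v i) * a * v j = μ • e := by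
  obtain ⟨e, heN, he0, hee, hes, hmin⟩ := hN.exists_minimal_projection hne
  obtain ⟨w, hw1, hew⟩ : ∃ w : E, ‖w‖ = 1 ∧ e w = w := by
    obtain ⟨x, hx⟩ : ∃ x, e x ≠ 0 := by
      by_contra! h
      exact he0 (ContinuousLinearMap.ext h)
    refine ⟨((‖e x‖⁻¹ : ℝ) : ℂ) • e x, ?_, ?_⟩
    · rw [norm_smul, Complex.norm_real, norm_inv, norm_norm,
        inv_mul_cancel₀ (norm_ne_zero_iff.2 hx)]
    · rw [map_smul]
      congr 1
      exact DFunLike.congr_fun hee x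
  have hw0 : w ≠ 0 := by
    rintro rfl
    simp at hw1
  -- For a unit vector w in the range of e, the map x ↦ xw takes Ne isometrically to Nw, up to the
  -- factor e (`hform`). An orthonormal basis of Nw then yields the isometries.
  set U : Submodule ℂ E := N.map ((ContinuousLinearMap.apply ℂ E w : (E →L[ℂ] E) →L[ℂ] E) :
    (E →L[ℂ] E) →ₗ[ℂ] E) with hU
  have hUmem : ∀ a ∈ N, a w ∈ U := fun a ha => ⟨a, ha, rfl⟩
  set b := stdOrthonormalBasis ℂ U with hb
  have hex : ∀ i, ∃ a ∈ N, a w = (b i : E) := fun i => (b i).2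
  choose a haN haw using hex
  have hvw : ∀ i, (a i * e) w = (b i : E) := fun i => by
    rw [mul_apply_eq_comp, hew, haw]
  have hform : ∀ x ∈ N, ∀ y ∈ N, star (x * e) * (y * e) = ⟪x w, y w⟫_ℂ • e := by
    intro x hx y hy
    obtain ⟨μ, hμ⟩ := hmin (star x * y) (hN.mul_mem _ (hN.star_mem x hx) y hy)
    have h1 : star (x * e) * (y * e) = μ • e := by
      rw [← hμ, star_mul, hes]
      simp only [mul_assoc]
    have h2 : ⟪w, (star (x * e) * (y * e)) w⟫_ℂ = ⟪x w, y w⟫_ℂ := by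
      rw [mul_apply_eq_comp, ContinuousLinearMap.star_eq_adjoint,
        ContinuousLinearMap.adjoint_inner_right, mul_apply_eq_comp, mul_apply_eq_comp, hew]
    rw [h1, smul_apply, hew, inner_smul_right, inner_self_eq_norm_sq_to_K, hw1] at h2
    rw [h1, ← h2]
    simp
  have heq : ∀ x ∈ N, x * e = x → x w = 0 → x = 0 := by
    intro x hx hxe hxw
    have h1 := hform x hx x hx
    rw [hxe, hxw, inner_zero_left, zero_smul] at h1
    exact ContinuousLinearMap.ext fun y => star_mul_self_apply_eq_zero (by rw [h1]; rfl)
  have hvN : ∀ i, a i * e ∈ N := fun i => hN.mul_mem _ (haN i) e heN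
  have hve : ∀ i, a i * e * e = a i * e := fun i => by rw [mul_assoc, hee]
  have hact : ∀ x ∈ N, ∀ i, ∃ c : Fin (Module.finrank ℂ U) → ℂ,
      x * (a i * e) = ∑ k, c k • (a k * e) := by
    intro x hx i
    have hxb : x (b i : E) ∈ U := by
      rw [← haw i]
      exact hUmem (x * a i) (hN.mul_mem x hx _ (haN i))
    refine ⟨fun k => b.repr ⟨_, hxb⟩ k, sub_eq_zero.1 (heq _ ?_ ?_ ?_)⟩
    · exact sub_mem (hN.mul_mem x hx _ (hvN i))
        (Submodule.sum_mem _ fun k _ => N.smul_mem _ (hvN k))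
    · rw [sub_mul, mul_assoc, hve, Finset.sum_mul]
      simp only [smul_mul_assoc, hve]
    · have h1 := congrArg Subtype.val (b.sum_repr ⟨_, hxb⟩)
      simp only [Submodule.coe_sum, Submodule.coe_smul] at h1
      rw [sub_apply, mul_apply_eq_comp, hvw, sum_apply, sub_eq_zero]
      simp only [smul_apply, hvw]
      exact h1.symm
  refine ⟨Module.finrank ℂ U, e, fun i => a i * e, ?_, he0, hvN, hve, ?_, hact, ?_⟩
  · have : Nontrivial U := by
      refine ⟨⟨w, hew ▸ hUmem e heN⟩, 0, fun h => hw0 (congrArg Subtype.val h)⟩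
    exact Module.finrank_pos
  · intro i j
    rw [hform _ (haN i) _ (haN j), haw, haw]
    have h1 := orthonormal_iff_ite.1 b.orthonormal i j
    rw [Submodule.coe_inner] at h1
    rw [h1]
    split_ifs <;> simp
  · intro x hx i j
    refine ⟨⟪a i w, x (a j w)⟫_ℂ, ?_⟩
    have := hform _ (haN i) (x * a j) (hN.mul_mem x hx _ (haN j))
    rw [mul_assoc, ← mul_assoc x]
    exact this

/-- A finite-dimensional `*`-algebra of operators without non-trivial central projections is a
full matrix algebra. -/
theorem exists_matrix_equiv (hN : IsStarSubalgebra N) (hne : N ≠ ⊥)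
    (hcentral : ∀ Z ∈ N, IsStarProjection Z → (∀ a ∈ N, Z * a = a * Z) → Z ≠ 0 →
      ∀ a ∈ N, Z * a = a) :
    ∃ q : ℕ, 0 < q ∧ ∃ Θ : Matrix (Fin q) (Fin q) ℂ ≃ₗ[ℂ] N,
      (∀ X, (Θ X.conjTranspose : E →L[ℂ] E) = star (Θ X : E →L[ℂ] E)) ∧
      ∀ X Y, (Θ (X * Y) : E →L[ℂ] E) = (Θ X : E →L[ℂ] E) * (Θ Y : E →L[ℂ] E) := by
  obtain ⟨q, e, v, hq, he0, hvN, hve, hvv, hact, hmin⟩ := hN.exists_isometries hne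
  have hvne : ∀ i, v i ≠ 0 := fun i h => he0 (by
    have := hvv i i
    rw [h, if_pos rfl, mul_zero] at this
    exact this.symm)
  -- Z is the projection onto the span of the ranges of the `v i`. `N` leaves this span invariant,
  -- so Z is central and, by hypothesis, the unit of `N`.
  set Z := ∑ i, v i * star (v i) with hZ
  have hZN : Z ∈ N := Submodule.sum_mem _ fun i _ => hN.mul_mem _ (hvN i) _ (hN.star_mem _ (hvN i))
  have hZs : star Z = Z := by simp [hZ, star_sum]
  have hZv : ∀ j, Z * v j = v j := by
    intro j
    simp only [hZ, Finset.sum_mul, mul_assoc, hvv, mul_ite, mul_zero, hve]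
    simp
  have haZ : ∀ a ∈ N, Z * (a * Z) = a * Z := by
    intro a ha
    have h1 : ∀ i, Z * (a * v i) = a * v i := by
      intro i
      obtain ⟨c, hc⟩ := hact a ha i
      rw [hc, Finset.mul_sum]
      exact Finset.sum_congr rfl fun k _ => by rw [mul_smul_comm, hZv]
    have h2 : a * Z = ∑ i, (a * v i) * star (v i) := by
      simp only [hZ, Finset.mul_sum, mul_assoc]
    rw [h2, Finset.mul_sum]
    exact Finset.sum_congr rfl fun i _ => by rw [← mul_assoc, h1]
  have hcomm : ∀ a ∈ N, Z * a = a * Z := by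
    intro a ha
    have h1 := congrArg star (haZ _ (hN.star_mem a ha))
    simp only [star_mul, star_star, hZs] at h1
    rw [← h1, mul_assoc, haZ a ha]
  have hZZ : Z * Z = Z := by
    conv_lhs => rw [hZ]
    conv_rhs => rw [hZ]
    rw [← hZ, Finset.mul_sum]
    exact Finset.sum_congr rfl fun i _ => by rw [← mul_assoc, hZv]
  have hZ0 : Z ≠ 0 := fun h => hvne ⟨0, hq⟩ (by rw [← hZv, h, zero_mul])
  have hZa := hcentral Z hZN ⟨hZZ, hZs⟩ hcomm hZ0
  let θ : Matrix (Fin q) (Fin q) ℂ →ₗ[ℂ] N :=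
    { toFun := fun X => ⟨∑ i, ∑ j, X i j • (v i * star (v j)), Submodule.sum_mem _ fun i _ =>
        Submodule.sum_mem _ fun j _ =>
          N.smul_mem _ (hN.mul_mem _ (hvN i) _ (hN.star_mem _ (hvN j)))⟩
      map_add' := fun X Y => Subtype.ext (by
        simp [add_smul, Finset.sum_add_distrib])
      map_smul' := fun c X => Subtype.ext (by
        simp [mul_smul, Finset.smul_sum]) }
  have hθ : ∀ X, (θ X : E →L[ℂ] E) = ∑ i, ∑ j, X i j • (v i * star (v j)) := fun X => rfl
  have hθv : ∀ X k, (θ X : E →L[ℂ] E) * v k = ∑ i, X i k • v i := by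
    intro X k
    rw [hθ, Finset.sum_mul]
    refine Finset.sum_congr rfl fun i _ => ?_
    simp only [Finset.sum_mul, smul_mul_assoc, mul_assoc, hvv, mul_ite, mul_zero, hve, smul_ite,
      smul_zero]
    simp
  have hinj : Function.Injective θ := by
    rw [injective_iff_map_eq_zero]
    intro X hX
    ext k l
    have h1 := hθv X l
    rw [hX, Submodule.coe_zero, zero_mul] at h1
    have h2 := congrArg (fun T => star (v k) * T) h1
    simp only [mul_zero, Finset.mul_sum, mul_smul_comm, hvv, smul_ite, smul_zero,
      Finset.sum_ite_eq, Finset.mem_univ, if_true] at h2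
    exact (smul_eq_zero.1 h2.symm).resolve_right he0
  have hsurj : Function.Surjective θ := by
    rintro ⟨a, ha⟩
    choose c hc using fun i j => hmin a ha i j
    refine ⟨Matrix.of c, Subtype.ext ?_⟩
    have h1 : a = Z * (a * Z) := by rw [haZ a ha, ← hcomm a ha, hZa a ha]
    change (θ (Matrix.of c) : E →L[ℂ] E) = a
    simp only [hθ, Matrix.of_apply]
    rw [h1, hZ, Finset.sum_mul]
    refine Finset.sum_congr rfl fun i _ => ?_
    rw [Finset.mul_sum, Finset.mul_sum]
    refine Finset.sum_congr rfl fun j _ => ?_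
    calc c i j • (v i * star (v j)) = v i * (c i j • e) * star (v j) := by
          rw [mul_smul_comm, hve, smul_mul_assoc]
      _ = _ := by rw [← hc]; simp only [mul_assoc]
  have hbij : Function.Bijective θ := ⟨hinj, hsurj⟩
  refine ⟨q, hq, LinearEquiv.ofBijective θ hbij, fun X => ?_, fun X Y => ?_⟩
  · rw [LinearEquiv.ofBijective_apply, LinearEquiv.ofBijective_apply, hθ, hθ, star_sum,
      Finset.sum_comm]
    refine Finset.sum_congr rfl fun i _ => ?_
    rw [star_sum]
    refine Finset.sum_congr rfl fun j _ => ?_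
    rw [star_smul, star_mul, star_star, Matrix.conjTranspose_apply]
  · rw [LinearEquiv.ofBijective_apply, LinearEquiv.ofBijective_apply,
      LinearEquiv.ofBijective_apply]
    have h1 : (θ X : E →L[ℂ] E) * (θ Y : E →L[ℂ] E) =
        ∑ k, ∑ l, ∑ i, (X i k * Y k l) • (v i * star (v l)) := by
      rw [hθ Y, Finset.mul_sum]
      refine Finset.sum_congr rfl fun k _ => ?_
      rw [Finset.mul_sum]
      refine Finset.sum_congr rfl fun l _ => ?_
      rw [mul_smul_comm, ← mul_assoc, hθv, Finset.sum_mul, Finset.smul_sum]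
      exact Finset.sum_congr rfl fun i _ => by rw [smul_mul_assoc, smul_smul, mul_comm (Y k l)]
    rw [h1, hθ]
    simp only [Matrix.mul_apply, Finset.sum_smul]
    symm
    calc ∑ k, ∑ l, ∑ i, (X i k * Y k l) • (v i * star (v l))
        = ∑ l, ∑ k, ∑ i, (X i k * Y k l) • (v i * star (v l)) := Finset.sum_comm
      _ = ∑ l, ∑ i, ∑ k, (X i k * Y k l) • (v i * star (v l)) :=
        Finset.sum_congr rfl fun l _ => Finset.sum_comm
      _ = _ := Finset.sum_comm

end IsStarSubalgebra

end Wedderburn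

end QWeight

namespace QWeight

/-! ### Choi–Effros factors: extremality of the identity, and positivity at P. -/

section Factor

variable {p q : ℕ} {L L' : Op p →ₗ[ℂ] Op p} {ℒ : Submodule ℂ (Op p)}

theorem op_star_zero : star (0 : Op p) = 0 := star_zero (Op p)

theorem op_star_sub (A B : Op p) : star (A - B) = star A - star B := star_sub A B

theorem mul_self_le_norm_smul {X : Op p} (hX : 0 ≤ X) : X * X ≤ ‖X‖ • X := by
  have h3 := (IsSelfAdjoint.of_nonneg hX).le_algebraMap_norm_self
  have h4 := conj_le_of_le_algebraMap h3 (B := CFC.sqrt X)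
  rw [(CFC.sqrt_nonneg X).isSelfAdjoint.star_eq] at h4
  have h5 := CFC.sqrt_mul_sqrt_self X hX
  rw [h5] at h4
  refine le_trans (le_of_eq ?_) h4
  calc X * X = (CFC.sqrt X * CFC.sqrt X) * (CFC.sqrt X * CFC.sqrt X) := by rw [h5]
    _ = CFC.sqrt X * (CFC.sqrt X * CFC.sqrt X) * CFC.sqrt X := by simp only [mul_assoc]
    _ = CFC.sqrt X * X * CFC.sqrt X := by rw [h5]

/-- From CBC ≤ CAC one gets L(CBC) = 0; then (BC)*(BC) ≤ ‖B‖ CBC and the Schwarz inequality give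
L(BC) = 0. -/
theorem IsCEIdempotent.map_mul_eq_zero (h : IsCEIdempotent L ℒ) {A B C : Op p} (hB : 0 ≤ B)
    (hBA : B ≤ A) (hC : C ∈ ℒ) (hCs : star C = C) (hAC : L (A * C) = 0) : L (B * C) = 0 := by
  have h1 : L (C * A * C) = 0 := by
    rw [mul_assoc, ← h.map_mul_map hC, hAC, mul_zero, map_zero]
  have hle := star_left_conjugate_le_conjugate hBA C
  have hnn := star_left_conjugate_nonneg hB C
  rw [hCs] at hle hnn
  have h2 : L (C * B * C) = 0 :=
    le_antisymm ((h.completelyPositive.mono hle).trans_eq h1) (h.completelyPositive.nonneg hnn)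
  have h3 : star (B * C) * (B * C) ≤ ‖B‖ • (C * B * C) := by
    have h4 := star_left_conjugate_le_conjugate (mul_self_le_norm_smul hB) C
    rw [star_mul, (IsSelfAdjoint.of_nonneg hB).star_eq]
    rw [hCs] at h4 ⊢
    have e1 : C * (‖B‖ • B) * C = ‖B‖ • (C * B * C) :=
      ContinuousLinearMap.ext fun x => by
        simp only [mul_apply_eq_comp, smul_apply, ← Complex.coe_smul, map_smul]
    rw [e1] at h4
    simpa only [mul_assoc] using h4
  have h4 := map_eq_zero_of_le_smul h.completelyPositive (star_mul_self_nonneg _) h3 h2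
  have h5 := h.schwarz (B * C)
  rw [h4] at h5
  exact op_star_mul_self_eq_zero _ (le_antisymm h5 (star_mul_self_nonneg _))

theorem IsCEIdempotent.map_star_mul_eq_zero (h : IsCEIdempotent L ℒ) {A B : Op p}
    (hA : star A = A) (hB : star B = B) (hAB : L (A * B) = 0) : L (B * A) = 0 := by
  have h1 := congrArg star hAB
  rw [← h.completelyPositive.map_star, star_mul, hA, hB, op_star_zero] at h1
  exact h1

/-- A positive map on `ℒ` that is dominated by the identity is multiplication by its value at the
unit, on projections. -/
theorem IsCEIdempotent.apply_projection (h : IsCEIdempotent L ℒ) {Φ : Op p →ₗ[ℂ] Op p}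
    (hmem : ∀ A ∈ ℒ, Φ A ∈ ℒ) (hpos : ∀ A ∈ ℒ, 0 ≤ A → 0 ≤ Φ A ∧ Φ A ≤ A) {A : Op p}
    (hA : A ∈ ℒ) (hAs : star A = A) (hAA : L (A * A) = A) :
    L (A * Φ (L 1)) = Φ A ∧ L (Φ (L 1) * A) = Φ A := by
  set C := L 1 - A with hC
  have hu : L 1 ∈ ℒ := h.map_mem 1
  have hCm : C ∈ ℒ := sub_mem hu hA
  have hus : star (L 1) = L 1 := by rw [← h.completelyPositive.map_star, star_one]
  have hCs : star C = C := by rw [hC, op_star_sub, hus, hAs]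
  have hAC : L (A * C) = 0 := by rw [hC, mul_sub, map_sub, h.mul_unit hA, hAA, sub_self]
  have hCA : L (C * A) = 0 := h.map_star_mul_eq_zero hAs hCs hAC
  have hCC : L (C * C) = C := by
    conv_lhs => rw [hC]
    rw [← hC, sub_mul, map_sub, h.unit_mul hCm, hAC, sub_zero]
  have hA0 : 0 ≤ A := by
    rw [← hAA]
    nth_rewrite 1 [← hAs]
    exact h.completelyPositive.nonneg (star_mul_self_nonneg A)
  have hC0 : 0 ≤ C := by
    rw [← hCC]
    nth_rewrite 1 [← hCs]
    exact h.completelyPositive.nonneg (star_mul_self_nonneg C)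
  obtain ⟨hΦA, hΦA'⟩ := hpos A hA hA0
  obtain ⟨hΦC, hΦC'⟩ := hpos C hCm hC0
  have hsA : star (Φ A) = Φ A := (IsSelfAdjoint.of_nonneg hΦA).star_eq
  have hsC : star (Φ C) = Φ C := (IsSelfAdjoint.of_nonneg hΦC).star_eq
  -- Φ(A) ≤ A is orthogonal to the complement C of A, and Φ(C) ≤ C is orthogonal to A, so A picks
  -- out the summand Φ(A) of Φ(I_o).
  have e1 : L (Φ A * C) = 0 := h.map_mul_eq_zero hΦA hΦA' hCm hCs hAC
  have e2 : L (Φ C * A) = 0 := h.map_mul_eq_zero hΦC hΦC' hA hAs hCA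
  have e3 : L (C * Φ A) = 0 := h.map_star_mul_eq_zero hsA hCs e1
  have e4 : L (A * Φ C) = 0 := h.map_star_mul_eq_zero hsC hAs e2
  have hsum : Φ (L 1) = Φ A + Φ C := by rw [← map_add, hC, add_sub_cancel]
  have hsum' : L 1 = A + C := by rw [hC, add_sub_cancel]
  have hm := hmem A hA
  constructor
  · rw [hsum, mul_add, map_add, e4, add_zero]
    conv_rhs => rw [← h.unit_mul hm, hsum', add_mul, map_add, e3, add_zero]
  · rw [hsum, add_mul, map_add, e2, add_zero]
    conv_rhs => rw [← h.mul_unit hm, hsum', mul_add, map_add, e1, add_zero]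

/-- `Θ` is a `*`-isomorphism of the `q × q` matrices onto `ℒ` with the Choi–Effros product. -/
structure IsFactorIso (L : Op p →ₗ[ℂ] Op p) (ℒ : Submodule ℂ (Op p))
    (Θ : Matrix (Fin q) (Fin q) ℂ ≃ₗ[ℂ] ℒ) : Prop where
  idempotent : IsCEIdempotent L ℒ
  star_eq : ∀ X, (Θ X.conjTranspose : Op p) = star (Θ X : Op p)
  mul_eq : ∀ X Y, (Θ (X * Y) : Op p) = L ((Θ X : Op p) * (Θ Y : Op p))

namespace IsFactorIso

variable {Θ : Matrix (Fin q) (Fin q) ℂ ≃ₗ[ℂ] ℒ}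

theorem of_idempotent (h : IsFactorIso L ℒ Θ) (h' : IsCEIdempotent L' ℒ) : IsFactorIso L' ℒ Θ :=
  ⟨h', h.star_eq, fun X Y => by
    rw [h.mul_eq, h.idempotent.map_mul_eq h' (Θ X).2 (Θ Y).2]⟩

/-- The identity map of a factor is extremal. -/
theorem exists_eq_smul (h : IsFactorIso L ℒ Θ) {Φ : Op p →ₗ[ℂ] Op p}
    (hmem : ∀ A ∈ ℒ, Φ A ∈ ℒ) (hpos : ∀ A ∈ ℒ, 0 ≤ A → 0 ≤ Φ A ∧ Φ A ≤ A) :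
    ∃ l : ℂ, ∀ A ∈ ℒ, Φ A = l • A := by
  obtain ⟨z, hz⟩ := Θ.surjective ⟨Φ (L 1), hmem _ (h.idempotent.map_mem 1)⟩
  have hz' : (Θ z : Op p) = Φ (L 1) := congrArg Subtype.val hz
  let θ : Matrix (Fin q) (Fin q) ℂ →ₗ[ℂ] Op p := ℒ.subtype ∘ₗ Θ.toLinearMap
  -- `S` collects the matrices on which Φ is both left and right multiplication by z. It contains
  -- all projections, and these span the matrices. Hence z is central, that is, a scalar.
  let S : Submodule ℂ (Matrix (Fin q) (Fin q) ℂ) :=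
    LinearMap.eqLocus (θ ∘ₗ LinearMap.mulRight ℂ z) (Φ ∘ₗ θ) ⊓
      LinearMap.eqLocus (θ ∘ₗ LinearMap.mulLeft ℂ z) (Φ ∘ₗ θ)
  have hproj : ∀ X : Matrix (Fin q) (Fin q) ℂ, X.conjTranspose = X → X * X = X → X ∈ S := by
    intro X hXs hXX
    have h1 := h.idempotent.apply_projection hmem hpos (Θ X).2
      (by rw [← h.star_eq, hXs]) (by rw [← h.mul_eq, hXX])
    rw [← hz', ← h.mul_eq, ← h.mul_eq] at h1
    exact h1
  have hdiag : ∀ i, Matrix.single i i (1 : ℂ) ∈ S := fun i =>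
    hproj _ (by simp [Matrix.conjTranspose_single]) (by simp)
  have hoff : ∀ i j, i ≠ j → ∀ c : ℂ, c * starRingEnd ℂ c = 1 →
      c • Matrix.single i j (1 : ℂ) + (starRingEnd ℂ c) • Matrix.single j i (1 : ℂ) ∈ S := by
    intro i j hij c hc
    have hc' : starRingEnd ℂ c * c = 1 := by rw [mul_comm, hc]
    -- For |c| = 1, M/2 is a rank-one projection with off-diagonal entries c/2 and its conjugate.
    -- The choices c = 1 and c = i together isolate the unit (i,j).
    set M := Matrix.single i i (1 : ℂ) + Matrix.single j j (1 : ℂ) +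
      (c • Matrix.single i j (1 : ℂ) + (starRingEnd ℂ c) • Matrix.single j i (1 : ℂ)) with hM
    have hMs : M.conjTranspose = M := by
      rw [hM]
      simp only [Matrix.conjTranspose_smul, Matrix.conjTranspose_add, Matrix.conjTranspose_single,
        star_one]
      rw [← starRingEnd_apply, ← starRingEnd_apply, Complex.conj_conj]
      abel
    have hMM : M * M = (2 : ℂ) • M := by
      rw [hM]
      simp only [mul_add, add_mul, mul_smul_comm, smul_mul_assoc, Matrix.single_mul_single_same,
        Matrix.single_mul_single_of_ne _ _ _ _ hij, Matrix.single_mul_single_of_ne _ _ _ _ hij.symm,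
        smul_add, mul_one, smul_zero, add_zero, zero_add]
      rw [smul_smul, smul_smul, hc, hc']
      module
    have h1 := hproj ((2⁻¹ : ℂ) • M)
      (by rw [Matrix.conjTranspose_smul, hMs, ← starRingEnd_apply, map_inv₀, Complex.conj_ofNat])
      (by rw [smul_mul_smul_comm, hMM, smul_smul]; norm_num)
    have h2 := sub_mem (S.smul_mem 2 h1) (add_mem (hdiag i) (hdiag j))
    rw [smul_smul, mul_inv_cancel₀ two_ne_zero, one_smul, hM, add_sub_cancel_left] at h2
    exact h2
  have hall : ∀ i j, Matrix.single i j (1 : ℂ) ∈ S := by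
    intro i j
    by_cases hij : i = j
    · subst hij
      exact hdiag i
    have h1 := hoff i j hij 1 (by simp)
    have h2 := S.smul_mem (-Complex.I) (hoff i j hij Complex.I (by simp))
    have h3 := S.smul_mem (2⁻¹ : ℂ) (add_mem h1 h2)
    convert h3 using 1
    simp only [map_one, one_smul, Complex.conj_I, smul_add, smul_smul, neg_mul, mul_neg,
      Complex.I_mul_I, neg_neg]
    module
  have htop : ∀ X, X ∈ S := by
    intro X
    rw [Matrix.matrix_eq_sum_single X]
    refine Submodule.sum_mem _ fun i _ => Submodule.sum_mem _ fun j _ => ?_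
    have := S.smul_mem (X i j) (hall i j)
    simpa using this
  have hcomm : ∀ X, X * z = z * X := fun X =>
    Θ.injective (Subtype.ext ((htop X).1.trans (htop X).2.symm))
  obtain ⟨l, hl⟩ := Matrix.mem_range_scalar_of_commute_single (M := z)
    fun i j _ => hcomm (Matrix.single i j 1)
  refine ⟨l, fun A hA => ?_⟩
  obtain ⟨X, hX⟩ := Θ.surjective ⟨A, hA⟩
  have hX' : (Θ X : Op p) = A := congrArg Subtype.val hX
  rw [← hX', show Φ (Θ X) = Θ (X * z) from (htop X).1.symm, ← hl, Matrix.scalar_apply, ← Matrix.smul_one_eq_diagonal,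
    mul_smul_comm, mul_one, map_smul, Submodule.coe_smul]

/-- All completely positive contractive idempotents with range `ℒ` charge the maximal support
projection of the factor `ℒ`. -/
theorem map_centralSupport_ne_zero (h : IsFactorIso L ℒ Θ) {F P : Op p}
    (hP : IsCentralSupport L F ℒ P) (hq : 0 < q) (h' : IsCEIdempotent L' ℒ) : L' P ≠ 0 := by
  intro h0
  obtain ⟨F', hF', -⟩ := exists_supportProjection h'.completelyPositive
  have hF := hP.support
  have hL := h.idempotent
  let v : Fin q → Fin q → Op p := fun i j => (Θ (Matrix.single i j 1) : Op p)
  have hv : ∀ i j, v i j ∈ ℒ := fun i j => (Θ _).2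
  have hvv : ∀ i j k l, L (v i j * v k l) = if j = k then v i l else 0 := by
    intro i j k l
    rw [← h.mul_eq]
    split_ifs with hjk
    · subst hjk
      rw [Matrix.single_mul_single_same, mul_one]
    · rw [Matrix.single_mul_single_of_ne _ _ _ _ hjk, LinearEquiv.map_zero, Submodule.coe_zero]
  have hvF : ∀ i j k l, F * (v i j * v k l) = if j = k then F * v i l else 0 := by
    intro i j k l
    rw [← hF.mul_map_mul hL (hv i j) (hv k l), hvv, mul_ite, mul_zero]
  have hvF' : ∀ i j k l, F' * (v i j * v k l) = if j = k then F' * v i l else 0 := by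
    intro i j k l
    rw [← hF'.mul_map_mul h' (hv i j) (hv k l), h'.map_mul_eq hL (hv i j) (hv k l), hvv, mul_ite,
      mul_zero]
  let o : Fin q := ⟨0, hq⟩
  have key : ∀ T : Op p, F' * v o o * T * (v o o * F) = 0 := by
    intro T
    -- The maps A ↦ FA and A ↦ F'A are both representations of the matrix algebra, and X is the
    -- intertwiner obtained from T by summing over matrix units; so X ∈ ℒ'.
    set X := ∑ i, F' * v i o * T * (v o i * F) with hX
    have hleft : ∀ k l, v k l * X = F' * v k o * T * (v o l * F) := by
      intro k l
      rw [hX, Finset.mul_sum, Finset.sum_eq_single l]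
      · calc v k l * (F' * v l o * T * (v o l * F))
            = (v k l * F') * v l o * T * (v o l * F) := by simp only [mul_assoc]
          _ = (F' * (v k l * v l o)) * T * (v o l * F) := by
            rw [← hF'.commute h' (hv k l)]; simp only [mul_assoc]
          _ = _ := by rw [hvF', if_pos rfl]
      · intro i _ hi
        calc v k l * (F' * v i o * T * (v o i * F))
            = (v k l * F') * v i o * T * (v o i * F) := by simp only [mul_assoc]
          _ = (F' * (v k l * v i o)) * T * (v o i * F) := by
            rw [← hF'.commute h' (hv k l)]; simp only [mul_assoc]
          _ = 0 := by rw [hvF', if_neg (Ne.symm hi), zero_mul, zero_mul]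
      · simp
    have hright : ∀ k l, X * v k l = F' * v k o * T * (v o l * F) := by
      intro k l
      rw [hX, Finset.sum_mul, Finset.sum_eq_single k]
      · calc F' * v k o * T * (v o k * F) * v k l
            = F' * v k o * T * (v o k * (F * v k l)) := by simp only [mul_assoc]
          _ = F' * v k o * T * ((v o k * v k l) * F) := by
            rw [hF.commute hL (hv k l)]; simp only [mul_assoc]
          _ = F' * v k o * T * (v o l * F) := by
            rw [mul_assoc (v o k), ← hF.commute hL (hv k l), ← mul_assoc (v o k),
              ← hF.commute hL (hv o k), mul_assoc F, hvF, if_pos rfl, hF.commute hL (hv o l)]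
      · intro i _ hi
        calc F' * v i o * T * (v o i * F) * v k l
            = F' * v i o * T * ((v o i * F) * v k l) := by simp only [mul_assoc]
          _ = 0 := by
            rw [← hF.commute hL (hv o i), mul_assoc F, hvF, if_neg hi, mul_zero]
      · simp
    have hcent : X ∈ Set.centralizer (ℒ : Set (Op p)) := by
      have hlin : ∀ Y : Matrix (Fin q) (Fin q) ℂ, (Θ Y : Op p) * X = X * (Θ Y : Op p) := by
        intro Y
        have hY : (Θ Y : Op p) = ∑ i, ∑ j, Y i j • v i j := by
          let θ : Matrix (Fin q) (Fin q) ℂ →ₗ[ℂ] Op p := ℒ.subtype ∘ₗ Θ.toLinearMap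
          change θ Y = ∑ i, ∑ j, Y i j • θ (Matrix.single i j 1)
          conv_lhs => rw [Matrix.matrix_eq_sum_single Y]
          rw [map_sum]
          refine Finset.sum_congr rfl fun i _ => ?_
          rw [map_sum]
          refine Finset.sum_congr rfl fun j _ => ?_
          rw [← map_smul, Matrix.smul_single, smul_eq_mul, mul_one]
        rw [hY, Finset.sum_mul, Finset.mul_sum]
        refine Finset.sum_congr rfl fun i _ => ?_
        rw [Finset.sum_mul, Finset.mul_sum]
        refine Finset.sum_congr rfl fun j _ => ?_
        rw [smul_mul_assoc, mul_smul_comm, hleft, hright]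
      intro a ha
      obtain ⟨Y, hY⟩ := Θ.surjective ⟨a, ha⟩
      have hY' : (Θ Y : Op p) = a := congrArg Subtype.val hY
      rw [← hY']
      exact hlin Y
    have hPX := hP.bicommutant X hcent
    have hFP : F * P = F := (hF.isStarProjection.le_iff_mul_eq_left hP.projection).1 hP.le
    have hF'P : F' * P = 0 := hF'.faithful h'.completelyPositive hP.projection.nonneg h0
    have hPF' : P * F' = 0 := by
      have := congrArg star hF'P
      rw [star_mul, hP.projection.isSelfAdjoint.star_eq,
        hF'.isStarProjection.isSelfAdjoint.star_eq, op_star_zero] at this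
      exact this
    have hXP : X * P = X := by
      rw [hX, Finset.sum_mul]
      exact Finset.sum_congr rfl fun i _ => by rw [mul_assoc, mul_assoc (v o i), hFP]
    have hPX0 : P * X = 0 := by
      rw [hX, Finset.mul_sum]
      refine Finset.sum_eq_zero fun i _ => ?_
      calc P * (F' * v i o * T * (v o i * F)) = (P * F') * v i o * T * (v o i * F) := by
            simp only [mul_assoc]
        _ = 0 := by rw [hPF', zero_mul, zero_mul, zero_mul]
    -- P ∈ ℒ'' commutes with X, while FP = F gives XP = X and F'P = 0 gives PX = 0.
    have hX0 : X = 0 := by rw [← hXP, hPX, hPX0]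
    rw [← hleft o o, hX0, mul_zero]
  have hvo : v o o ≠ 0 := by
    intro hz
    have h1 : Θ (Matrix.single o o 1) = 0 := Subtype.ext hz
    have h2 := Θ.map_eq_zero_iff.1 h1
    have h3 := congrFun (congrFun h2 o) o
    simp at h3
  obtain ⟨w, hw⟩ : ∃ w, (v o o * F) w ≠ 0 := by
    by_contra! hcon
    have h1 : v o o * F = 0 := ContinuousLinearMap.ext hcon
    refine hvo ?_
    rw [← hL.map_eq (hv o o), ← hF.map_mul_right hL hF.isStarProjection le_rfl, h1, map_zero]
  obtain ⟨w', hw'⟩ : ∃ w, (F' * v o o) w ≠ 0 := by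
    by_contra! hcon
    have h1 : F' * v o o = 0 := ContinuousLinearMap.ext hcon
    refine hvo ?_
    rw [← h'.map_eq (hv o o), ← hF'.map_mul_left h' hF'.isStarProjection le_rfl, h1, map_zero]
  -- With this rank-one T, the operator in `key` sends w to ‖v_oo F w‖² F' v_oo w', a non-zero
  -- vector.
  have h1 := DFunLike.congr_fun (key (InnerProductSpace.rankOne ℂ w' ((v o o * F) w))) w
  rw [mul_apply_eq_comp, mul_apply_eq_comp, InnerProductSpace.rankOne_apply, map_smul,
    zero_apply, smul_eq_zero] at h1
  exact h1.elim (fun h2 => hw (inner_self_eq_zero.1 h2)) hw'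

end IsFactorIso

end Factor

end QWeight

namespace QWeight

/-! ### The subordinate obtained by cutting with P. -/

section CentralCut

variable {p q : ℕ} {ω η : bAlg p →ₗ[ℂ] Op p} {L : Op p →ₗ[ℂ] Op p} {ℒ : Submodule ℂ (Op p)}
  {F P : Op p} {Θ : Matrix (Fin q) (Fin q) ℂ ≃ₗ[ℂ] ℒ}

theorem op_zero_smul (A : Op p) : (0 : ℂ) • A = 0 :=
  ContinuousLinearMap.ext fun x => by rw [smul_apply, zero_smul, zero_apply]

/-- The same splitting is used at every r. An X with D'(X) = 0 has u_r(X) = 0 for every r, so u(X) =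
0; this detects that the subordinate is not zero. -/
theorem IsQWeightMap.exists_subordinate_of_splitting (hω : IsQWeightMap ω)
    {D D' : Module.End ℂ (Op p)} (hD : IsSplitting D D' (LinearMap.range ω))
    {ℛ : Submodule ℂ (Op p)} (hℛ : ∀ A ∈ LinearMap.range ω, D A ∈ ℛ) :
    ∃ u : Module.End ℂ (Op p), IsCompletelyPositive u ∧ IsContractive u ∧
      IsQSubordinate ω ((1 - u) ∘ₗ ω) ∧ (∀ A ∈ LinearMap.range ω, A - u A ∈ ℛ) ∧
      ∀ X, D' X = 0 → u X = 0 := by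
  have hD' : ∀ r : ℝ, 0 < r → IsSplitting D D' (LinearMap.range ω) := fun _ _ => hD
  obtain ⟨u, hcp, hc, hlim⟩ := hω.exists_stopped_limit hD'
  refine ⟨u, hcp, hc, hω.isQSubordinate_of_splitting hD' hlim,
    fun A hA => hω.sub_limit_mem hD' hlim (fun _ _ => hℛ) hA, fun X hX => ?_⟩
  refine tendsto_nhds_unique (hlim X) ?_
  have h : (fun r => stopped D D' (repLam ω r) X) = fun _ => 0 := funext fun r => by
    rw [stopped, Module.End.mul_apply, hX, map_zero]
  rw [h]
  exact tendsto_const_nhds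

/-- The map `X ↦ P X P`. -/
noncomputable def compress (P : Op p) : Module.End ℂ (Op p) := LinearMap.mulLeftRight ℂ (P, P)

theorem compress_apply (P X : Op p) : compress P X = P * X * P := LinearMap.mulLeftRight_apply ..

theorem compress_completelyPositive (hP : star P = P) : IsCompletelyPositive (compress P) :=
  IsCompletelyPositive.conj' hP

theorem isSplitting_compress (hP : IsStarProjection P) (hc : ∀ a ∈ ℒ, P * a = a * P) :
    IsSplitting (compress P) (compress (1 - P)) ℒ where
  left := compress_completelyPositive hP.isSelfAdjoint.star_eq
  right := compress_completelyPositive hP.one_sub.isSelfAdjoint.star_eq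
  one_le := by
    rw [compress_apply, compress_apply, mul_one, mul_one, hP.isIdempotentElem.eq,
      hP.one_sub.isIdempotentElem.eq, add_sub_cancel]
  add_eq A hA := by
    have h := hP.isIdempotentElem.eq
    rw [compress_apply, compress_apply, hc A hA, mul_assoc, h]
    have h2 : (1 - P) * A = A * (1 - P) := by rw [sub_mul, mul_sub, hc A hA, one_mul, mul_one]
    rw [h2, mul_assoc, hP.one_sub.isIdempotentElem.eq, ← mul_add, add_sub_cancel, mul_one]

namespace IsCentralSupport

theorem map_compress (hP : IsCentralSupport L F ℒ P) (X : Op p) : L (compress P X) = L X := by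
  rw [compress_apply, hP.map_mul_right, hP.map_mul_left]

theorem map_cut (hP : IsCentralSupport L F ℒ P) {A : Op p} (hA : A ∈ ℒ) : L (P * A) = A := by
  rw [hP.map_mul_left, hP.idempotent.map_eq hA]

theorem compress_eq (hP : IsCentralSupport L F ℒ P) {A : Op p} (hA : A ∈ ℒ) :
    compress P A = P * A := by
  rw [compress_apply, mul_assoc, ← hP.commute A hA, ← mul_assoc, hP.projection.isIdempotentElem.eq]

theorem cut_mul_cut (hP : IsCentralSupport L F ℒ P) {A B : Op p} (hA : A ∈ ℒ) :
    P * A * (P * B) = P * (A * B) := by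
  rw [← mul_assoc, ← hP.compress_eq hA, compress_apply, mul_assoc _ P P,
    hP.projection.isIdempotentElem.eq, ← compress_apply, hP.compress_eq hA, mul_assoc]

theorem isCEIdempotent_cut (hP : IsCentralSupport L F ℒ P) :
    IsCEIdempotent (compress P ∘ₗ L) (ℒ.map (LinearMap.mulLeft ℂ P)) := by
  have hL := hP.idempotent
  have hcp : IsCompletelyPositive (compress P ∘ₗ L) :=
    (compress_completelyPositive hP.projection.isSelfAdjoint.star_eq).comp hL.completelyPositive
  have happ : ∀ X, (compress P ∘ₗ L) X = P * L X := fun X => hP.compress_eq (hL.map_mem X)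
  refine ⟨hcp, hcp.isContractive ?_, fun A => ?_, ?_⟩
  · rw [happ, hP.mul_unit]
    exact hP.projection.le_one
  · rw [LinearMap.comp_apply, LinearMap.comp_apply, hP.map_compress, hL.idempotent]
  · ext X
    rw [LinearMap.mem_range, Submodule.mem_map]
    constructor
    · rintro ⟨Y, rfl⟩
      exact ⟨L Y, hL.map_mem Y, (happ Y).symm⟩
    · rintro ⟨A, hA, rfl⟩
      exact ⟨A, by rw [happ, hL.map_eq hA]; rfl⟩

theorem map_mul_cut (hP : IsCentralSupport L F ℒ P) {A B : Op p}
    (hA : A ∈ ℒ.map (LinearMap.mulLeft ℂ P)) (hB : B ∈ ℒ.map (LinearMap.mulLeft ℂ P)) :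
    (compress P ∘ₗ L) (A * B) = A * B := by
  obtain ⟨a, ha, rfl⟩ := hA
  obtain ⟨b, hb, rfl⟩ := hB
  rw [LinearMap.mulLeft_apply, LinearMap.mulLeft_apply, hP.cut_mul_cut ha, LinearMap.comp_apply,
    hP.map_mul_left, hP.compress_eq (hP.idempotent.map_mem _), hP.mul_map_mul ha hb]

end IsCentralSupport

/-- A ↦ PA is injective on ℒ because L(PA) = A, and it carries the Choi–Effros product to the
ordinary one. -/
theorem IsFactorIso.exists_cut (h : IsFactorIso L ℒ Θ) (hP : IsCentralSupport L F ℒ P) :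
    ∃ Θ' : Matrix (Fin q) (Fin q) ℂ ≃ₗ[ℂ] ℒ.map (LinearMap.mulLeft ℂ P),
      IsFactorIso (compress P ∘ₗ L) (ℒ.map (LinearMap.mulLeft ℂ P)) Θ' := by
  have hinj : Function.Injective ((LinearMap.mulLeft ℂ P).submoduleMap ℒ) := by
    intro A B hAB
    have h1 : P * (A : Op p) = P * (B : Op p) := congrArg Subtype.val hAB
    have h2 := congrArg L h1
    rw [hP.map_cut A.2, hP.map_cut B.2] at h2
    exact Subtype.ext h2
  let e := LinearEquiv.ofBijective _ ⟨hinj, (LinearMap.mulLeft ℂ P).submoduleMap_surjective ℒ⟩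
  have he : ∀ X, ((Θ.trans e X : ℒ.map (LinearMap.mulLeft ℂ P)) : Op p) = P * (Θ X : Op p) :=
    fun X => rfl
  refine ⟨Θ.trans e, hP.isCEIdempotent_cut, fun X => ?_, fun X Y => ?_⟩
  · rw [he, he, h.star_eq, star_mul, hP.projection.isSelfAdjoint.star_eq]
    exact hP.commute _ (h.idempotent.star_mem (Θ X).2)
  · rw [hP.map_mul_cut (Θ.trans e X).2 (Θ.trans e Y).2, he, he, he, h.mul_eq,
      hP.cut_mul_cut (Θ X).2, hP.mul_map_mul (Θ X).2 (Θ Y).2]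

section Subordinate

variable {Θ : Matrix (Fin q) (Fin q) ℂ ≃ₗ[ℂ] LinearMap.range ω}

/-- The central cut of a `q`-weight map whose range is a factor. -/
theorem IsQWeightMap.exists_cut_subordinate (hω : IsQWeightMap ω)
    (h : IsFactorIso L (LinearMap.range ω) Θ) (hq : 0 < q)
    (hP : IsCentralSupport L F (LinearMap.range ω) P) :
    ∃ η, IsQSubordinate ω η ∧ η ≠ 0 ∧
      LinearMap.range η ≤ (LinearMap.range ω).map (LinearMap.mulLeft ℂ P) := by
  have hL := h.idempotent
  obtain ⟨u, hcp, hc, hsub, hmem, hzero⟩ := hω.exists_subordinate_of_splitting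
    (isSplitting_compress hP.projection hP.commute)
    (ℛ := (LinearMap.range ω).map (LinearMap.mulLeft ℂ P))
    (fun A hA => ⟨A, hA, (hP.compress_eq hA).symm⟩)
  refine ⟨_, hsub, fun h0 => ?_, ?_⟩
  -- If the subordinate were zero, u would be the identity on ℒ and L ∘ u an idempotent with range
  -- ℒ. It annihilates P because D'(P) = 0, which is impossible for a factor.
  · have hu : ∀ A ∈ LinearMap.range ω, u A = A := by
      rintro _ ⟨B, rfl⟩
      exact (sub_eq_zero.1 (LinearMap.congr_fun h0 B)).symm
    have hM : IsCEIdempotent (L ∘ₗ u) (LinearMap.range ω) := by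
      refine ⟨hL.completelyPositive.comp hcp, fun A => (hL.contractive _).trans (hc A),
        fun A => ?_, ?_⟩
      · rw [LinearMap.comp_apply, LinearMap.comp_apply, hu _ (hL.map_mem _), hL.idempotent]
      · refine le_antisymm ?_ fun A hA => ⟨A, ?_⟩
        · rintro _ ⟨A, rfl⟩
          exact hL.map_mem _
        · rw [LinearMap.comp_apply, hu A hA, hL.map_eq hA]
    refine h.map_centralSupport_ne_zero hP hq hM ?_
    rw [LinearMap.comp_apply, hzero P ?_, map_zero]
    rw [compress_apply, sub_mul, one_mul, hP.projection.isIdempotentElem.eq, sub_self, zero_mul]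
  · rintro _ ⟨B, rfl⟩
    exact hmem (ω B) ⟨B, rfl⟩

/-- The limit of the boundary representations of a `q`-subordinate is dominated by that of a
`q`-weight map. -/
theorem nonneg_and_le_of_sub {M N : Op p →ₗ[ℂ] Op p} (hM : IsCompletelyPositive M)
    (h : IsCompletelyPositive (N - M)) {A : Op p} (hA : 0 ≤ A) : 0 ≤ M A ∧ M A ≤ N A :=
  ⟨hM.nonneg hA, sub_nonneg.1 (h.nonneg hA)⟩

/-- With M the limit idempotent of η, L ∘ M is dominated by the identity on the factor ℒ, hence is a
scalar l there. If l ≠ 0, M is injective on ℒ and the range of η is large enough. -/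
theorem IsQSubordinate.range_eq_cut (hη : IsQSubordinate ω η) (h0 : IsIndexZero ω)
    (h : IsFactorIso L (LinearMap.range ω) Θ) (hP : IsCentralSupport L F (LinearMap.range ω) P)
    (hne : η ≠ 0) (hle : LinearMap.range η ≤ (LinearMap.range ω).map (LinearMap.mulLeft ℂ P)) :
    LinearMap.range η = (LinearMap.range ω).map (LinearMap.mulLeft ℂ P) := by
  have hL := h.idempotent
  obtain ⟨N, hN, hNlim⟩ := hη.1.exists_repLam_limit h0
  obtain ⟨M, hM, hMlim⟩ := hη.2.1.exists_repLam_limit (hη.isIndexZero h0)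
  have hsub := hη.limit_sub hNlim hMlim
  have hmem : ∀ A ∈ LinearMap.range ω, (L ∘ₗ M) A ∈ LinearMap.range ω := fun A _ => hL.map_mem _
  have hpos : ∀ A ∈ LinearMap.range ω, 0 ≤ A → 0 ≤ (L ∘ₗ M) A ∧ (L ∘ₗ M) A ≤ A := by
    intro A hA hA0
    obtain ⟨h1, h2⟩ := nonneg_and_le_of_sub hM.completelyPositive hsub hA0
    refine ⟨hL.completelyPositive.nonneg h1, (hL.completelyPositive.mono h2).trans_eq ?_⟩
    rw [hN.map_eq hA, hL.map_eq hA]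
  obtain ⟨l, hl⟩ := h.exists_eq_smul hmem hpos
  -- If l = 0, then M(1) ≤ M(N(1)) with N(1) ∈ ℒ gives L(M(1)) = 0. As M(1) ∈ Pℒ is determined by
  -- its image under L, M(1) = 0 and η = 0.
  have hl0 : l ≠ 0 := by
    rintro rfl
    have hM1 : 0 ≤ M 1 := hM.completelyPositive.nonneg zero_le_one
    have h2 : M 1 ≤ M (N 1) := by
      have := hM.completelyPositive.mono
        (nonneg_and_le_of_sub hM.completelyPositive hsub zero_le_one).2
      rwa [hM.idempotent] at this
    have h3 : L (M (N 1)) = 0 := (hl (N 1) (hN.map_mem 1)).trans (op_zero_smul _)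
    have h4 : L (M 1) = 0 := le_antisymm ((hL.completelyPositive.mono h2).trans_eq h3)
      (hL.completelyPositive.nonneg hM1)
    obtain ⟨A, hA, hAM⟩ := hle (hM.map_mem 1)
    rw [LinearMap.mulLeft_apply] at hAM
    rw [← hAM, hP.map_cut hA] at h4
    refine hne (eq_zero_of_range_limit hM ?_)
    rw [← hAM, h4, mul_zero]
  -- Dimension count: dim Pℒ ≤ dim ℒ ≤ dim of the range of η, the last step by injectivity of M on
  -- ℒ.
  refine Submodule.eq_of_le_of_finrank_le hle (le_trans (Submodule.finrank_map_le _ _) ?_)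
  have hMr : ∀ A : LinearMap.range ω, M.domRestrict (LinearMap.range ω) A ∈ LinearMap.range η :=
    fun A => hM.map_mem _
  refine LinearMap.finrank_le_finrank_of_injective
    (f := (M.domRestrict (LinearMap.range ω)).codRestrict (LinearMap.range η) hMr) ?_
  intro A B hAB
  have h1 : M (A : Op p) = M (B : Op p) := congrArg Subtype.val hAB
  have h2 := congrArg L h1
  have hA := hl A A.2
  have hB := hl B B.2
  rw [LinearMap.comp_apply] at hA hB
  rw [hA, hB] at h2
  exact Subtype.ext (smul_right_injective _ hl0 h2)

end Subordinate

end CentralCut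

end QWeight

namespace QWeight

/-! ### Purity forces a trivial centre. -/

section Pure

variable {p : ℕ} {ω η : bAlg p →ₗ[ℂ] Op p} {L : Op p →ₗ[ℂ] Op p} {ℒ : Submodule ℂ (Op p)}
  {F Z W G : Op p}

theorem mul_eq_zero_of_le {A B : Op p} (hB : 0 ≤ B) (hBA : B ≤ A) (hG : star G = G)
    (h : G * A = 0) : G * B = 0 := by
  have hid : IsCEIdempotent (1 : Module.End ℂ (Op p)) ⊤ :=
    ⟨IsCompletelyPositive.id, fun _ => le_rfl, fun _ => rfl, LinearMap.range_id⟩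
  have hsA : star A = A := (IsSelfAdjoint.of_nonneg (hB.trans hBA)).star_eq
  have hsB : star B = B := (IsSelfAdjoint.of_nonneg hB).star_eq
  have h1 : A * G = 0 := hid.map_star_mul_eq_zero hG hsA h
  have h2 : B * G = 0 := hid.map_mul_eq_zero hB hBA trivial hG h1
  exact hid.map_star_mul_eq_zero hsB hG h2

/-- `Z` and `W` are complementary central projections of `F ℒ`, where `F` is the support projection
of `L`. -/
structure IsCentralPair (L : Op p →ₗ[ℂ] Op p) (F : Op p) (ℒ : Submodule ℂ (Op p)) (Z W : Op p) :
    Prop where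
  left : IsStarProjection Z
  right : IsStarProjection W
  add_eq : Z + W = F
  left_mem : F * L Z = Z
  right_mem : F * L W = W
  left_commute : ∀ a ∈ ℒ, Z * a = a * Z
  right_commute : ∀ a ∈ ℒ, W * a = a * W

namespace IsCentralPair

theorem symm (h : IsCentralPair L F ℒ Z W) : IsCentralPair L F ℒ W Z :=
  ⟨h.right, h.left, by rw [add_comm, h.add_eq], h.right_mem, h.left_mem, h.right_commute,
    h.left_commute⟩

theorem mul_support (h : IsCentralPair L F ℒ Z W) (hF : IsSupportProjection L F) : Z * F = Z := by
  refine (h.left.le_iff_mul_eq_left hF.isStarProjection).1 ?_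
  rw [← h.add_eq]
  exact le_add_of_nonneg_right h.right.nonneg

theorem mul_eq_zero (h : IsCentralPair L F ℒ Z W) (hF : IsSupportProjection L F) : Z * W = 0 := by
  have h1 := h.mul_support hF
  rwa [← h.add_eq, mul_add, h.left.isIdempotentElem.eq, add_eq_left] at h1

theorem mul_map_left (h : IsCentralPair L F ℒ Z W) (hF : IsSupportProjection L F) :
    Z * L Z = Z := by
  have h1 : Z * L Z = Z * F * L Z := by rw [h.mul_support hF]
  rw [h1, mul_assoc, h.left_mem, h.left.isIdempotentElem.eq]

/-- L ignores a left factor F and F L(Z) = Z, so under L the compression by L(Z) acts as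
multiplication by Z. -/
theorem map_corner (h : IsCentralPair L F ℒ Z W) (hL : IsCEIdempotent L ℒ)
    (hF : IsSupportProjection L F) {A : Op p} (hA : Z * A = A * Z) :
    L (compress (L Z) A) = L (Z * A) := by
  rw [compress_apply, ← hF.map_mul_left hL hF.isStarProjection le_rfl, ← mul_assoc, ← mul_assoc,
    h.left_mem, hA, mul_assoc, h.mul_map_left hF]

theorem support_mul_map (h : IsCentralPair L F ℒ Z W) (hL : IsCEIdempotent L ℒ)
    (hF : IsSupportProjection L F) {A : Op p} (hA : A ∈ ℒ) : F * L (Z * A) = Z * A := by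
  conv_lhs => rw [← h.left_mem, mul_assoc, hF.map_mul_left hL hF.isStarProjection le_rfl,
    hF.mul_map_mul hL (hL.map_mem Z) hA, ← mul_assoc, h.left_mem]

theorem isSplitting (h : IsCentralPair L F ℒ Z W) (hL : IsCEIdempotent L ℒ)
    (hF : IsSupportProjection L F) :
    IsSplitting (L ∘ₗ compress (L Z)) (L ∘ₗ compress (L W)) ℒ where
  left := hL.completelyPositive.comp (compress_completelyPositive
    (by rw [← hL.completelyPositive.map_star, h.left.isSelfAdjoint.star_eq]))
  right := hL.completelyPositive.comp (compress_completelyPositive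
    (by rw [← hL.completelyPositive.map_star, h.right.isSelfAdjoint.star_eq]))
  one_le := by
    rw [LinearMap.comp_apply, LinearMap.comp_apply, h.map_corner hL hF (by rw [mul_one, one_mul]),
      h.symm.map_corner hL hF (by rw [mul_one, one_mul]), ← map_add, ← add_mul, h.add_eq, mul_one,
      hF.1.2]
    exact hL.one_le
  add_eq A hA := by
    rw [LinearMap.comp_apply, LinearMap.comp_apply, h.map_corner hL hF (h.left_commute A hA),
      h.symm.map_corner hL hF (h.right_commute A hA), ← map_add, ← add_mul, h.add_eq,
      hF.map_mul_left hL hF.isStarProjection le_rfl, hL.map_eq hA]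

theorem exists_subordinate (hω : IsQWeightMap ω) (h : IsCentralPair L F (LinearMap.range ω) Z W)
    (hL : IsCEIdempotent L (LinearMap.range ω)) (hF : IsSupportProjection L F) (hZ : Z ≠ 0) :
    ∃ η, IsQSubordinate ω η ∧ η ≠ 0 ∧
      ∀ A ∈ LinearMap.range η, A ∈ LinearMap.range ω ∧ W * A = 0 := by
  obtain ⟨u, -, -, hsub, hmem, hzero⟩ := hω.exists_subordinate_of_splitting (h.isSplitting hL hF)
    (ℛ := LinearMap.range ω ⊓ LinearMap.ker (LinearMap.mulLeft ℂ W)) (fun A hA => by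
      refine ⟨hL.map_mem _, ?_⟩
      change W * (L ∘ₗ compress (L Z)) A = 0
      rw [LinearMap.comp_apply, h.map_corner hL hF (h.left_commute A hA), ← h.symm.mul_support hF, mul_assoc, h.support_mul_map hL hF hA,
        ← mul_assoc, h.symm.mul_eq_zero hF, zero_mul])
  refine ⟨_, hsub, fun h0 => hZ ?_, ?_⟩
  -- D' annihilates L(Z) because Z and W are orthogonal. So L(Z) ∈ ℒ is never stopped and shows that
  -- the subordinate is not zero.
  · have hz : u (L Z) = 0 := by
      refine hzero _ ?_
      rw [LinearMap.comp_apply, h.symm.map_corner hL hF (h.right_commute _ (hL.map_mem Z)),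
        ← h.symm.mul_support hF, mul_assoc, h.left_mem, h.symm.mul_eq_zero hF, map_zero]
    obtain ⟨B, hB⟩ := hL.map_mem Z
    have h1 : ω B - u (ω B) = 0 := LinearMap.congr_fun h0 B
    rw [hB, hz, sub_zero] at h1
    rw [← h.left_mem, h1, mul_zero]
  · rintro _ ⟨B, rfl⟩
    exact hmem (ω B) ⟨B, rfl⟩

/-- The cuts by complementary central projections are not comparable. -/
theorem not_isQSubordinate {η₁ η₂ : bAlg p →ₗ[ℂ] Op p} (h : IsCentralPair L F (LinearMap.range ω) Z W)
    (hL : IsCEIdempotent L (LinearMap.range ω)) (hF : IsSupportProjection L F)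
    (h1 : IsIndexZero η₁) (hne : η₂ ≠ 0) (hW : ∀ A ∈ LinearMap.range η₁, W * A = 0)
    (hZ : ∀ A ∈ LinearMap.range η₂, A ∈ LinearMap.range ω ∧ Z * A = 0) :
    ¬ IsQSubordinate η₁ η₂ := by
  intro hsub
  obtain ⟨M₁, hM₁, hlim₁⟩ := hsub.1.exists_repLam_limit h1
  obtain ⟨M₂, hM₂, hlim₂⟩ := hsub.2.1.exists_repLam_limit (hsub.isIndexZero h1)
  obtain ⟨h2, h3⟩ := nonneg_and_le_of_sub hM₂.completelyPositive (hsub.limit_sub hlim₁ hlim₂)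
    zero_le_one
  -- M₂(1) ≤ M₁(1) forces W M₂(1) = 0, and Z M₂(1) = 0 already. So F M₂(1) = 0, and L recovers M₂(1)
  -- = 0.
  have h4 := mul_eq_zero_of_le h2 h3 h.right.isSelfAdjoint.star_eq (hW _ (hM₁.map_mem 1))
  obtain ⟨h5, h6⟩ := hZ _ (hM₂.map_mem 1)
  refine hne (eq_zero_of_range_limit hM₂ ?_)
  rw [← hL.map_eq h5, ← hF.map_mul_left hL hF.isStarProjection le_rfl, ← h.add_eq, add_mul, h6, h4,
    add_zero, map_zero]

end IsCentralPair

/-- The range of a `q`-pure `q`-weight map of index zero is a Choi–Effros factor. -/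
theorem IsQPure.exists_isFactorIso (hpure : IsQPure ω) (h0 : IsIndexZero ω) (hne : ω ≠ 0) :
    ∃ q : ℕ, 0 < q ∧ ∃ (L : Op p →ₗ[ℂ] Op p)
      (Θ : Matrix (Fin q) (Fin q) ℂ ≃ₗ[ℂ] LinearMap.range ω),
      IsFactorIso L (LinearMap.range ω) Θ := by
  obtain ⟨hω, hpure⟩ := hpure
  obtain ⟨L, hL, -⟩ := hω.exists_repLam_limit h0
  obtain ⟨F, hF, -⟩ := exists_supportProjection hL.completelyPositive
  set ℒ := LinearMap.range ω with hℒ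
  have hFF := hF.isStarProjection.isIdempotentElem.eq
  have hFs := hF.isStarProjection.isSelfAdjoint.star_eq
  have hback : ∀ a ∈ ℒ, L (F * a) = a := fun a ha => by
    rw [hF.map_mul_left hL hF.isStarProjection le_rfl, hL.map_eq ha]
  have hcut : ∀ a ∈ ℒ, ∀ b, F * a * (F * b) = F * (a * b) := fun a ha b => by
    rw [hF.commute hL ha, mul_assoc, ← mul_assoc F F, hFF, ← mul_assoc, ← hF.commute hL ha,
      mul_assoc]
  -- Fℒ is closed under the ordinary product, so it can be treated as a *-algebra of operators; L
  -- maps it back to ℒ.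
  let N := ℒ.map (LinearMap.mulLeft ℂ F)
  have hN : IsStarSubalgebra N := by
    constructor
    · rintro _ ⟨a, ha, rfl⟩ _ ⟨b, hb, rfl⟩
      refine ⟨L (a * b), hL.map_mem _, ?_⟩
      rw [LinearMap.mulLeft_apply, LinearMap.mulLeft_apply, LinearMap.mulLeft_apply, hcut a ha,
        hF.mul_map_mul hL ha hb]
    · rintro _ ⟨a, ha, rfl⟩
      refine ⟨star a, hL.star_mem ha, ?_⟩
      rw [LinearMap.mulLeft_apply, LinearMap.mulLeft_apply, star_mul, hFs,
        hF.commute hL (hL.star_mem ha)]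
  have hN0 : N ≠ ⊥ := by
    intro hbot
    refine hne (LinearMap.range_eq_bot.1 ((Submodule.eq_bot_iff _).2 fun a ha => ?_))
    have h1 : F * a ∈ N := ⟨a, ha, rfl⟩
    rw [hbot, Submodule.mem_bot] at h1
    rw [← hback a ha, h1, map_zero]
  have hcentral : ∀ Z ∈ N, IsStarProjection Z → (∀ a ∈ N, Z * a = a * Z) → Z ≠ 0 →
      ∀ a ∈ N, Z * a = a := by
    rintro _ ⟨z, hz, rfl⟩ hZ hZc hZ0
    rw [LinearMap.mulLeft_apply] at hZ hZc hZ0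
    have hLZ := hback z hz
    have hFZ : F * (F * z) = F * z := by rw [← mul_assoc, hFF]
    have hFzF : F * z * F = F * z := by rw [mul_assoc, ← hF.commute hL hz, hFZ]
    set Z := F * z with hZdef
    have hcomm : ∀ a ∈ ℒ, Z * a = a * Z := by
      intro a ha
      have h1 := hZc (F * a) ⟨a, ha, rfl⟩
      rw [← mul_assoc, hFzF] at h1
      rw [h1, hF.commute hL ha, mul_assoc, hFZ]
    by_contra! hcon
    obtain ⟨a, ⟨b, hb, rfl⟩, hab⟩ := hcon
    change Z * (F * b) ≠ F * b at hab
    have hW0 : F - Z ≠ 0 := by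
      intro hW
      rw [← sub_eq_zero.1 hW, ← mul_assoc, hFF] at hab
      exact hab rfl
    have hpair : IsCentralPair L F ℒ Z (F - Z) := by
      refine ⟨hZ, ⟨?_, ?_⟩, add_sub_cancel _ _, by rw [hLZ], ?_, hcomm, fun c hc => ?_⟩
      · rw [IsIdempotentElem, mul_sub, sub_mul, sub_mul, hFF, hFZ, hFzF, hZ.isIdempotentElem.eq,
          sub_self, sub_zero]
      · rw [IsSelfAdjoint, op_star_sub, hFs, hZ.isSelfAdjoint.star_eq]
      · rw [map_sub, hLZ, hF.1.2, mul_sub, hF.mul_unit hL]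
      · rw [sub_mul, mul_sub, hcomm c hc, hF.commute hL hc]
    obtain ⟨η₁, hη₁, hne₁, hr₁⟩ := hpair.exists_subordinate hω hL hF hZ0
    obtain ⟨η₂, hη₂, hne₂, hr₂⟩ := hpair.symm.exists_subordinate hω hL hF hW0
    -- The subordinates belonging to Z and to F - Z cannot be comparable in either order, contrary
    -- to purity.
    rcases hpure η₁ η₂ hη₁ hη₂ with h1 | h1
    · exact hpair.not_isQSubordinate hL hF (hη₁.isIndexZero h0) hne₂ (fun A hA => (hr₁ A hA).2)
        hr₂ h1
    · exact hpair.symm.not_isQSubordinate hL hF (hη₂.isIndexZero h0) hne₁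
        (fun A hA => (hr₂ A hA).2) hr₁ h1
  obtain ⟨q, hq, Θ, hΘs, hΘm⟩ := hN.exists_matrix_equiv hN0 hcentral
  have hinj : Function.Injective ((LinearMap.mulLeft ℂ F).submoduleMap ℒ) := by
    intro A B hAB
    have h1 : F * (A : Op p) = F * (B : Op p) := congrArg Subtype.val hAB
    have h2 := congrArg L h1
    rw [hback _ A.2, hback _ B.2] at h2
    exact Subtype.ext h2
  let e := LinearEquiv.ofBijective _ ⟨hinj, (LinearMap.mulLeft ℂ F).submoduleMap_surjective ℒ⟩
  have he : ∀ X, F * (Θ.trans e.symm X : Op p) = (Θ X : Op p) := fun X =>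
    congrArg Subtype.val (e.apply_symm_apply (Θ X))
  have hext : ∀ a ∈ ℒ, ∀ b ∈ ℒ, F * a = F * b → a = b := fun a ha b hb hab => by
    rw [← hback a ha, hab, hback b hb]
  refine ⟨q, hq, L, Θ.trans e.symm, hL, fun X => ?_, fun X Y => ?_⟩
  · refine hext _ (Θ.trans e.symm _).2 _ (hL.star_mem (Θ.trans e.symm X).2) ?_
    rw [he, hΘs, ← he, star_mul, hFs, hF.commute hL (hL.star_mem (Θ.trans e.symm X).2)]
  · refine hext _ (Θ.trans e.symm _).2 _ (hL.map_mem _) ?_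
    rw [he, hΘm, ← he, ← he, hcut _ (Θ.trans e.symm X).2,
      hF.mul_map_mul hL (Θ.trans e.symm X).2 (Θ.trans e.symm Y).2]

end Pure

end QWeight

namespace QWeight

/-! ### Scalar stopping and the identification of the unit. -/

section Scaling

variable {p q : ℕ} {ω η : bAlg p →ₗ[ℂ] Op p} {L : Op p →ₗ[ℂ] Op p} {ℒ : Submodule ℂ (Op p)}
  {F P : Op p}

theorem sub_eq_of_eq_smul {V : Type*} [AddCommGroup V] [Module ℂ V] (φ : V →ₗ[ℂ] V) {a b w : V}
    {x y : ℂ} (ha : a = (1 - x) • (φ a + w)) (hb : b = (1 - y) • (φ b + w)) :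
    a - b = (1 - x) • φ (a - b) + (y - x) • (φ b + w) := by
  conv_lhs => rw [ha, hb]
  rw [map_sub]
  module

theorem isSplitting_smul {e : ℝ} (h0 : 0 ≤ e) (h1 : e ≤ 1) :
    IsSplitting (((1 - e : ℝ) : ℂ) • 1) ((e : ℂ) • 1) ℒ := by
  have hadd : ∀ A : Op p, ((((1 - e : ℝ) : ℂ) • 1 : Module.End ℂ (Op p)) A) +
      (((e : ℂ) • 1 : Module.End ℂ (Op p)) A) = A := fun A => by
    rw [LinearMap.smul_apply, LinearMap.smul_apply, Module.End.one_apply, ← add_smul,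
      ← Complex.ofReal_add, sub_add_cancel, Complex.ofReal_one, one_smul]
  exact ⟨IsCompletelyPositive.id.smul (Complex.zero_le_real.2 (sub_nonneg.2 h1)),
    IsCompletelyPositive.id.smul (Complex.zero_le_real.2 h0), (hadd 1).le, fun A _ => hadd A⟩

/-- Intermediate value theorem in the stopping rate e: at e = 0 nothing is stopped and X remains, at
e = 1 everything is stopped. -/
theorem exists_smul_stopped_norm {Y : Module.End ℂ (Op p)} (hY : IsStrictContraction Y)
    (hcp : IsCompletelyPositive Y) (hY1 : Y 1 ≤ 1) {X : Op p} {d : ℝ} (hd : 0 ≤ d) (hdX : d ≤ ‖X‖) :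
    ∃ e : ℝ, (0 ≤ e ∧ e ≤ 1) ∧
      ‖X - stopped (((1 - e : ℝ) : ℂ) • 1) ((e : ℂ) • 1) Y X‖ = d := by
  set g : ℝ → Op p := fun e => X - stopped (((1 - e : ℝ) : ℂ) • 1) ((e : ℂ) • 1) Y X with hg
  have heq : ∀ e ∈ Set.Icc (0 : ℝ) 1, g e = ((1 - e : ℝ) : ℂ) • (Y (g e) + (X - Y X)) := by
    intro e he
    have h1 := (isSplitting_smul (ℒ := ⊤) he.1 he.2).sub_stopped hY (A := X) trivial
    rw [sub_eq_iff_eq_add, add_comm, LinearMap.smul_apply, LinearMap.smul_apply,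
      Module.End.one_apply, Module.End.one_apply, ← smul_add] at h1
    exact h1
  have hbound : ∀ e ∈ Set.Icc (0 : ℝ) 1, ‖g e‖ ≤ 2 * ‖X‖ := by
    intro e he
    refine (norm_sub_le _ _).trans ?_
    have := (isSplitting_smul (ℒ := (⊤ : Submodule ℂ (Op p))) he.1 he.2).stopped_contractive hY hcp
      hY1 X
    linarith
  have h0 : g 0 = X := by
    rw [hg]
    change X - neumann _ (((0 : ℝ) : ℂ) • X) = X
    rw [Complex.ofReal_zero, op_zero_smul, map_zero, sub_zero]
  have h1 : g 1 = 0 := by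
    rw [heq 1 ⟨zero_le_one, le_rfl⟩, sub_self, Complex.ofReal_zero, op_zero_smul]
  obtain ⟨c, hc0, hc1, hc⟩ := hY
  have hnorm : ∀ e ∈ Set.Icc (0 : ℝ) 1, ‖((1 - e : ℝ) : ℂ)‖ ≤ 1 := by
    intro e he
    rw [Complex.norm_real, Real.norm_eq_abs, abs_le]
    constructor <;> linarith [he.1, he.2]
  -- Subtracting the fixed-point equations of g at x and y bounds (1 - c)‖g x - g y‖ by K |x - y|.
  set K := c * (2 * ‖X‖) + ‖X - Y X‖ with hK
  have hlip : ∀ x ∈ Set.Icc (0 : ℝ) 1, ∀ y ∈ Set.Icc (0 : ℝ) 1,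
      dist (g x) (g y) ≤ (Real.toNNReal (K / (1 - c)) : ℝ) * dist x y := by
    intro x hx y hy
    have h2 : g x - g y = ((1 - x : ℝ) : ℂ) • Y (g x - g y) +
        ((y - x : ℝ) : ℂ) • (Y (g y) + (X - Y X)) := by
      have hx' := heq x hx
      have hy' := heq y hy
      rw [Complex.ofReal_sub, Complex.ofReal_one] at hx' hy'
      rw [Complex.ofReal_sub, Complex.ofReal_one, Complex.ofReal_sub]
      exact sub_eq_of_eq_smul Y hx' hy'
    have h3 : ‖g x - g y‖ ≤ c * ‖g x - g y‖ + dist x y * K := by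
      conv_lhs => rw [h2]
      refine (norm_add_le _ _).trans (add_le_add ?_ ?_)
      · rw [norm_smul]
        exact (mul_le_of_le_one_left (norm_nonneg _) (hnorm x hx)).trans (hc _)
      · rw [norm_smul, Complex.norm_real, dist_comm, ← dist_eq_norm]
        refine mul_le_mul_of_nonneg_left ((norm_add_le _ _).trans ?_) dist_nonneg
        exact add_le_add ((hc _).trans (mul_le_mul_of_nonneg_left (hbound y hy) hc0)) le_rfl
    have hK0 : 0 ≤ K := by positivity
    rw [Real.coe_toNNReal _ (div_nonneg hK0 (by linarith)), dist_eq_norm, div_mul_eq_mul_div,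
      le_div_iff₀ (by linarith)]
    linarith
  have hcont : ContinuousOn (fun e => ‖g e‖) (Set.Icc 0 1) :=
    (LipschitzOnWith.of_dist_le_mul hlip).continuousOn.norm
  obtain ⟨e, he, hed⟩ := intermediate_value_Icc' zero_le_one hcont
    (show d ∈ Set.Icc ‖g 1‖ ‖g 0‖ by rw [h0, h1, norm_zero]; exact ⟨hd, hdX⟩)
  exact ⟨e, he, hed⟩

/-- Every `q`-weight map has `q`-subordinates with prescribed smaller norm of a truncation. -/
theorem IsQWeightMap.exists_subordinate_norm (hω : IsQWeightMap ω) {t d : ℝ} (hd : 0 ≤ d)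
    (hdt : d ≤ ‖trunc ω t 1‖) :
    ∃ η, IsQSubordinate ω η ∧ ‖trunc η t 1‖ = d ∧ LinearMap.range η ≤ LinearMap.range ω := by
  -- The rate e must depend on r: if Y_r tends to the identity on ℒ, a fixed positive rate stops
  -- everything in the limit. Keeping the norm equal to d at every r makes it survive the limit.
  have hex : ∀ r : ℝ, ∃ e : ℝ, 0 < r → (0 ≤ e ∧ e ≤ 1) ∧
      ‖trunc ω t 1 - stopped (((1 - e : ℝ) : ℂ) • 1) ((e : ℂ) • 1) (repLam ω r) (trunc ω t 1)‖ =
        d := by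
    intro r
    by_cases hr : 0 < r
    · obtain ⟨e, he⟩ := exists_smul_stopped_norm (hω.isStrict hr) (hω.repLam_cp hr)
        (hω.repLam_one_le hr) hd hdt
      exact ⟨e, fun _ => he⟩
    · exact ⟨0, fun h => absurd h hr⟩
  choose e he using hex
  have hD : ∀ r, 0 < r → IsSplitting (((1 - e r : ℝ) : ℂ) • 1) ((e r : ℂ) • 1)
      (LinearMap.range ω) := fun r hr => isSplitting_smul (he r hr).1.1 (he r hr).1.2
  obtain ⟨u, -, -, hlim⟩ := hω.exists_stopped_limit hD
  refine ⟨_, hω.isQSubordinate_of_splitting hD hlim, ?_, ?_⟩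
  · have h1 := ((hlim (trunc ω t 1)).const_sub (trunc ω t 1)).norm
    refine tendsto_nhds_unique h1 (tendsto_const_nhds.congr' ?_)
    exact eventually_zeroUltrafilter_pos.mono fun r hr => (he r hr).2.symm
  · rintro _ ⟨B, rfl⟩
    refine hω.sub_limit_mem hD hlim (fun r _ A hA => ?_) (LinearMap.mem_range_self ω B)
    rw [LinearMap.smul_apply]
    exact Submodule.smul_mem _ _ hA

/-- The unit of the range of a `q`-pure `q`-weight map is its maximal support projection. -/
theorem IsQPure.unit_eq (hpure : IsQPure ω) (h0 : IsIndexZero ω) (hq : 0 < q)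
    {Θ : Matrix (Fin q) (Fin q) ℂ ≃ₗ[ℂ] LinearMap.range ω}
    (h : IsFactorIso L (LinearMap.range ω) Θ) (hP : IsCentralSupport L F (LinearMap.range ω) P) :
    L 1 = P := by
  obtain ⟨hω, hpure⟩ := hpure
  have hL := h.idempotent
  obtain ⟨η₁, hη₁, hne₁, hr₁⟩ := hω.exists_cut_subordinate h hq hP
  obtain ⟨t, ht, htne⟩ := hη₁.2.1.exists_trunc_one_ne_zero hne₁
  have hpos : 0 < ‖trunc η₁ t 1‖ := norm_pos_iff.2 htne
  -- Half the norm of the truncated cut: η₂ is not zero but too small to dominate η₁, so purity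
  -- gives η₁ ≥_q η₂.
  obtain ⟨η₂, hη₂, hd, hr₂⟩ := hω.exists_subordinate_norm (t := t) (d := ‖trunc η₁ t 1‖ / 2)
    (by positivity) (by linarith [hη₁.norm_trunc_one_le ht])
  have hne₂ : η₂ ≠ 0 := by
    rintro rfl
    have : trunc (0 : bAlg p →ₗ[ℂ] Op p) t 1 = 0 := rfl
    rw [this, norm_zero] at hd
    linarith
  have hsub : IsQSubordinate η₁ η₂ := by
    refine (hpure η₁ η₂ hη₁ hη₂).resolve_right fun hs => ?_
    have := hs.norm_trunc_one_le ht
    linarith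
  obtain ⟨N, hN, hNlim⟩ := hω.exists_repLam_limit h0
  obtain ⟨M₁, hM₁, hlim₁⟩ := hη₁.2.1.exists_repLam_limit (hη₁.isIndexZero h0)
  obtain ⟨M₂, hM₂, hlim₂⟩ := hη₂.2.1.exists_repLam_limit (hη₂.isIndexZero h0)
  have hle₂ := hη₂.limit_sub hNlim hlim₂
  have hle₁₂ := hsub.limit_sub hlim₁ hlim₂
  obtain ⟨l, hl⟩ := h.exists_eq_smul (Φ := M₂) (fun A _ => hr₂ (hM₂.map_mem A)) fun A hA hA0 => by
    have h1 := nonneg_and_le_of_sub hM₂.completelyPositive hle₂ hA0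
    rwa [hN.map_eq hA] at h1
  have hM₂1 : M₂ 1 ≠ 0 := fun h1 => hne₂ (eq_zero_of_range_limit hM₂ h1)
  -- A non-zero idempotent that acts on ℒ as a scalar and has its range inside ℒ is the identity on
  -- ℒ.
  have hl1 : l = 1 := by
    have h1 := hl (M₂ 1) (hr₂ (hM₂.map_mem 1))
    rw [hM₂.idempotent] at h1
    exact smul_left_injective ℂ hM₂1 (h1.symm.trans (one_smul ℂ _).symm)
  have hu : M₂ (L 1) = L 1 := by rw [hl _ (hL.map_mem 1), hl1, one_smul]
  -- I_o = M₂(I_o) ≤ M₂(1) ≤ M₁(1), and M₁(1) lies in Pℒ. Hence (1 - P) I_o = 0, while P I_o = P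
  -- always holds.
  have hle : L 1 ≤ M₁ 1 := by
    refine le_trans ?_ (nonneg_and_le_of_sub hM₂.completelyPositive hle₁₂ zero_le_one).2
    rw [← hu]
    exact hM₂.completelyPositive.mono hL.one_le
  have hcut : (1 - P) * M₁ 1 = 0 := by
    obtain ⟨A, hA, hAM⟩ := hr₁ (hM₁.map_mem 1)
    rw [← hAM, LinearMap.mulLeft_apply, ← mul_assoc, sub_mul, one_mul,
      hP.projection.isIdempotentElem.eq, sub_self, zero_mul]
  have h1 := mul_eq_zero_of_le (hL.completelyPositive.nonneg zero_le_one) hle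
    hP.projection.one_sub.isSelfAdjoint.star_eq hcut
  rw [sub_mul, one_mul, hP.mul_unit, sub_eq_zero] at h1
  exact h1

/-- If the unit is the maximal support projection, then `ℒ` is cut down by it. -/
theorem IsCentralSupport.mul_eq_of_unit_eq (hP : IsCentralSupport L F ℒ P) (h : L 1 = P) {A : Op p}
    (hA : A ∈ ℒ) : P * A = A := by
  have hle := hP.idempotent.nonneg_smul_unit hA
  rw [h] at hle
  have h1 : (1 - P) * ((‖A‖ ^ 2) • P) = 0 := by
    have h2 : (1 - P) * P = 0 := by
      rw [sub_mul, one_mul, hP.projection.isIdempotentElem.eq, sub_self]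
    refine ContinuousLinearMap.ext fun x => ?_
    have h3 := DFunLike.congr_fun h2 ((‖A‖ ^ 2) • x)
    rw [mul_apply_eq_comp] at h3 ⊢
    rw [smul_apply, ← Complex.coe_smul, ← map_smul, Complex.coe_smul]
    exact h3
  have h2 := mul_eq_zero_of_le (star_mul_self_nonneg A) hle
    hP.projection.one_sub.isSelfAdjoint.star_eq h1
  have h3 : A * (1 - P) = 0 := by
    refine op_star_mul_self_eq_zero _ ?_
    rw [star_mul, hP.projection.one_sub.isSelfAdjoint.star_eq, mul_assoc, ← mul_assoc (star A),
      ← mul_assoc, h2, zero_mul]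
  rw [mul_sub, mul_one, ← hP.commute A hA, sub_eq_zero] at h3
  exact h3.symm

theorem IsCentralSupport.map_mul_of_unit_eq (hP : IsCentralSupport L F ℒ P) (h : L 1 = P)
    {A B : Op p} (hA : A ∈ ℒ) (hB : B ∈ ℒ) : L (A * B) = A * B := by
  rw [← hP.mul_eq_of_unit_eq h (hP.idempotent.map_mem (A * B)), hP.mul_map_mul hA hB, ← mul_assoc,
    hP.mul_eq_of_unit_eq h hA]

end Scaling

end QWeight

/-! ### The theorem. -/

theorem theorem5p22 (p : ℕ) (ω : QWeight.bAlg p →ₗ[ℂ] QWeight.Op p)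
    (hω : QWeight.IsQWeightMap ω) (h0 : QWeight.IsIndexZero ω) :
    -- a `q`-subordinate whose range is `Pℒ`, with the ordinary product
    (∀ (q : ℕ) (P : QWeight.Op p),
      QWeight.IsChoiEffrosFactor q (LinearMap.range ω) →
      QWeight.IsMaximalSupportProjection (LinearMap.range ω) P →
      ∃ η : QWeight.bAlg p →ₗ[ℂ] QWeight.Op p,
        QWeight.IsQSubordinate ω η ∧
        LinearMap.range η = (LinearMap.range ω).map (LinearMap.mulLeft ℂ P) ∧
        QWeight.IsChoiEffrosFactor q (LinearMap.range η) ∧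
        ∀ L : QWeight.Op p →ₗ[ℂ] QWeight.Op p,
          QWeight.IsCEIdempotent L (LinearMap.range η) →
          ∀ A ∈ LinearMap.range η, ∀ B ∈ LinearMap.range η, L (A * B) = A * B) ∧
    -- the `q`-pure case
    (QWeight.IsQPure ω → ω ≠ 0 →
      (∃ q : ℕ, QWeight.IsTypeIFactor q (LinearMap.range ω) ∧
        QWeight.IsChoiEffrosFactor q (LinearMap.range ω)) ∧
      (∀ L : QWeight.Op p →ₗ[ℂ] QWeight.Op p,
        QWeight.IsCEIdempotent L (LinearMap.range ω) →
        ∀ A ∈ LinearMap.range ω, ∀ B ∈ LinearMap.range ω, L (A * B) = A * B) ∧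
      (∃ P : QWeight.Op p, QWeight.IsMaximalSupportProjection (LinearMap.range ω) P) ∧
      ∀ (L : QWeight.Op p →ₗ[ℂ] QWeight.Op p) (P : QWeight.Op p),
        QWeight.IsCEIdempotent L (LinearMap.range ω) →
        QWeight.IsMaximalSupportProjection (LinearMap.range ω) P → L 1 = P) := by
  constructor
  · rintro q P ⟨hq, L₀, hL₀, Θ, hΘs, hΘm⟩ hmax
    obtain ⟨L, F, hP⟩ := hmax.exists_isCentralSupport
    -- The idempotent witnessing the factor and the one defining P may differ, but the Choi–Effros
    -- product depends on the range only.
    have h : QWeight.IsFactorIso L (LinearMap.range ω) Θ :=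
      QWeight.IsFactorIso.of_idempotent ⟨hL₀, hΘs, hΘm⟩ hP.idempotent
    obtain ⟨η, hη, hne, hle⟩ := hω.exists_cut_subordinate h hq hP
    have hr := hη.range_eq_cut h0 h hP hne hle
    obtain ⟨Θ', h'⟩ := h.exists_cut hP
    refine ⟨η, hη, hr, ?_, ?_⟩
    · rw [hr]
      exact ⟨hq, _, h'.idempotent, Θ', h'.star_eq, h'.mul_eq⟩
    · rw [hr]
      intro L' hL' A hA B hB
      rw [hL'.map_mul_eq h'.idempotent hA hB, hP.map_mul_cut hA hB]
  · intro hpure hne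
    obtain ⟨q, hq, L₀, Θ, h₀⟩ := hpure.exists_isFactorIso h0 hne
    have hL₀ := h₀.idempotent
    have key : ∀ P, QWeight.IsMaximalSupportProjection (LinearMap.range ω) P →
        ∃ L F, QWeight.IsCentralSupport L F (LinearMap.range ω) P ∧ L 1 = P := by
      intro P hmax
      obtain ⟨L, F, hP⟩ := hmax.exists_isCentralSupport
      exact ⟨L, F, hP, hpure.unit_eq h0 hq (h₀.of_idempotent hP.idempotent) hP⟩
    obtain ⟨P, hmax⟩ := hL₀.exists_maximalSupportProjection
    obtain ⟨L, F, hP, h1⟩ := key P hmax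
    have h := h₀.of_idempotent hP.idempotent
    refine ⟨⟨q, ⟨hq, Θ, h.star_eq, fun X Y => ?_⟩, hq, L, h.idempotent, Θ, h.star_eq, h.mul_eq⟩,
      fun L' hL' A hA B hB => ?_, ⟨P, hmax⟩, fun L' P' hL' hmax' => ?_⟩
    · rw [h.mul_eq, hP.map_mul_of_unit_eq h1 (Θ X).2 (Θ Y).2]
    · rw [hL'.map_mul_eq h.idempotent hA hB, hP.map_mul_of_unit_eq h1 hA hB]
    · obtain ⟨L'', F'', hP'', h1''⟩ := key P' hmax'
      rw [hL'.unit_eq hP''.idempotent, h1'']
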